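/- **Theorem 2.1.** Let $s\ge 2$ be an integer, let $\widehat{\mathbb C}=\mathbb C\cup\{\infty\}$ be the Riemann sphere, let $S_n$ be the symmetric group, and let $\Delta\subset\widehat{\mathbb C}^s$ be the set of tuples with two equal entries. Consider the following three spaces. 1. *Coefficients.* $\Omega^1_{coef}(-1^s)$ is the Zariski open subset of $\mathbb{CP}^{2s-1}$ of all $[a_{s-2}:\dots:a_0:b_s:\dots:b_0]$ such that, with $Q(z)=a_{s-2}z^{s-2}+\dots+a_0$ and $P(z)=b_sz^s+\dots+b_0$, the resultant of $P$ and $Q$ (as forms of degrees $s$ and $s-2$) and the discriminant of $P$ (as a form of degree $s$) are both non-zero. 2. *Zeros–poles.* The symmetric product $\widehat{\mathbb C}^n/S_n$ is identified with $\mathbb{CP}^n$ by $\{p_1,\dots,p_n\}\mapsto[\nu_n(1,\{p_1,\dots,p_n\})]$, where the Viète map $\nu_n(b,\{p_1,\dots,p_n\})$ is the vector of the coefficients of $z^n,\dots,z^0$ in $b\prod_i(z-p_i)$, the factors with $p_i=\infty$ being omitted; for finite $p_i$ it is $(b,-b\sum_i p_i,\dots,(-1)^n b\prod_i p_i)$.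 Let $M_s$ be the open set of all $u=(\{c_1,\dots,c_{s-2}\},\{p_1,\dots,p_s\})$ in $\widehat{\mathbb C}^{s-2}/S_{s-2}\times(\widehat{\mathbb C}^s\setminus\Delta)/S_s$ with $c_j\ne p_\iota$ for all $j,\iota$, and put $Q_u(z)=\prod_j(z-c_j)$ and $P_u(z)=\prod_\iota(z-p_\iota)$, factors belonging to $\infty$ being omitted. Then $\Omega^1_{zp}(-1^s)$ is the total space of the principal $\mathbb C^*$-bundle over $M_s$ with trivializing sets $\mathcal U_\alpha=\{u\in M_s: Q_u(\alpha)\neq0,\ P_u(\alpha)\ne0\}$, $\alpha\in\{1,\dots,2s-1\}$, and transition functions $\phi_{\alpha\beta}(u)=\frac{Q_u(\alpha)}{P_u(\alpha)}\cdot\frac{P_u(\beta)}{Q_u(\beta)}$, where the points with coordinates $(u,\lambda_\alpha)$ over $\mathcal U_\alpha$ and $(u,\lambda_\beta)$ over $\mathcal U_\beta$ are identified if $\lambda_\alpha=\phi_{\alpha\beta}(u)\lambda_\beta$. Write $[u,\lambda]_\alpha$ for the point with coordinates $(u,\lambda)$ over $\mathcal U_\alpha$. 3. *Residues–poles.* Let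 $H_s=\{r\in(\mathbb C^*)^s: r_1+\dots+r_s=0\}$. Then $\Omega^1_{rp}(-1^s)=\big(H_s\times(\widehat{\mathbb C}^s\setminus\Delta)\big)/S_s$ for the diagonal action of $S_s$ permuting the entries of $r$ and $p$ simultaneously. The class of $(r,p)$ is written $\langle r_1,\dots,r_s;p_1,\dots,p_s\rangle$. With their natural complex structures, these are complex manifolds (Hausdorff, second countable) of dimension $2s-1$, and they are pairwise biholomorphic. More precisely, the following maps are well defined and biholomorphic: * $\mathcal F_s:\Omega^1_{zp}(-1^s)\to\Omega^1_{coef}(-1^s)$ given, for $\alpha\in\{1,\dots,2s-1\}$, $u\in\mathcal U_\alpha$ and $\lambda\in\mathbb C^*$, by $$\mathcal F_s([u,\lambda]_\alpha)=\Big[\lambda\tfrac{P_u(\alpha)}{Q_u(\alpha)}\,\nu_{s-2}(1,\{c_1,\dots,c_{s-2}\}):\nu_s(1,\{p_1,\dots,p_s\})\Big];$$ * $C_s:\Omega^1_{rp}(-1^s)\to\Omega^1_{coef}(-1^s)$ given by $$C_s\langle r_1,\dots,r_s;p_1,\dots,p_s\rangle=\big[a_{s-2}:\dots:a_0:\nu_s(1,\{p_1,\dots,p_s\})\big],$$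 where $a_k$ is the coefficient of $z^k$ in $\sum_{j:\,p_j\neq\infty}r_j\prod_{\iota\ne j,\,p_\iota\neq\infty}(z-p_\iota)$; and hence so is $C_s^{-1}\circ\mathcal F_s:\Omega^1_{zp}(-1^s)\to\Omega^1_{rp}(-1^s)$. -/

import Mathlib

open Polynomial Topology Filter
open scoped Manifold ContDiff LinearAlgebra.Projectivization

namespace SimplePoles

noncomputable section

/-! ### Complex manifolds -/

/-- A complex manifold modelled on the complex vector space `E`: a Hausdorff, second countable
space with an atlas whose changes of coordinates are holomorphic (that is, complex analytic). -/
structure IsComplexManifold {E H : Type*} [NormedAddCommGroup E] [NormedSpace ℂ E]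
    [TopologicalSpace H] (I : ModelWithCorners ℂ E H) (M : Type*) [TopologicalSpace M]
    [ChartedSpace H M] : Prop where
  t2 : T2Space M
  secondCountable : SecondCountableTopology M
  isManifold : IsManifold I ω M

/-! ### Complex projective space -/

/-- Complex projective space of dimension `n`, with homogeneous coordinates `[v₀ : … : vₙ]`. -/
abbrev CP (n : ℕ) : Type := ℙ ℂ (Fin (n + 1) → ℂ)

/-- The quotient topology on projective space. -/
instance (n : ℕ) : TopologicalSpace (CP n) :=
  inferInstanceAs (TopologicalSpace (Quotient (projectivizationSetoid ℂ (Fin (n + 1) → ℂ))))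

/-- The projection `v ↦ [v]`. -/
def CP.proj (n : ℕ) (v : {v : Fin (n + 1) → ℂ // v ≠ 0}) : CP n := Projectivization.mk' ℂ v

theorem CP.proj_eq_iff {n : ℕ} (v w : {v : Fin (n + 1) → ℂ // v ≠ 0}) :
    CP.proj n v = CP.proj n w ↔ ∃ a : ℂˣ, a • (w : Fin (n + 1) → ℂ) = v :=
  Projectivization.mk_eq_mk_iff ℂ _ _ v.2 w.2

theorem CP.isOpenQuotientMap_proj (n : ℕ) : IsOpenQuotientMap (CP.proj n) := by
  refine ⟨Quotient.mk_surjective, continuous_quot_mk, fun U hU => ?_⟩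
  have hpre : CP.proj n ⁻¹' (CP.proj n '' U) = ⋃ a : ℂˣ,
      (fun v : {v : Fin (n + 1) → ℂ // v ≠ 0} =>
        (⟨a • (v : Fin (n + 1) → ℂ), smul_ne_zero a.ne_zero v.2⟩ :
          {v : Fin (n + 1) → ℂ // v ≠ 0})) ⁻¹' U := by
    ext v
    simp only [Set.mem_preimage, Set.mem_image, Set.mem_iUnion]
    constructor
    · rintro ⟨w, hw, h⟩
      obtain ⟨a, ha⟩ := (CP.proj_eq_iff w v).1 h
      exact ⟨a, by convert hw⟩
    · rintro ⟨a, ha⟩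
      exact ⟨_, ha, (CP.proj_eq_iff _ v).2 ⟨a, rfl⟩⟩
  have : IsOpen (CP.proj n ⁻¹' (CP.proj n '' U)) := by
    rw [hpre]
    refine isOpen_iUnion fun a => hU.preimage ?_
    exact Continuous.subtype_mk (continuous_subtype_val.const_smul a) _
  exact this

theorem CP.proj_eq_iff_cross {n : ℕ} (v w : {v : Fin (n + 1) → ℂ // v ≠ 0}) :
    CP.proj n v = CP.proj n w ↔ ∀ i j, v.1 i * w.1 j = v.1 j * w.1 i := by
  rw [CP.proj_eq_iff]
  constructor
  · rintro ⟨a, ha⟩ i j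
    rw [← ha]
    simp only [Pi.smul_apply, Units.smul_def, smul_eq_mul]
    ring
  · intro h
    obtain ⟨j, hj⟩ := Function.ne_iff.1 w.2
    obtain ⟨i, hi⟩ := Function.ne_iff.1 v.2
    simp only [Pi.zero_apply] at hi hj
    have hvj : v.1 j ≠ 0 := by
      intro h0
      have := h i j
      rw [h0, zero_mul] at this
      exact (mul_ne_zero hi hj) this
    refine ⟨Units.mk0 (v.1 j / w.1 j) (div_ne_zero hvj hj), ?_⟩
    ext k
    simp only [Pi.smul_apply, Units.smul_def, smul_eq_mul, Units.val_mk0]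
    rw [div_mul_eq_mul_div, div_eq_iff hj]
    exact (h j k)

instance (n : ℕ) : T2Space (CP n) := by
  rw [t2Space_iff_of_isOpenQuotientMap (CP.isOpenQuotientMap_proj n)]
  simp only [CP.proj_eq_iff_cross, Set.ofPred_forall]
  refine isClosed_iInter fun i => isClosed_iInter fun j => isClosed_eq ?_ ?_
  · exact ((continuous_apply i).comp (continuous_subtype_val.comp continuous_fst)).mul
      ((continuous_apply j).comp (continuous_subtype_val.comp continuous_snd))
  · exact ((continuous_apply j).comp (continuous_subtype_val.comp continuous_fst)).mul
      ((continuous_apply i).comp (continuous_subtype_val.comp continuous_snd))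

/-- The standard affine chart `[v] ↦ (v_j / v_i)_{j ≠ i}` on the open set `v_i ≠ 0`. -/
def CP.affineChart (n : ℕ) (i : Fin (n + 1)) : OpenPartialHomeomorph (CP n) (Fin n → ℂ) where
  toFun x := Projectivization.lift
    (fun (v : {v : Fin (n + 1) → ℂ // v ≠ 0}) (j : Fin n) => v.1 (i.succAbove j) / v.1 i) (by
    rintro ⟨a, ha⟩ ⟨b, hb⟩ t h
    simp only at h
    subst h
    have ht : t ≠ 0 := by rintro rfl; simp at ha
    ext j
    simp only [Pi.smul_apply, smul_eq_mul]
    rw [mul_div_mul_left _ _ ht]) x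
  invFun w := CP.proj n ⟨i.insertNth 1 w, fun h => by simpa using congrFun h i⟩
  source := CP.proj n '' {v | v.1 i ≠ 0}
  target := Set.univ
  map_source' _ _ := Set.mem_univ _
  map_target' w _ := ⟨_, by simp, rfl⟩
  left_inv' := by
    rintro _ ⟨v, hv, rfl⟩
    refine (CP.proj_eq_iff _ _).2 ⟨(Units.mk0 _ hv)⁻¹, ?_⟩
    ext k
    refine Fin.succAboveCases i ?_ (fun j => ?_) k
    · simp only [Pi.smul_apply, Units.smul_def, smul_eq_mul, Fin.insertNth_apply_same,
        Units.val_inv_eq_inv_val, Units.val_mk0]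
      exact inv_mul_cancel₀ hv
    · simp only [Pi.smul_apply, Units.smul_def, smul_eq_mul, Fin.insertNth_apply_succAbove,
        Units.val_inv_eq_inv_val, Units.val_mk0]
      rw [← div_eq_inv_mul]
      rfl
  right_inv' w _ := by
    ext j
    simp [CP.proj]
  open_source := (CP.isOpenQuotientMap_proj n).isOpenMap _
    (isOpen_ne_fun ((continuous_apply i).comp continuous_subtype_val) continuous_const)
  open_target := isOpen_univ
  continuousOn_toFun := by
    rintro _ ⟨v, hv, rfl⟩
    refine ContinuousAt.continuousWithinAt ?_
    rw [← (CP.isOpenQuotientMap_proj n).continuousAt_comp_iff]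
    change ContinuousAt (fun v : {v : Fin (n + 1) → ℂ // v ≠ 0} =>
      fun j => v.1 (i.succAbove j) / v.1 i) v
    refine continuousAt_pi.2 fun j => ContinuousAt.div ?_ ?_ hv
    · exact ((continuous_apply _).comp continuous_subtype_val).continuousAt
    · exact ((continuous_apply _).comp continuous_subtype_val).continuousAt
  continuousOn_invFun := by
    refine Continuous.continuousOn ?_
    refine (CP.isOpenQuotientMap_proj n).continuous.comp ?_
    refine Continuous.subtype_mk ?_ _
    exact Continuous.finInsertNth (A := fun _ => ℂ) i continuous_const continuous_id

theorem CP.exists_mem_affineChart {n : ℕ} (x : CP n) :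
    ∃ i, x ∈ (CP.affineChart n i).source := by
  obtain ⟨v, rfl⟩ := (CP.isOpenQuotientMap_proj n).surjective x
  obtain ⟨i, hi⟩ := Function.ne_iff.1 v.2
  exact ⟨i, v, hi, rfl⟩

/-- The standard complex structure on `ℂℙⁿ`, given by the affine charts. -/
instance (n : ℕ) : ChartedSpace (Fin n → ℂ) (CP n) where
  atlas := Set.range (CP.affineChart n)
  chartAt x := CP.affineChart n (CP.exists_mem_affineChart x).choose
  mem_chart_source x := (CP.exists_mem_affineChart x).choose_spec
  chart_mem_atlas _ := Set.mem_range_self _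

/-! ### The Riemann sphere -/

/-- The Riemann sphere `ℂ ∪ {∞}`. -/
abbrev RiemannSphere : Type := OnePoint ℂ

open Classical in
/-- The map `z ↦ 1/z` of the Riemann sphere, with `1/0 = ∞` and `1/∞ = 0`. -/
def sphereInv (p : RiemannSphere) : RiemannSphere :=
  p.elim ((0 : ℂ) : RiemannSphere) (fun z => if z = 0 then OnePoint.infty else ((z⁻¹ : ℂ) : RiemannSphere))

@[simp] theorem sphereInv_infty : sphereInv OnePoint.infty = ((0 : ℂ) : RiemannSphere) := rfl

@[simp] theorem sphereInv_zero : sphereInv ((0 : ℂ) : RiemannSphere) = OnePoint.infty := by simp [sphereInv]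

theorem sphereInv_coe {z : ℂ} (hz : z ≠ 0) :
    sphereInv (z : RiemannSphere) = ((z⁻¹ : ℂ) : RiemannSphere) := by simp [sphereInv, hz]

theorem sphereInv_sphereInv (p : RiemannSphere) : sphereInv (sphereInv p) = p := by
  induction p using OnePoint.rec with
  | infty => simp
  | coe z =>
    by_cases hz : z = 0
    · simp [hz]
    · rw [sphereInv_coe hz, sphereInv_coe (inv_ne_zero hz), inv_inv]

theorem continuous_sphereInv : Continuous sphereInv := by
  rw [OnePoint.continuous_iff]
  have hcc : coclosedCompact ℂ = Bornology.cobounded ℂ := by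
    rw [coclosedCompact_eq_cocompact, Metric.cobounded_eq_cocompact]
  constructor
  · have h1 : Tendsto (fun z : ℂ => ((z⁻¹ : ℂ) : RiemannSphere)) (coclosedCompact ℂ)
        (𝓝 ((0 : ℂ) : RiemannSphere)) := by
      rw [hcc]
      exact (OnePoint.continuous_coe.tendsto 0).comp tendsto_inv₀_cobounded
    refine h1.congr' ?_
    have : ∀ᶠ z : ℂ in coclosedCompact ℂ, z ≠ 0 := by
      rw [hcc]
      exact Bornology.eventually_ne_cobounded 0
    filter_upwards [this] with z hz
    exact (sphereInv_coe hz).symm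
  · rw [continuous_iff_continuousAt]
    intro z
    by_cases hz : z = 0
    · subst hz
      rw [continuousAt_iff_punctured_nhds]
      have h1 : Tendsto (fun z : ℂ => ((z⁻¹ : ℂ) : RiemannSphere)) (𝓝[≠] 0) (𝓝 OnePoint.infty) := by
        refine OnePoint.tendsto_coe_infty.comp ?_
        rw [hcc]
        exact tendsto_inv₀_nhdsNE_zero
      rw [sphereInv_zero]
      refine h1.congr' ?_
      filter_upwards [self_mem_nhdsWithin] with z hz
      exact (sphereInv_coe hz).symm
    · have h1 : ContinuousAt (fun z : ℂ => ((z⁻¹ : ℂ) : RiemannSphere)) z :=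
        OnePoint.continuous_coe.continuousAt.comp (continuousAt_inv₀ hz)
      refine h1.congr ?_
      filter_upwards [isOpen_ne.mem_nhds hz] with w hw
      exact (sphereInv_coe hw).symm

/-- The inversion `z ↦ 1/z` as a homeomorphism of the Riemann sphere. -/
def sphereInvHomeo : RiemannSphere ≃ₜ RiemannSphere where
  toFun := sphereInv
  invFun := sphereInv
  left_inv := sphereInv_sphereInv
  right_inv := sphereInv_sphereInv
  continuous_toFun := continuous_sphereInv
  continuous_invFun := continuous_sphereInv

/-- The coordinate `z` on the complement of `∞`. -/
def sphereChartFinite : OpenPartialHomeomorph RiemannSphere ℂ :=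
  (OnePoint.isOpenEmbedding_coe (X := ℂ)).toOpenPartialHomeomorph.symm

/-- The coordinate `1/z` on the complement of `0`. -/
def sphereChartInfinity : OpenPartialHomeomorph RiemannSphere ℂ :=
  sphereInvHomeo.toOpenPartialHomeomorph.trans sphereChartFinite

open Classical in
/-- The standard complex structure on the Riemann sphere. -/
instance : ChartedSpace ℂ RiemannSphere where
  atlas := {sphereChartFinite, sphereChartInfinity}
  chartAt p := if p = OnePoint.infty then sphereChartInfinity else sphereChartFinite
  mem_chart_source p := by
    induction p using OnePoint.rec with
    | infty => simp [sphereChartInfinity, sphereChartFinite, sphereInvHomeo]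
    | coe z => simp [sphereChartFinite]
  chart_mem_atlas p := by
    split_ifs
    · exact Or.inr rfl
    · exact Or.inl rfl

/-! ### Symmetric products of the sphere and the Viète map -/

/-- The symmetric group of `n` letters acting on `n`-tuples by
`(σ, (x₁, …, xₙ)) ↦ (x_{σ(1)}, …, x_{σ(n)})`. -/
abbrev SymGroup (n : ℕ) : Type := (Equiv.Perm (Fin n))ᵈᵐᵃ

instance {n : ℕ} {X : Type*} [TopologicalSpace X] :
    ContinuousConstSMul (SymGroup n) (Fin n → X) where
  continuous_const_smul _ := continuous_pi fun _ => continuous_apply _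

/-- The symmetric product: the space of unordered `n`-tuples of points of the Riemann sphere,
with the quotient topology. -/
def SymProd (n : ℕ) : Type :=
  MulAction.orbitRel.Quotient (SymGroup n) (Fin n → RiemannSphere)

instance (n : ℕ) : TopologicalSpace (SymProd n) :=
  inferInstanceAs (TopologicalSpace
    (Quotient (MulAction.orbitRel (SymGroup n) (Fin n → RiemannSphere))))

/-- The unordered tuple `{p₁, …, pₙ}`. -/
def SymProd.mk {n : ℕ} (p : Fin n → RiemannSphere) : SymProd n :=
  Quotient.mk (MulAction.orbitRel (SymGroup n) (Fin n → RiemannSphere)) p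

theorem SymProd.isOpenQuotientMap_mk (n : ℕ) : IsOpenQuotientMap (SymProd.mk (n := n)) :=
  MulAction.isOpenQuotientMap_quotientMk

instance (n : ℕ) : CompactSpace (SymProd n) :=
  inferInstanceAs (CompactSpace
    (Quotient (MulAction.orbitRel (SymGroup n) (Fin n → RiemannSphere))))

theorem SymProd.mk_eq_mk_iff {n : ℕ} (p q : Fin n → RiemannSphere) :
    SymProd.mk p = SymProd.mk q ↔ ∃ σ : Equiv.Perm (Fin n), q ∘ σ = p := by
  refine Quotient.eq.trans ?_
  constructor
  · rintro ⟨σ, h⟩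
    exact ⟨DomMulAct.mk.symm σ, h⟩
  · rintro ⟨σ, h⟩
    exact ⟨DomMulAct.mk σ, h⟩

/-- The factor `z - p` if `p` is finite, and `1` if `p = ∞`. -/
def linearFactor (p : RiemannSphere) : ℂ[X] := p.elim 1 (fun c => X - C c)

@[simp] theorem linearFactor_infty : linearFactor OnePoint.infty = 1 := rfl

@[simp] theorem linearFactor_coe (c : ℂ) : linearFactor (c : RiemannSphere) = X - C c := rfl

/-- The monic polynomial `∏ (z - pᵢ)`, the factors with `pᵢ = ∞` being omitted. -/
def rootPoly {n : ℕ} (p : Fin n → RiemannSphere) : ℂ[X] := ∏ i, linearFactor (p i)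

/-- The monic polynomial `∏ (z - pᵢ)` of an unordered tuple `{p₁, …, pₙ}`, the factors with
`pᵢ = ∞` being omitted. -/
def SymProd.poly {n : ℕ} (u : SymProd n) : ℂ[X] :=
  Quotient.lift (s := MulAction.orbitRel (SymGroup n) (Fin n → RiemannSphere)) rootPoly (by
    rintro _ q ⟨σ, rfl⟩
    exact Equiv.prod_comp (DomMulAct.mk.symm σ) (fun i => linearFactor (q i))) u

@[simp] theorem SymProd.poly_mk {n : ℕ} (p : Fin n → RiemannSphere) :
    (SymProd.mk p).poly = rootPoly p := rfl

/-- The Viète map: `(b, {p₁, …, pₙ})` is sent to the coefficients of `b ∏ (z - pᵢ)`, from the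
coefficient of `zⁿ` down to the constant one; see `viete_coe` for the expression by elementary
symmetric functions. If `m` of the points are `∞`, then the first `m` entries vanish and the
others are the Viète map of the remaining `n - m` points. -/
def viete (n : ℕ) (b : ℂ) (u : SymProd n) : Fin (n + 1) → ℂ := fun k => b * u.poly.coeff (n - k)

/-- For finite points the Viète map is
`(b, -b ∑ pᵢ, …, (-1)ⁿ b ∏ pᵢ)`. -/
theorem viete_coe (n : ℕ) (b : ℂ) (x : Fin n → ℂ) (k : Fin (n + 1)) :
    viete n b (SymProd.mk fun i => (x i : RiemannSphere)) k =
      (-1) ^ (k : ℕ) * b * ∑ t ∈ Finset.univ.powersetCard (k : ℕ), ∏ i ∈ t, x i := by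
  have h := Multiset.prod_X_sub_C_coeff (Finset.univ.val.map x) (k := n - k) (by simp)
  have hk : n - (n - (k : ℕ)) = k := by omega
  simp only [Multiset.map_map, Function.comp_def, Multiset.card_map, Finset.card_val,
    Finset.card_univ, Fintype.card_fin, hk] at h
  rw [Finset.esymm_map_val] at h
  simp only [viete, SymProd.poly_mk, rootPoly, linearFactor_coe]
  rw [Finset.prod_eq_multiset_prod, h]
  ring

theorem linearFactor_monic (p : RiemannSphere) : (linearFactor p).Monic := by
  induction p using OnePoint.rec with
  | infty => exact monic_one
  | coe c => exact monic_X_sub_C c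

theorem linearFactor_natDegree_le (p : RiemannSphere) : (linearFactor p).natDegree ≤ 1 := by
  induction p using OnePoint.rec with
  | infty => simp
  | coe c => simp

theorem rootPoly_monic {n : ℕ} (p : Fin n → RiemannSphere) : (rootPoly p).Monic :=
  monic_prod_of_monic _ _ fun i _ => linearFactor_monic (p i)

theorem rootPoly_natDegree_le {n : ℕ} (p : Fin n → RiemannSphere) :
    (rootPoly p).natDegree ≤ n := by
  refine (natDegree_prod_le _ _).trans ?_
  refine (Finset.sum_le_card_nsmul _ _ 1 fun i _ => linearFactor_natDegree_le (p i)).trans ?_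
  simp

theorem poly_ext_of_natDegree_le {n : ℕ} {f g : ℂ[X]} (hf : f.natDegree ≤ n)
    (hg : g.natDegree ≤ n) (h : ∀ k : Fin (n + 1), f.coeff (n - k) = g.coeff (n - k)) :
    f = g := by
  ext m
  by_cases hm : m ≤ n
  · have := h ⟨n - m, by omega⟩
    simpa [Nat.sub_sub_self hm] using this
  · rw [coeff_eq_zero_of_natDegree_lt (by omega), coeff_eq_zero_of_natDegree_lt (by omega)]

theorem viete_ne_zero {n : ℕ} {b : ℂ} (hb : b ≠ 0) (u : SymProd n) : viete n b u ≠ 0 := by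
  obtain ⟨p, rfl⟩ := (SymProd.isOpenQuotientMap_mk n).surjective u
  intro h
  refine (rootPoly_monic p).ne_zero ?_
  refine poly_ext_of_natDegree_le (rootPoly_natDegree_le p) (by simp) fun k => ?_
  have := congrFun h k
  simpa [viete, hb] using this

/-- The map `{p₁, …, pₙ} ↦ [ν(1, {p₁, …, pₙ})]` from the symmetric product of the sphere to
projective space. -/
def vieteProj (n : ℕ) (u : SymProd n) : CP n :=
  CP.proj n ⟨viete n 1 u, viete_ne_zero one_ne_zero u⟩

open Classical in
theorem rootPoly_roots_count {n : ℕ} (p : Fin n → RiemannSphere) (c : ℂ) :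
    (rootPoly p).rootMultiplicity c = Fintype.card {i // p i = (c : RiemannSphere)} := by
  have h1 : (rootPoly p).roots = ∑ i, (linearFactor (p i)).roots :=
    roots_prod _ _ (rootPoly_monic p).ne_zero
  rw [← count_roots, h1, Multiset.count_sum', Fintype.card_subtype, Finset.card_filter]
  refine Finset.sum_congr rfl fun i _ => ?_
  generalize p i = q
  induction q using OnePoint.rec with
  | infty => simp
  | coe d => simp [Multiset.count_singleton, eq_comm]

theorem vieteProj_injective (n : ℕ) : Function.Injective (vieteProj n) := by
  classical
  intro u w h
  obtain ⟨p, rfl⟩ := (SymProd.isOpenQuotientMap_mk n).surjective u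
  obtain ⟨q, rfl⟩ := (SymProd.isOpenQuotientMap_mk n).surjective w
  obtain ⟨a, ha⟩ := (CP.proj_eq_iff _ _).1 h
  have hpoly : C (a : ℂ) * rootPoly q = rootPoly p := by
    refine poly_ext_of_natDegree_le (n := n)
      ((natDegree_C_mul_le _ _).trans (rootPoly_natDegree_le q)) (rootPoly_natDegree_le p)
      fun k => ?_
    have := congrFun ha k
    simpa [viete, Units.smul_def] using this
  have hc : (a : ℂ) = 1 := by
    have := congrArg leadingCoeff hpoly
    rw [leadingCoeff_mul, leadingCoeff_C, (rootPoly_monic q).leadingCoeff,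
      (rootPoly_monic p).leadingCoeff, mul_one] at this
    exact this
  rw [hc, C_1, one_mul] at hpoly
  have hfin : ∀ c : ℂ, Fintype.card {i // p i = (c : RiemannSphere)} =
      Fintype.card {i // q i = (c : RiemannSphere)} := fun c => by
    rw [← rootPoly_roots_count, ← rootPoly_roots_count, hpoly]
  have hinf : Fintype.card {i // p i = OnePoint.infty} = Fintype.card {i // q i = OnePoint.infty} := by
    have key : ∀ p : Fin n → RiemannSphere,
        (rootPoly p).natDegree + Fintype.card {i // p i = OnePoint.infty} = n := by
      intro p
      rw [rootPoly, natDegree_prod_of_monic _ _ fun i _ => linearFactor_monic (p i),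
        Fintype.card_subtype, Finset.card_filter, ← Finset.sum_add_distrib]
      have : ∀ i, (linearFactor (p i)).natDegree + (if p i = OnePoint.infty then 1 else 0) = 1 := by
        intro i
        generalize p i = q
        induction q using OnePoint.rec with
        | infty => simp
        | coe d => simp
      simp [this]
    have h1 := key p
    have h2 := key q
    rw [hpoly] at h2
    omega
  have hall : ∀ c : RiemannSphere, Nonempty ({i // p i = c} ≃ {i // q i = c}) := by
    intro c
    refine Fintype.card_eq.1 ?_
    induction c using OnePoint.rec with
    | infty => exact hinf
    | coe d => exact hfin d
  refine (SymProd.mk_eq_mk_iff p q).2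
    ⟨Equiv.ofFiberEquiv (f := p) (g := q) fun c => (hall c).some, ?_⟩
  ext i
  exact Equiv.ofFiberEquiv_map _ i

theorem vieteProj_surjective (n : ℕ) : Function.Surjective (vieteProj n) := by
  intro x
  obtain ⟨v, rfl⟩ := (CP.isOpenQuotientMap_proj n).surjective x
  set f : ℂ[X] := ∑ i : Fin (n + 1), C (v.1 i) * X ^ (n - (i : ℕ)) with hf
  have hcoeff : ∀ k : Fin (n + 1), f.coeff (n - k) = v.1 k := by
    intro k
    rw [hf, finsetSum_coeff, Finset.sum_eq_single k]
    · simp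
    · intro j _ hj
      rw [coeff_C_mul, coeff_X_pow, if_neg, mul_zero]
      intro h
      exact hj (Fin.ext (by omega))
    · simp
  have hf0 : f ≠ 0 := by
    intro h
    apply v.2
    ext k
    rw [← hcoeff k, h]
    simp
  have hdeg : f.natDegree ≤ n := by
    refine natDegree_sum_le_of_forall_le _ _ fun i _ => ?_
    exact (natDegree_C_mul_X_pow_le _ _).trans (Nat.sub_le _ _)
  have hsplit : f.Splits := IsAlgClosed.splits f
  have hcard : f.roots.card = f.natDegree := hsplit.natDegree_eq_card_roots.symm
  set l : List RiemannSphere :=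
    f.roots.toList.map (OnePoint.some : ℂ → RiemannSphere) ++ List.replicate (n - f.natDegree) OnePoint.infty
    with hl
  have hlen : l.length = n := by
    simp [hl, hcard]
    omega
  have hprod : (l.map linearFactor).prod = (f.roots.map fun c => X - C c).prod := by
    rw [hl, List.map_append, List.prod_append, List.map_map, List.map_replicate,
      linearFactor_infty, List.prod_replicate, one_pow, mul_one]
    conv_rhs => rw [← Multiset.coe_toList f.roots, Multiset.map_coe, Multiset.prod_coe]
    rfl
  have hroot : rootPoly (fun i : Fin n => l.get (i.cast hlen.symm)) =
      (f.roots.map fun c => X - C c).prod := by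
    rw [← hprod, rootPoly]
    clear_value l
    subst hlen
    exact Fin.prod_univ_fun_getElem l linearFactor
  refine ⟨SymProd.mk fun i : Fin n => l.get (i.cast hlen.symm), ?_⟩
  refine (CP.proj_eq_iff _ _).2
    ⟨(Units.mk0 f.leadingCoeff (leadingCoeff_ne_zero.2 hf0))⁻¹, ?_⟩
  have hfe := hsplit.eq_prod_roots
  rw [← hroot] at hfe
  ext k
  have hk := hcoeff k
  rw [hfe, coeff_C_mul] at hk
  simp only [Pi.smul_apply, Units.smul_def, smul_eq_mul, Units.val_inv_eq_inv_val, Units.val_mk0,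
    viete, SymProd.poly_mk, one_mul]
  rw [← hk, inv_mul_cancel_left₀ (leadingCoeff_ne_zero.2 hf0)]

/-- The two copies of the plane, with coordinates `z` and `w = 1/z`, that cover the sphere. -/
def sphereCover : ℂ ⊕ ℂ → RiemannSphere :=
  Sum.elim (fun z => (z : RiemannSphere)) (fun w => sphereInv (w : RiemannSphere))

theorem sphereCover_isOpenQuotientMap : IsOpenQuotientMap sphereCover := by
  refine ⟨fun p => ?_, ?_, ?_⟩
  · induction p using OnePoint.rec with
    | infty => exact ⟨Sum.inr 0, by simp [sphereCover]⟩
    | coe z => exact ⟨Sum.inl z, rfl⟩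
  · exact OnePoint.continuous_coe.sumElim (continuous_sphereInv.comp OnePoint.continuous_coe)
  · exact OnePoint.isOpenMap_coe.sumElim
      (sphereInvHomeo.isOpenMap.comp OnePoint.isOpenMap_coe)

/-- A multiple of `linearFactor` whose coefficients are continuous in both coordinates. -/
def coverFactor : ℂ ⊕ ℂ → ℂ[X] := Sum.elim (fun z => X - C z) (fun w => C w * X - 1)

theorem coverFactor_eq (t : ℂ ⊕ ℂ) :
    ∃ a : ℂˣ, C (a : ℂ) * linearFactor (sphereCover t) = coverFactor t := by
  rcases t with z | w
  · exact ⟨1, by simp [sphereCover, coverFactor]⟩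
  · by_cases hw : w = 0
    · subst hw
      exact ⟨-1, by simp [sphereCover, coverFactor]⟩
    · refine ⟨Units.mk0 w hw, ?_⟩
      simp only [Units.val_mk0, sphereCover, coverFactor, Sum.elim_inr, sphereInv_coe hw,
        linearFactor_coe]
      rw [mul_sub, ← C_mul, mul_inv_cancel₀ hw, C_1]

theorem continuous_coverFactor_coeff (k : ℕ) : Continuous fun t => (coverFactor t).coeff k := by
  rw [continuous_sum_dom]
  constructor
  · simp only [Function.comp_def, coverFactor, Sum.elim_inl, coeff_sub, coeff_C]
    split_ifs <;> fun_prop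
  · simp only [Function.comp_def, coverFactor, Sum.elim_inr, coeff_sub, coeff_C_mul]
    fun_prop

theorem continuous_prod_coeff {Y ι : Type*} [TopologicalSpace Y] (S : Finset ι)
    (f : ι → Y → ℂ[X]) (hf : ∀ i k, Continuous fun y => (f i y).coeff k) (k : ℕ) :
    Continuous fun y => (∏ i ∈ S, f i y).coeff k := by
  classical
  induction S using Finset.induction_on generalizing k with
  | empty => simpa using continuous_const
  | insert a S ha ih =>
    simp only [Finset.prod_insert ha, coeff_mul]
    exact continuous_finsetSum _ fun x _ => (hf a x.1).mul (ih x.2)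

theorem continuous_vieteProj (n : ℕ) : Continuous (vieteProj n) := by
  rw [← (SymProd.isOpenQuotientMap_mk n).continuous_comp_iff,
    ← (IsOpenQuotientMap.piMap fun _ : Fin n => sphereCover_isOpenQuotientMap).continuous_comp_iff]
  choose a ha using coverFactor_eq
  have hprod : ∀ t : Fin n → ℂ ⊕ ℂ, ∏ i, coverFactor (t i) =
      C ((∏ i, a (t i) : ℂˣ) : ℂ) * rootPoly (fun i => sphereCover (t i)) := by
    intro t
    simp only [rootPoly, ← ha, Finset.prod_mul_distrib, Units.coe_prod, map_prod]
  have hlift : ∀ t : Fin n → ℂ ⊕ ℂ, (∏ i, a (t i) : ℂˣ) •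
      viete n 1 (SymProd.mk fun i => sphereCover (t i)) =
        fun k : Fin (n + 1) => (∏ i, coverFactor (t i)).coeff (n - (k : ℕ)) := by
    intro t
    ext k
    rw [hprod, coeff_C_mul]
    simp [viete, Units.smul_def]
  have hne : ∀ t : Fin n → ℂ ⊕ ℂ,
      (fun k : Fin (n + 1) => (∏ i, coverFactor (t i)).coeff (n - (k : ℕ))) ≠ 0 := by
    intro t
    rw [← hlift]
    exact (smul_ne_zero_iff_ne _).2 (viete_ne_zero one_ne_zero _)
  have heq : (vieteProj n ∘ SymProd.mk) ∘ Pi.map (fun _ : Fin n => sphereCover) =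
      fun t => CP.proj n ⟨_, hne t⟩ := by
    ext1 t
    refine ((CP.proj_eq_iff _ _).2 ⟨∏ i, a (t i), ?_⟩).symm
    exact hlift t
  rw [heq]
  refine (CP.isOpenQuotientMap_proj n).continuous.comp (Continuous.subtype_mk ?_ _)
  refine continuous_pi fun k => ?_
  exact continuous_prod_coeff _ (fun i (t : Fin n → ℂ ⊕ ℂ) => coverFactor (t i))
    (fun i k => (continuous_coverFactor_coeff k).comp (continuous_apply i)) _

/-- The identification of the `n`-th symmetric product of the Riemann sphere with `ℂℙⁿ`. -/
def vieteHomeo (n : ℕ) : SymProd n ≃ₜ CP n :=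
  Continuous.homeoOfEquivCompactToT2
    (f := Equiv.ofBijective (vieteProj n) ⟨vieteProj_injective n, vieteProj_surjective n⟩)
    (continuous_vieteProj n)

/-- The complex structure on the symmetric product, carried over from `ℂℙⁿ`. -/
instance (n : ℕ) : ChartedSpace (Fin n → ℂ) (SymProd n) where
  atlas := {e | ∃ c ∈ atlas (Fin n → ℂ) (CP n),
    e = (vieteHomeo n).toOpenPartialHomeomorph.trans c}
  chartAt u := (vieteHomeo n).toOpenPartialHomeomorph.trans (chartAt _ (vieteHomeo n u))
  mem_chart_source u := by simp
  chart_mem_atlas u := ⟨_, chart_mem_atlas _ _, rfl⟩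

/-! ### The coefficient model -/

/-- The polynomial `Q = a_{s-2} z^{s-2} + … + a₀` of
`v = (a_{s-2}, …, a₀, b_s, …, b₀)`. -/
def numPoly (s : ℕ) (v : Fin (2 * s - 1 + 1) → ℂ) : ℂ[X] :=
  ∑ i : Fin (2 * s - 1 + 1), if (i : ℕ) < s - 1 then C (v i) * X ^ (s - 2 - (i : ℕ)) else 0

/-- The polynomial `P = b_s z^s + … + b₀` of `v = (a_{s-2}, …, a₀, b_s, …, b₀)`. -/
def denPoly (s : ℕ) (v : Fin (2 * s - 1 + 1) → ℂ) : ℂ[X] :=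
  ∑ i : Fin (2 * s - 1 + 1), if (i : ℕ) < s - 1 then 0 else C (v i) * X ^ (2 * s - 1 - (i : ℕ))

/-- The discriminant of `f = b_d z^d + … + b₀` as a form of degree `d` (so that `b_d = 0` means a
root at `∞`): the resultant of the two partial derivatives of the binary form
`F(x, y) = b_d x^d + … + b₀ y^d`, which are `f'` and `d f - z f'` in the coordinate `z = x / y`.
It is `± d^(d-2)` times the classical discriminant polynomial in `b_d, …, b₀`. -/
def formDiscr (d : ℕ) (f : ℂ[X]) : ℂ :=
  resultant (derivative f) (C (d : ℂ) * f - X * derivative f) (d - 1) (d - 1)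

/-- The condition defining the coefficient model: the resultant of `P` and `Q`, regarded as forms
of degrees `s` and `s - 2`, and the discriminant of `P`, regarded as a form of degree `s`, do not
vanish. -/
def coefCondition (s : ℕ) (v : Fin (2 * s - 1 + 1) → ℂ) : Prop :=
  resultant (denPoly s v) (numPoly s v) s (s - 2) ≠ 0 ∧ formDiscr s (denPoly s v) ≠ 0

theorem continuous_resultant {Y : Type*} [TopologicalSpace Y] {f g : Y → ℂ[X]} (m n : ℕ)
    (hf : ∀ k, Continuous fun y => (f y).coeff k) (hg : ∀ k, Continuous fun y => (g y).coeff k) :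
    Continuous fun y => resultant (f y) (g y) m n := by
  unfold resultant
  refine Continuous.matrix_det (continuous_matrix fun i j => ?_)
  unfold sylvester
  simp only [Matrix.of_apply]
  induction j using Fin.addCases with
  | left j =>
    simp only [Fin.addCases_left]
    split_ifs
    · exact hg _
    · exact continuous_const
  | right j =>
    simp only [Fin.addCases_right]
    split_ifs
    · exact hf _
    · exact continuous_const

theorem isOpen_coefCondition (s : ℕ) : IsOpen {v | coefCondition s v} := by
  have hQ : ∀ k, Continuous fun v => (numPoly s v).coeff k := by
    intro k
    simp only [numPoly, finsetSum_coeff]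
    refine continuous_finsetSum _ fun i _ => ?_
    split_ifs
    · simp only [coeff_C_mul]
      fun_prop
    · simp only [coeff_zero]
      fun_prop
  have hP : ∀ k, Continuous fun v => (denPoly s v).coeff k := by
    intro k
    simp only [denPoly, finsetSum_coeff]
    refine continuous_finsetSum _ fun i _ => ?_
    split_ifs
    · simp only [coeff_zero]
      fun_prop
    · simp only [coeff_C_mul]
      fun_prop
  have hP' : ∀ k, Continuous fun v => (derivative (denPoly s v)).coeff k := by
    intro k
    simp only [coeff_derivative]
    exact (hP _).mul continuous_const
  refine (isOpen_ne_fun (continuous_resultant _ _ hP hQ) continuous_const).inter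
    (isOpen_ne_fun (continuous_resultant _ _ hP' fun k => ?_) continuous_const)
  simp only [coeff_sub, coeff_C_mul]
  refine (continuous_const.mul (hP k)).sub ?_
  cases k with
  | zero => simpa using continuous_const
  | succ k => simpa only [coeff_X_mul] using hP' k

/-- The coefficient model: the Zariski open subset of `ℂℙ^{2s-1}` of all
`[a_{s-2} : … : a₀ : b_s : … : b₀]` with non-vanishing resultant and discriminant. -/
def coefOpens (s : ℕ) : TopologicalSpace.Opens (CP (2 * s - 1)) where
  carrier := CP.proj (2 * s - 1) '' {v | coefCondition s v.1}
  is_open' := (CP.isOpenQuotientMap_proj _).isOpenMap _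
    ((isOpen_coefCondition s).preimage continuous_subtype_val)

/-- The coefficient model, with the complex structure of an open subset of `ℂℙ^{2s-1}`. -/
abbrev OmegaCoef (s : ℕ) : Type := coefOpens s

/-! ### The zeros–poles model -/

/-- The space `M_s` of pairs `({c₁, …, c_{s-2}}, {p₁, …, p_s})` of unordered tuples of points of
the sphere, where the `pᵢ` are pairwise distinct and different from all `c_j`. -/
def zerosPoles (s : ℕ) : TopologicalSpace.Opens (SymProd (s - 2) × SymProd s) where
  carrier := Prod.map SymProd.mk SymProd.mk ''
    {x : (Fin (s - 2) → RiemannSphere) × (Fin s → RiemannSphere) |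
      Function.Injective x.2 ∧ ∀ j i, x.1 j ≠ x.2 i}
  is_open' := by
    refine ((SymProd.isOpenQuotientMap_mk _).prodMap
      (SymProd.isOpenQuotientMap_mk _)).isOpenMap _ ?_
    have h1 : {x : (Fin (s - 2) → RiemannSphere) × (Fin s → RiemannSphere) |
        Function.Injective x.2} = ⋂ i, ⋂ j, ⋂ (_ : i ≠ j), {x | x.2 i ≠ x.2 j} := by
      ext x
      simp only [Set.mem_ofPred_eq, Set.mem_iInter, Function.Injective]
      exact ⟨fun h i j hij he => hij (h he), fun h i j he => by_contra fun hij => h i j hij he⟩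
    refine IsOpen.inter ?_ ?_
    · change IsOpen {x : (Fin (s - 2) → RiemannSphere) × (Fin s → RiemannSphere) |
        Function.Injective x.2}
      rw [h1]
      refine isOpen_iInter_of_finite fun i => isOpen_iInter_of_finite fun j =>
        isOpen_iInter_of_finite fun _ => isOpen_ne_fun ?_ ?_ <;> fun_prop
    · change IsOpen {x : (Fin (s - 2) → RiemannSphere) × (Fin s → RiemannSphere) |
        ∀ j i, x.1 j ≠ x.2 i}
      simp only [Set.ofPred_forall]
      refine isOpen_iInter_of_finite fun i => isOpen_iInter_of_finite fun j =>
        isOpen_ne_fun ?_ ?_ <;> fun_prop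

/-- `Q_u = ∏ (z - c_j)`, the factors with `c_j = ∞` being omitted. -/
def zeroPoly {s : ℕ} (u : zerosPoles s) : ℂ[X] := u.1.1.poly

/-- `P_u = ∏ (z - pᵢ)`, the factor with `pᵢ = ∞` being omitted. -/
def polePoly {s : ℕ} (u : zerosPoles s) : ℂ[X] := u.1.2.poly

/-- The index set `{1, 2, …, 2s - 1}` of the trivializing cover. -/
abbrev BundleIndex (s : ℕ) : Type := Set.Icc 1 (2 * s - 1)

/-- The index `α ∈ {1, 2, …, 2s - 1}` as a point of the plane. -/
def BundleIndex.pt {s : ℕ} (α : BundleIndex s) : ℂ := ((α : ℕ) : ℂ)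

/-- `𝒰_α = {u ∈ M_s | Q_u(α) ≠ 0 and P_u(α) ≠ 0}`. -/
def trivSet {s : ℕ} (α : BundleIndex s) : Set (zerosPoles s) :=
  {u | (zeroPoly u).eval α.pt ≠ 0 ∧ (polePoly u).eval α.pt ≠ 0}

open Classical in
/-- The transition function `φ_{αβ}(u) = (Q_u(α) / P_u(α)) (P_u(β) / Q_u(β))` with values in `ℂ*`,
extended by `1` outside its domain of definition `𝒰_α ∩ 𝒰_β`. -/
def transition {s : ℕ} (α β : BundleIndex s) (u : zerosPoles s) : ℂˣ :=
  if h : (zeroPoly u).eval α.pt / (polePoly u).eval α.pt *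
      ((polePoly u).eval β.pt / (zeroPoly u).eval β.pt) ≠ 0
  then Units.mk0 _ h else 1

theorem transition_val {s : ℕ} {α β : BundleIndex s} {u : zerosPoles s}
    (hα : u ∈ trivSet α) (hβ : u ∈ trivSet β) :
    (transition α β u : ℂ) = (zeroPoly u).eval α.pt / (polePoly u).eval α.pt *
      ((polePoly u).eval β.pt / (zeroPoly u).eval β.pt) := by
  have h : (zeroPoly u).eval α.pt / (polePoly u).eval α.pt *
      ((polePoly u).eval β.pt / (zeroPoly u).eval β.pt) ≠ 0 :=
    mul_ne_zero (div_ne_zero hα.1 hα.2) (div_ne_zero hβ.2 hβ.1)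
  rw [transition, dif_pos h, Units.val_mk0]

theorem linearFactor_eval_ne_zero_iff (p : RiemannSphere) (z : ℂ) :
    (linearFactor p).eval z ≠ 0 ↔ p ≠ (z : RiemannSphere) := by
  induction p using OnePoint.rec with
  | infty => simp
  | coe c => simp [sub_eq_zero, eq_comm]

theorem rootPoly_eval_ne_zero_iff {n : ℕ} (p : Fin n → RiemannSphere) (z : ℂ) :
    (rootPoly p).eval z ≠ 0 ↔ ∀ i, p i ≠ (z : RiemannSphere) := by
  rw [rootPoly, eval_prod, Finset.prod_ne_zero_iff]
  simp only [Finset.mem_univ, true_imp_iff, linearFactor_eval_ne_zero_iff]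

theorem isOpen_poly_eval_ne_zero (n : ℕ) (z : ℂ) :
    IsOpen {u : SymProd n | u.poly.eval z ≠ 0} := by
  rw [← (SymProd.isOpenQuotientMap_mk n).isQuotientMap.isOpen_preimage]
  simp only [Set.preimage_ofPred_eq, SymProd.poly_mk, rootPoly_eval_ne_zero_iff, Set.ofPred_forall]
  exact isOpen_iInter_of_finite fun i => isOpen_ne_fun (continuous_apply i) continuous_const

theorem isOpen_trivSet {s : ℕ} (α : BundleIndex s) : IsOpen (trivSet α) :=
  ((isOpen_poly_eval_ne_zero (s - 2) α.pt).preimage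
      (continuous_fst.comp continuous_subtype_val)).inter
    ((isOpen_poly_eval_ne_zero s α.pt).preimage (continuous_snd.comp continuous_subtype_val))

theorem exists_mem_trivSet {s : ℕ} (hs : 2 ≤ s) (u : zerosPoles s) :
    ∃ α : BundleIndex s, u ∈ trivSet α := by
  classical
  obtain ⟨⟨c, p⟩, -, hx⟩ := u.2
  have hz : zeroPoly u = rootPoly c := by rw [zeroPoly, ← hx]; rfl
  have hp : polePoly u = rootPoly p := by rw [polePoly, ← hx]; rfl
  set q : Fin (s - 2) ⊕ Fin s → RiemannSphere := Sum.elim c p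
  have hinj : Function.Injective fun α : BundleIndex s => (α.pt : RiemannSphere) := by
    intro α β h
    have h' : α.pt = β.pt := OnePoint.coe_injective h
    exact Subtype.ext (Nat.cast_injective h')
  have hex : ∃ α : BundleIndex s, ∀ i, q i ≠ (α.pt : RiemannSphere) := by
    by_contra! hcon
    choose g hg using hcon
    have hginj : Function.Injective g := by
      intro α β h
      apply hinj
      change (α.pt : RiemannSphere) = β.pt
      rw [← hg, ← hg, h]
    have := Fintype.card_le_of_injective g hginj
    simp at this
    omega
  obtain ⟨α, hα⟩ := hex
  refine ⟨α, ?_, ?_⟩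
  · rw [hz, rootPoly_eval_ne_zero_iff]
    exact fun i => hα (Sum.inl i)
  · rw [hp, rootPoly_eval_ne_zero_iff]
    exact fun i => hα (Sum.inr i)

theorem continuousAt_poly_eval_div {n : ℕ} {z w : ℂ} {u : SymProd n}
    (hw : u.poly.eval w ≠ 0) :
    ContinuousAt (fun u : SymProd n => u.poly.eval z / u.poly.eval w) u := by
  obtain ⟨p, rfl⟩ := (SymProd.isOpenQuotientMap_mk n).surjective u
  have hcov := IsOpenQuotientMap.piMap fun _ : Fin n => sphereCover_isOpenQuotientMap
  obtain ⟨t, rfl⟩ := hcov.surjective p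
  rw [← (SymProd.isOpenQuotientMap_mk n).continuousAt_comp_iff, ← hcov.continuousAt_comp_iff]
  choose a ha using coverFactor_eq
  have heval : ∀ (t : Fin n → ℂ ⊕ ℂ) (y : ℂ), ∏ i, (coverFactor (t i)).eval y =
      ((∏ i, a (t i) : ℂˣ) : ℂ) * (rootPoly fun i => sphereCover (t i)).eval y := by
    intro t y
    simp only [rootPoly, ← ha, eval_mul, eval_C, Finset.prod_mul_distrib, Units.coe_prod,
      eval_prod]
  have heq : ((fun u : SymProd n => u.poly.eval z / u.poly.eval w) ∘ SymProd.mk) ∘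
      Pi.map (fun _ : Fin n => sphereCover) =
      fun t => (∏ i, (coverFactor (t i)).eval z) / ∏ i, (coverFactor (t i)).eval w := by
    ext1 t
    rw [heval, heval, mul_div_mul_left _ _ (Units.ne_zero _)]
    rfl
  rw [heq]
  have hcont : ∀ y : ℂ, Continuous fun x : ℂ ⊕ ℂ => (coverFactor x).eval y := by
    intro y
    rw [continuous_sum_dom]
    constructor <;> simp only [Function.comp_def, coverFactor, Sum.elim_inl, Sum.elim_inr,
      eval_sub, eval_mul, eval_X, eval_C, eval_one] <;> fun_prop
  have hprod : ∀ y : ℂ, Continuous fun t : Fin n → ℂ ⊕ ℂ => ∏ i, (coverFactor (t i)).eval y :=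
    fun y => continuous_finsetProd _ fun i _ => (hcont y).comp (continuous_apply i)
  refine (hprod z).continuousAt.div (hprod w).continuousAt ?_
  rw [heval]
  exact mul_ne_zero (Units.ne_zero _) hw

theorem continuousOn_transition {s : ℕ} (α β : BundleIndex s) :
    ContinuousOn (transition α β) (trivSet α ∩ trivSet β) := by
  rw [Units.isEmbedding_val₀.continuousOn_iff]
  have h : ContinuousOn (fun u : zerosPoles s =>
      (u.1.1.poly.eval α.pt / u.1.1.poly.eval β.pt) *
        (u.1.2.poly.eval β.pt / u.1.2.poly.eval α.pt)) (trivSet α ∩ trivSet β) := by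
    intro u hu
    refine ContinuousAt.continuousWithinAt ?_
    refine ContinuousAt.mul ?_ ?_
    · exact ContinuousAt.comp (f := fun u : zerosPoles s => u.1.1)
        (continuousAt_poly_eval_div hu.2.1)
        (continuous_fst.comp continuous_subtype_val).continuousAt
    · exact ContinuousAt.comp (f := fun u : zerosPoles s => u.1.2)
        (continuousAt_poly_eval_div hu.1.2)
        (continuous_snd.comp continuous_subtype_val).continuousAt
  refine h.congr fun u hu => ?_
  rw [Function.comp_apply, transition_val hu.1 hu.2, zeroPoly, polePoly]
  ring

/-- The principal `ℂ*`-bundle over `M_s` with the transition functions `φ_{αβ}`: the points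
`(u, λ_α)` and `(u, λ_β)` of the trivial bundles over `𝒰_α` and `𝒰_β` are identified if
`λ_α = φ_{αβ}(u) λ_β`. -/
def zpBundle (s : ℕ) (hs : 2 ≤ s) : FiberBundleCore (BundleIndex s) (zerosPoles s) ℂˣ where
  baseSet := trivSet
  isOpen_baseSet := isOpen_trivSet
  indexAt u := (exists_mem_trivSet hs u).choose
  mem_baseSet_at u := (exists_mem_trivSet hs u).choose_spec
  coordChange β α u l := transition α β u * l
  coordChange_self α u hu l := by
    ext
    rw [Units.val_mul, transition_val hu hu, div_mul_div_cancel₀ hu.2, div_self hu.1, one_mul]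
  continuousOn_coordChange β α := by
    refine ContinuousOn.mul ?_ continuousOn_snd
    refine (continuousOn_transition α β).comp continuousOn_fst ?_
    rintro ⟨u, l⟩ ⟨hu, -⟩
    exact ⟨hu.2, hu.1⟩
  coordChange_comp := by
    rintro i j k u ⟨⟨hi, hj⟩, hk⟩ l
    ext
    simp only [Units.val_mul, transition_val hk hj, transition_val hj hi, transition_val hk hi]
    have := hi.1
    have := hi.2
    have := hj.1
    have := hj.2
    have := hk.2
    field_simp

/-- The zeros–poles model: the total space of the principal `ℂ*`-bundle over `M_s`. -/
def OmegaZP (s : ℕ) (hs : 2 ≤ s) : Type := (zpBundle s hs).TotalSpace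

instance (s : ℕ) (hs : 2 ≤ s) : TopologicalSpace (OmegaZP s hs) :=
  inferInstanceAs (TopologicalSpace (zpBundle s hs).TotalSpace)

/-- The complex structure on the total space, given by the local trivializations and the complex
structures of `M_s` and `ℂ*`. -/
instance (s : ℕ) (hs : 2 ≤ s) :
    ChartedSpace (ModelProd (ModelProd (Fin (s - 2) → ℂ) (Fin s → ℂ)) ℂ) (OmegaZP s hs) :=
  letI : ChartedSpace (zerosPoles s × ℂˣ) (OmegaZP s hs) :=
    inferInstanceAs (ChartedSpace (zerosPoles s × ℂˣ) (zpBundle s hs).TotalSpace)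
  ChartedSpace.comp _ (zerosPoles s × ℂˣ) _

/-- The point `[u, l]` of the total space that has coordinates `(u, l)` in the trivialization over
`𝒰_α`. -/
def zpPoint {s : ℕ} (hs : 2 ≤ s) (α : BundleIndex s) (u : zerosPoles s) (l : ℂˣ) :
    OmegaZP s hs :=
  ((zpBundle s hs).localTriv α).toOpenPartialHomeomorph.symm (u, l)

/-! ### The residues–poles model -/

/-- The hyperplane `r₁ + … + r_s = 0` of `ℂˢ`. -/
def residueHyperplane (s : ℕ) : Submodule ℂ (Fin s → ℂ) where
  carrier := {r | ∑ i, r i = 0}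
  add_mem' {a b} ha hb := by
    simp only [Set.mem_ofPred_eq] at ha hb
    simp [Finset.sum_add_distrib, ha, hb]
  zero_mem' := by simp
  smul_mem' c r hr := by
    simp only [Set.mem_ofPred_eq] at hr
    simp [← Finset.mul_sum, hr]

/-- `H_s`: the tuples of non-zero complex numbers with `r₁ + … + r_s = 0`. -/
def residueSpace (s : ℕ) : TopologicalSpace.Opens (residueHyperplane s) where
  carrier := {r | ∀ i, r.1 i ≠ 0}
  is_open' := by
    simp only [Set.ofPred_forall]
    exact isOpen_iInter_of_finite fun i => isOpen_ne_fun
      ((continuous_apply i).comp (continuous_subtype_val.comp continuous_id)) continuous_const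

/-- The product complex structure on `n`-tuples of points of the sphere. -/
instance (n : ℕ) : ChartedSpace (Fin n → ℂ) (Fin n → RiemannSphere) :=
  piChartedSpace (fun _ => ℂ) (fun _ => RiemannSphere)

/-- The space of `s`-tuples of pairwise distinct points of the sphere. -/
def poleSpace (s : ℕ) : TopologicalSpace.Opens (Fin s → RiemannSphere) where
  carrier := {p | Function.Injective p}
  is_open' := by
    have h1 : {p : Fin s → RiemannSphere | Function.Injective p} =
        ⋂ i, ⋂ j, ⋂ (_ : i ≠ j), {p | p i ≠ p j} := by
      ext x
      simp only [Set.mem_ofPred_eq, Set.mem_iInter, Function.Injective]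
      exact ⟨fun h i j hij he => hij (h he), fun h i j he => by_contra fun hij => h i j hij he⟩
    rw [h1]
    exact isOpen_iInter_of_finite fun i => isOpen_iInter_of_finite fun j =>
      isOpen_iInter_of_finite fun _ => isOpen_ne_fun (continuous_apply i) (continuous_apply j)

/-- The diagonal action
`(σ, (r, p)) ↦ (r_{σ(1)}, …, r_{σ(s)}, p_{σ(1)}, …, p_{σ(s)})` of the symmetric group on
`H_s × (Ĉˢ ∖ Δ)`. -/
instance (s : ℕ) : SMul (SymGroup s) (residueSpace s × poleSpace s) where
  smul σ x := (⟨⟨fun i => x.1.1.1 (DomMulAct.mk.symm σ i),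
      (Equiv.sum_comp (DomMulAct.mk.symm σ) x.1.1.1).trans x.1.1.2⟩, fun _ => x.1.2 _⟩,
    ⟨fun i => x.2.1 (DomMulAct.mk.symm σ i),
      Function.Injective.comp x.2.2 (DomMulAct.mk.symm σ).injective⟩)

instance (s : ℕ) : MulAction (SymGroup s) (residueSpace s × poleSpace s) where
  one_smul _ := rfl
  mul_smul _ _ _ := rfl

instance (s : ℕ) : ContinuousConstSMul (SymGroup s) (residueSpace s × poleSpace s) where
  continuous_const_smul σ := by
    refine Continuous.prodMk ?_ ?_
    · refine Continuous.subtype_mk (Continuous.subtype_mk (continuous_pi fun i => ?_) _) _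
      exact (continuous_apply (DomMulAct.mk.symm σ i)).comp
        (continuous_subtype_val.comp (continuous_subtype_val.comp continuous_fst))
    · refine Continuous.subtype_mk (continuous_pi fun i => ?_) _
      exact (continuous_apply (DomMulAct.mk.symm σ i)).comp
        (continuous_subtype_val.comp continuous_snd)

/-- The action of the symmetric group on `H_s × (Ĉˢ ∖ Δ)` is free. -/
instance (s : ℕ) : IsCancelSMul (SymGroup s) (residueSpace s × poleSpace s) where
  left_cancel' σ _ _ h := MulAction.injective σ h
  right_cancel' σ τ x h := by
    apply DomMulAct.mk.symm.injective
    ext i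
    have h2 : x.2.1 (DomMulAct.mk.symm σ i) = x.2.1 (DomMulAct.mk.symm τ i) :=
      congrArg (fun y : residueSpace s × poleSpace s => y.2.1 i) h
    exact congrArg Fin.val (x.2.2 h2)

instance (s : ℕ) : Finite (SymGroup s) :=
  Finite.of_equiv (Equiv.Perm (Fin s)) DomMulAct.mk

instance (s : ℕ) : LocallyCompactSpace (residueSpace s) := by
  have : ProperSpace (residueHyperplane s) := FiniteDimensional.proper ℂ _
  exact (residueSpace s).isOpen.locallyCompactSpace

instance (s : ℕ) : LocallyCompactSpace (poleSpace s) :=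
  (poleSpace s).isOpen.locallyCompactSpace

/-- The residues–poles model: the quotient of `H_s × (Ĉˢ ∖ Δ)` by the diagonal action
`(σ, (r, p)) ↦ (r_{σ(1)}, …, r_{σ(s)}, p_{σ(1)}, …, p_{σ(s)})` of the symmetric group, with the
quotient topology. -/
def OmegaRP (s : ℕ) : Type :=
  MulAction.orbitRel.Quotient (SymGroup s) (residueSpace s × poleSpace s)

instance (s : ℕ) : TopologicalSpace (OmegaRP s) :=
  inferInstanceAs (TopologicalSpace
    (Quotient (MulAction.orbitRel (SymGroup s) (residueSpace s × poleSpace s))))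

/-- The complex structure on the quotient by the free, properly discontinuous action. -/
instance (s : ℕ) :
    ChartedSpace (ModelProd (residueHyperplane s) (Fin s → ℂ)) (OmegaRP s) :=
  inferInstanceAs (ChartedSpace (ModelProd (residueHyperplane s) (Fin s → ℂ))
    (MulAction.orbitRel.Quotient (SymGroup s) (residueSpace s × poleSpace s)))

/-- The class `⟨r₁, …, r_s; p₁, …, p_s⟩`. -/
def rpPoint {s : ℕ} (r : residueSpace s) (p : poleSpace s) : OmegaRP s :=
  Quotient.mk (MulAction.orbitRel (SymGroup s) (residueSpace s × poleSpace s)) (r, p)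

/-! ### The explicit maps -/

/-- The vector `(a, b) = (a_{s-2}, …, a₀, b_s, …, b₀)`. -/
def pairVec (s : ℕ) (a : Fin (s - 2 + 1) → ℂ) (b : Fin (s + 1) → ℂ) : Fin (2 * s - 1 + 1) → ℂ :=
  fun i => if h : (i : ℕ) < s - 2 + 1 then a ⟨i, h⟩
    else b ⟨(i : ℕ) - (s - 2 + 1), by have := i.2; omega⟩

/-- The numerator `∑ⱼ rⱼ ∏_{i ≠ j} (z - pᵢ)` of the sum of the simple fractions `rⱼ / (z - pⱼ)`
over the common denominator `∏ᵢ (z - pᵢ)`, where the sum runs over the `j` with `pⱼ ≠ ∞` and a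
factor with `pᵢ = ∞` is omitted. -/
def residueNumerator {s : ℕ} (r : Fin s → ℂ) (p : Fin s → RiemannSphere) : ℂ[X] :=
  ∑ j, (p j).elim 0 fun _ => C (r j) * ∏ i ∈ Finset.univ.erase j, linearFactor (p i)

/-- Homogeneous coordinates of the image of `⟨r; p⟩` in the coefficient model: the coefficients of
`z^{s-2}, …, z⁰` in the numerator, followed by the Viète map of the poles. -/
def rpVec {s : ℕ} (r : residueSpace s) (p : poleSpace s) : Fin (2 * s - 1 + 1) → ℂ :=
  pairVec s (fun k => (residueNumerator r.1.1 p.1).coeff (s - 2 - (k : ℕ)))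
    (viete s 1 (SymProd.mk p.1))

/-- Homogeneous coordinates of the image of `[u, l]`, `u = {c₁, …, c_{s-2}, p₁, …, p_s} ∈ 𝒰_α`, in
the coefficient model: `(l (P_u(α) / Q_u(α)) ν_{s-2}(1, {c_j}), ν_s(1, {pᵢ}))`. -/
def zpVec {s : ℕ} (α : BundleIndex s) (u : zerosPoles s) (l : ℂˣ) : Fin (2 * s - 1 + 1) → ℂ :=
  pairVec s
    ((l * ((polePoly u).eval α.pt / (zeroPoly u).eval α.pt) : ℂ) • viete (s - 2) 1 u.1.1)
    (viete s 1 u.1.2)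

/-- The model space of the coefficient model. -/
abbrev modelCoef (s : ℕ) := 𝓘(ℂ, Fin (2 * s - 1) → ℂ)

/-- The model space of the zeros–poles model. -/
abbrev modelZP (s : ℕ) :=
  (𝓘(ℂ, Fin (s - 2) → ℂ).prod 𝓘(ℂ, Fin s → ℂ)).prod 𝓘(ℂ, ℂ)

/-- The model space of the residues–poles model. -/
abbrev modelRP (s : ℕ) := 𝓘(ℂ, residueHyperplane s).prod 𝓘(ℂ, Fin s → ℂ)

end

end SimplePoles

/-!
# Three models of the space of meromorphic forms with simple poles

A point of any of the three spaces is a meromorphic one-form `(Q(z) / P(z)) dz` on the sphere with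
`s` simple poles. The coefficient model records the coefficients of `Q` and `P` up to a common
factor, the zeros–poles model their roots together with one number for the scale, and the
residues–poles model the partial fractions `Q / P = ∑ rⱼ / (z - pⱼ)`.

*The conditions agree.* Over `ℂ` the resultant of two forms vanishes exactly if they have a common
root on the sphere, and the discriminant exactly if there is a double root, where a root at `∞`
shows in the vanishing of leading coefficients (`resultant_ne_zero_iff`, `formDiscr_ne_zero_iff`).
Hence the coefficient model consists of the pairs of forms with roots `c` and `p` such that `p` is
injective and avoids `c` (`coefCondition_iff_of_factorization`). This makes the map from the
zeros–poles model a bijection (`zpEquiv`). For the residues–poles model, `Q` is determined by the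
residues `rⱼ = Q(pⱼ) / P'(pⱼ)` at the finite poles, the residue at `∞` follows from `∑ rⱼ = 0`, and
every `Q` of degree at most `s - 2` arises in this way (`exists_residues`), so that two pairs
`(r, p)` have the same image exactly if they differ by a permutation (`rpEquiv`).

*The bijections are biholomorphic.* It is enough to check that they and their inverses are
holomorphic in each chart of the given atlas of the source; the compatibility of these charts is
then a consequence, as the changes of coordinates factor through the coefficient model
(`IsChartwiseBiholomorphic`). With homogeneous coordinates `a`, `b` of the unordered tuples of zeros
and poles, that is with forms `A`, `B`, the map of the zeros–poles model is
`l ↦ [l (B(α) / A(α)) A : B]` over `𝒰_α`, and its inverse is `[A : B] ↦ ([A], [B], A(α) / B(α))`.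
For the residues–poles model the map is polynomial once every factor `z - pⱼ` is replaced by
`wⱼ z - 1` near `pⱼ = ∞`, `wⱼ = 1 / pⱼ` (`contMDiff_rpLift`). Its inverse is holomorphic because a
simple root is a holomorphic function of the coefficients, by the implicit function theorem
(`exists_holomorphic_root`); the formula for the residues then gives a holomorphic local section
through every `(r, p)` (`exists_rpLift_section`).

The Hausdorff property and second countability are inherited from projective space.
-/


namespace SimplePoles

noncomputable section

/-! ### Resultants and discriminants of forms -/

/-- The resultant of two forms of degrees `m` and `n` is non-zero if and only if they have no common
root on the sphere; a root at `∞` is a vanishing coefficient of `zᵐ` or `zⁿ`. For `m = n = 0` this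
fails, as the resultant is `1` even if both forms vanish. -/
theorem resultant_ne_zero_iff {f g : ℂ[X]} {m n : ℕ} (hf : f.natDegree ≤ m)
    (hg : g.natDegree ≤ n) (hmn : m ≠ 0 ∨ n ≠ 0) :
    resultant f g m n ≠ 0 ↔
      ¬(f.coeff m = 0 ∧ g.coeff n = 0) ∧ ∀ z, ¬(f.eval z = 0 ∧ g.eval z = 0) := by
  have lt_of_coeff : ∀ {f : ℂ[X]} {m : ℕ}, f.natDegree ≤ m → f.coeff m = 0 → m ≠ 0 →
      f.natDegree < m := by
    intro f m hf h hm
    refine lt_of_le_of_ne hf fun he => ?_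
    rw [← he, coeff_natDegree, leadingCoeff_eq_zero] at h
    rw [h, natDegree_zero] at he
    exact hm he.symm
  constructor
  · intro h
    refine ⟨fun ⟨h1, h2⟩ => h ?_, fun z ⟨h1, h2⟩ => h ?_⟩
    · rcases eq_or_ne m 0 with rfl | hm
      · rw [resultant_zero_left_deg, h1, zero_pow (by tauto)]
      rcases eq_or_ne n 0 with rfl | hn
      · rw [resultant_zero_right_deg, h2, zero_pow hm]
      exact resultant_eq_zero_of_lt_lt _ _ _ _ (lt_of_coeff hf h1 hm) (lt_of_coeff hg h2 hn)
    · obtain ⟨p, q, -, -, hpq⟩ := exists_mul_add_mul_eq_C_resultant f g hf hg hmn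
      have := congrArg (eval z) hpq
      simpa [h1, h2] using this.symm
  · rintro ⟨h1, h2⟩
    have key : ∀ {f g : ℂ[X]} {m n : ℕ}, f.natDegree ≤ m → g.natDegree ≤ n →
        (∀ z, ¬(f.eval z = 0 ∧ g.eval z = 0)) → f.coeff m ≠ 0 → resultant f g m n ≠ 0 := by
      intro f g m n hf hg h2 hm
      have hfm : f.natDegree = m := natDegree_eq_of_le_of_coeff_ne_zero hf hm
      obtain ⟨k, rfl⟩ := Nat.exists_eq_add_of_le hg
      rw [resultant_add_right_deg _ _ _ _ _ le_rfl]
      subst hfm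
      refine mul_ne_zero (pow_ne_zero _ hm) (resultant_ne_zero _ _ ?_)
      refine (isCoprime_iff_aeval_ne_zero_of_isAlgClosed ℂ ℂ f g).2 fun z => ?_
      simp only [coe_aeval_eq_eval]
      have := h2 z
      tauto
    by_cases hm : f.coeff m = 0
    · rw [resultant_comm]
      refine mul_ne_zero (pow_ne_zero _ (by norm_num)) ?_
      exact key hg hf (fun z hz => h2 z hz.symm) fun h => h1 ⟨hm, h⟩
    · exact key hf hg h2 hm

/-- The discriminant of a form of degree `d` is non-zero if and only if the form has no double root
on the sphere; a double root at `∞` is the vanishing of the coefficients of `z^d` and `z^(d-1)`. -/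
theorem formDiscr_ne_zero_iff {f : ℂ[X]} {d : ℕ} (hd : 2 ≤ d) (hf : f.natDegree ≤ d) :
    formDiscr d f ≠ 0 ↔ ¬(f.coeff d = 0 ∧ f.coeff (d - 1) = 0) ∧
      ∀ z, ¬(f.eval z = 0 ∧ (derivative f).eval z = 0) := by
  have hd0 : (d : ℂ) ≠ 0 := by norm_cast; omega
  obtain ⟨e, rfl⟩ : ∃ e, d = e + 2 := ⟨d - 2, by omega⟩
  have h2 : (C ((e + 2 : ℕ) : ℂ) * f - X * derivative f).natDegree ≤ e + 2 - 1 := by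
    rw [natDegree_le_iff_coeff_eq_zero]
    intro k hk
    obtain ⟨j, rfl⟩ : ∃ j, k = j + 1 := ⟨k - 1, by omega⟩
    rw [coeff_sub, coeff_C_mul, coeff_X_mul, coeff_derivative]
    rcases eq_or_ne j (e + 1) with rfl | hj
    · push_cast; ring
    · rw [coeff_eq_zero_of_natDegree_lt (by omega)]; ring
  rw [formDiscr, resultant_ne_zero_iff
    ((natDegree_derivative_le f).trans (Nat.sub_le_sub_right hf 1)) h2 (by omega)]
  refine and_congr (not_congr ?_) (forall_congr' fun z => not_congr ?_)
  · simp only [show e + 2 - 1 = e + 1 by omega, coeff_sub, coeff_C_mul,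
      coeff_X_mul, coeff_derivative]
    have h : ((e + 1 : ℕ) : ℂ) + 1 ≠ 0 := by exact_mod_cast hd0
    constructor
    · rintro ⟨h3, h4⟩
      refine ⟨(mul_eq_zero.1 h3).resolve_right h, ?_⟩
      push_cast at h4
      linear_combination h4
    · rintro ⟨h3, h4⟩
      simp [h3, h4]
  · simp only [eval_sub, eval_mul, eval_C, eval_X]
    constructor
    · rintro ⟨h3, h4⟩
      rw [h3, mul_zero, sub_zero] at h4
      exact ⟨(mul_eq_zero.1 h4).resolve_left hd0, h3⟩
    · rintro ⟨h3, h4⟩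
      simp [h3, h4]

/-! ### Polynomials and their coefficient vectors -/

/-- The coefficients of `zⁿ, …, z⁰` of a polynomial, in this order. -/
def coeffVec (n : ℕ) (f : ℂ[X]) : Fin (n + 1) → ℂ := fun k => f.coeff (n - k)

theorem viete_eq_coeffVec (n : ℕ) (b : ℂ) (u : SymProd n) :
    viete n b u = coeffVec n (C b * u.poly) := by
  ext k
  simp [viete, coeffVec]

theorem coeffVec_C_mul (n : ℕ) (c : ℂ) (f : ℂ[X]) :
    coeffVec n (C c * f) = c • coeffVec n f := by
  ext k
  simp [coeffVec]

theorem coeffVec_ne_zero {n : ℕ} {f : ℂ[X]} (hf : f.natDegree ≤ n) (h0 : f ≠ 0) :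
    coeffVec n f ≠ 0 := by
  intro h
  exact h0 (poly_ext_of_natDegree_le hf (by simp) fun k => by
    simpa [coeffVec] using congrFun h k)

theorem numPoly_coeff {s : ℕ} (hs : 2 ≤ s) (v : Fin (2 * s - 1 + 1) → ℂ) (k : ℕ) :
    (numPoly s v).coeff k = if k ≤ s - 2 then v ⟨s - 2 - k, by omega⟩ else 0 := by
  simp only [numPoly, finsetSum_coeff]
  split_ifs with hk
  · rw [Finset.sum_eq_single ⟨s - 2 - k, by omega⟩]
    · simp only
      rw [if_pos (by omega), coeff_C_mul_X_pow, if_pos (by omega)]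
    · intro i _ hi
      split_ifs with h
      · rw [coeff_C_mul_X_pow, if_neg]
        intro h2
        exact hi (Fin.ext (by simp only; omega))
      · simp
    · simp
  · refine Finset.sum_eq_zero fun i _ => ?_
    split_ifs with h
    · rw [coeff_C_mul_X_pow, if_neg (by omega)]
    · simp

theorem denPoly_coeff {s : ℕ} (hs : 2 ≤ s) (v : Fin (2 * s - 1 + 1) → ℂ) (k : ℕ) :
    (denPoly s v).coeff k = if k ≤ s then v ⟨2 * s - 1 - k, by omega⟩ else 0 := by
  simp only [denPoly, finsetSum_coeff]
  split_ifs with hk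
  · rw [Finset.sum_eq_single ⟨2 * s - 1 - k, by omega⟩]
    · simp only
      rw [if_neg (by omega), coeff_C_mul_X_pow, if_pos (by omega)]
    · intro i _ hi
      split_ifs with h
      · simp
      · rw [coeff_C_mul_X_pow, if_neg]
        intro h2
        exact hi (Fin.ext (by simp only; omega))
    · simp
  · refine Finset.sum_eq_zero fun i _ => ?_
    split_ifs with h
    · simp
    · rw [coeff_C_mul_X_pow, if_neg (by omega)]

theorem numPoly_smul {s : ℕ} (hs : 2 ≤ s) (c : ℂ) (v : Fin (2 * s - 1 + 1) → ℂ) :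
    numPoly s (c • v) = C c * numPoly s v := by
  ext k
  rw [coeff_C_mul, numPoly_coeff hs, numPoly_coeff hs]
  split_ifs <;> simp

theorem denPoly_smul {s : ℕ} (hs : 2 ≤ s) (c : ℂ) (v : Fin (2 * s - 1 + 1) → ℂ) :
    denPoly s (c • v) = C c * denPoly s v := by
  ext k
  rw [coeff_C_mul, denPoly_coeff hs, denPoly_coeff hs]
  split_ifs <;> simp

theorem numPoly_natDegree_le {s : ℕ} (hs : 2 ≤ s) (v : Fin (2 * s - 1 + 1) → ℂ) :
    (numPoly s v).natDegree ≤ s - 2 := by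
  rw [natDegree_le_iff_coeff_eq_zero]
  intro k hk
  rw [numPoly_coeff hs, if_neg (by omega)]

theorem denPoly_natDegree_le {s : ℕ} (hs : 2 ≤ s) (v : Fin (2 * s - 1 + 1) → ℂ) :
    (denPoly s v).natDegree ≤ s := by
  rw [natDegree_le_iff_coeff_eq_zero]
  intro k hk
  rw [denPoly_coeff hs, if_neg (by omega)]

theorem pairVec_coeffVec {s : ℕ} (hs : 2 ≤ s) (v : Fin (2 * s - 1 + 1) → ℂ) :
    pairVec s (coeffVec (s - 2) (numPoly s v)) (coeffVec s (denPoly s v)) = v := by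
  ext i
  simp only [pairVec, coeffVec, numPoly_coeff hs, denPoly_coeff hs]
  have := i.2
  split_ifs
  · congr 1; ext; simp only; omega
  · omega
  · congr 1; ext; simp only; omega
  · omega

theorem numPoly_pairVec {s : ℕ} (hs : 2 ≤ s) {f : ℂ[X]} (hf : f.natDegree ≤ s - 2)
    (b : Fin (s + 1) → ℂ) : numPoly s (pairVec s (coeffVec (s - 2) f) b) = f := by
  ext k
  rw [numPoly_coeff hs]
  split_ifs with hk
  · simp only [pairVec, coeffVec]
    rw [dif_pos (by omega), Nat.sub_sub_self hk]
  · rw [coeff_eq_zero_of_natDegree_lt (by omega)]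

theorem denPoly_pairVec {s : ℕ} (hs : 2 ≤ s) {f : ℂ[X]} (hf : f.natDegree ≤ s)
    (a : Fin (s - 2 + 1) → ℂ) : denPoly s (pairVec s a (coeffVec s f)) = f := by
  ext k
  rw [denPoly_coeff hs]
  split_ifs with hk
  · simp only [pairVec, coeffVec]
    rw [dif_neg (by omega)]
    congr 1; omega
  · rw [coeff_eq_zero_of_natDegree_lt (by omega)]

theorem pairVec_smul (s : ℕ) (c : ℂ) (a : Fin (s - 2 + 1) → ℂ) (b : Fin (s + 1) → ℂ) :
    pairVec s (c • a) (c • b) = c • pairVec s a b := by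
  ext i
  simp only [pairVec, Pi.smul_apply]
  split_ifs <;> rfl

/-! ### The defining condition in terms of roots -/

theorem coefCondition_iff {s : ℕ} (hs : 2 ≤ s) (v : Fin (2 * s - 1 + 1) → ℂ) :
    coefCondition s v ↔
      (¬((denPoly s v).coeff s = 0 ∧ (numPoly s v).coeff (s - 2) = 0) ∧
        ∀ z, ¬((denPoly s v).eval z = 0 ∧ (numPoly s v).eval z = 0)) ∧
      (¬((denPoly s v).coeff s = 0 ∧ (denPoly s v).coeff (s - 1) = 0) ∧
        ∀ z, ¬((denPoly s v).eval z = 0 ∧ (derivative (denPoly s v)).eval z = 0)) := by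
  rw [coefCondition, resultant_ne_zero_iff (denPoly_natDegree_le hs v) (numPoly_natDegree_le hs v)
    (by omega), formDiscr_ne_zero_iff hs (denPoly_natDegree_le hs v)]

open Classical in
theorem rootPoly_natDegree_add {n : ℕ} (p : Fin n → RiemannSphere) :
    (rootPoly p).natDegree + Fintype.card {i // p i = OnePoint.infty} = n := by
  rw [rootPoly, natDegree_prod_of_monic _ _ fun i _ => linearFactor_monic (p i),
    Fintype.card_subtype, Finset.card_filter, ← Finset.sum_add_distrib]
  have : ∀ i, (linearFactor (p i)).natDegree + (if p i = OnePoint.infty then 1 else 0) = 1 := by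
    intro i
    generalize p i = q
    induction q using OnePoint.rec with
    | infty => simp
    | coe d => simp
  simp [this]

theorem rootPoly_eval_eq_zero_iff {n : ℕ} (p : Fin n → RiemannSphere) (z : ℂ) :
    (rootPoly p).eval z = 0 ↔ ∃ i, p i = (z : RiemannSphere) := by
  have := rootPoly_eval_ne_zero_iff p z
  rw [← not_iff_not, ← ne_eq, this]
  push Not
  rfl

theorem rootPoly_coeff_eq_zero_iff {n : ℕ} (p : Fin n → RiemannSphere) :
    (rootPoly p).coeff n = 0 ↔ ∃ i, p i = OnePoint.infty := by
  classical
  have h := rootPoly_natDegree_add p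
  constructor
  · intro h0
    by_contra hc
    push Not at hc
    have : IsEmpty {i // p i = OnePoint.infty} := ⟨fun i => hc i.1 i.2⟩
    rw [Fintype.card_eq_zero, add_zero] at h
    have hm := (rootPoly_monic p).coeff_natDegree
    rw [h, h0] at hm
    exact zero_ne_one hm
  · rintro ⟨i, hi⟩
    have : 0 < Fintype.card {i // p i = OnePoint.infty} := Fintype.card_pos_iff.2 ⟨⟨i, hi⟩⟩
    exact coeff_eq_zero_of_natDegree_lt (by omega)

/-- The points of a tuple are distinct if and only if the form with these roots has no double root,
at `∞` or at a finite point. -/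
theorem injective_iff_rootPoly {n : ℕ} (hn : 2 ≤ n) (p : Fin n → RiemannSphere) :
    Function.Injective p ↔
      ¬((rootPoly p).coeff n = 0 ∧ (rootPoly p).coeff (n - 1) = 0) ∧
        ∀ z, ¬((rootPoly p).eval z = 0 ∧ (derivative (rootPoly p)).eval z = 0) := by
  classical
  have h1 : Function.Injective p ↔ ∀ c, Fintype.card {i // p i = c} ≤ 1 := by
    simp only [Fintype.card_le_one_iff]
    constructor
    · rintro h c ⟨i, hi⟩ ⟨j, hj⟩
      exact Subtype.ext (h (hi.trans hj.symm))
    · intro h i j hij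
      exact congrArg Subtype.val (h (p j) ⟨i, hij⟩ ⟨j, rfl⟩)
  rw [h1, OnePoint.forall]
  refine and_congr ?_ (forall_congr' fun z => ?_)
  · have h := rootPoly_natDegree_add p
    have hm := (rootPoly_monic p).coeff_natDegree
    constructor
    · rintro hc ⟨h2, h3⟩
      rcases Nat.le_one_iff_eq_zero_or_eq_one.1 hc with h4 | h4
      · rw [show (rootPoly p).natDegree = n by omega, h2] at hm
        exact zero_ne_one hm
      · rw [show (rootPoly p).natDegree = n - 1 by omega, h3] at hm
        exact zero_ne_one hm
    · intro hc
      by_contra h4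
      exact hc ⟨coeff_eq_zero_of_natDegree_lt (by omega), coeff_eq_zero_of_natDegree_lt (by omega)⟩
  · rw [← rootPoly_roots_count, ← not_iff_not, not_le, not_not,
      one_lt_rootMultiplicity_iff_isRoot (rootPoly_monic p).ne_zero]
    rfl

/-- In terms of the zeros `c` and the poles `p`, the resultant and the discriminant are non-zero
exactly if the poles are distinct from each other and from the zeros. -/
theorem coefCondition_iff_of_factorization {s : ℕ} (hs : 2 ≤ s) {v : Fin (2 * s - 1 + 1) → ℂ}
    {κ μ : ℂ} (hκ : κ ≠ 0) (hμ : μ ≠ 0) {c : Fin (s - 2) → RiemannSphere}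
    {p : Fin s → RiemannSphere} (hc : numPoly s v = C κ * rootPoly c)
    (hp : denPoly s v = C μ * rootPoly p) :
    coefCondition s v ↔ Function.Injective p ∧ ∀ j i, c j ≠ p i := by
  rw [coefCondition_iff hs, injective_iff_rootPoly hs, and_comm, hc, hp]
  simp only [coeff_C_mul, eval_mul, eval_C, derivative_C_mul, mul_eq_zero, hκ, hμ, false_or]
  refine and_congr_right fun _ => ?_
  simp only [rootPoly_coeff_eq_zero_iff, rootPoly_eval_eq_zero_iff]
  constructor
  · rintro ⟨h1, h2⟩ j i hij
    cases hq : p i using OnePoint.rec with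
    | infty => exact h1 ⟨⟨i, hq⟩, ⟨j, hij.trans hq⟩⟩
    | coe z => exact h2 z ⟨⟨i, hq⟩, ⟨j, hij.trans hq⟩⟩
  · intro h
    refine ⟨?_, fun z => ?_⟩ <;>
    · rintro ⟨⟨i, hi⟩, ⟨j, hj⟩⟩
      exact h j i (hj.trans hi.symm)

/-- A non-zero form of degree `n` is a multiple of the product of the linear factors of its `n` roots
on the sphere. -/
theorem exists_eq_C_mul_rootPoly {n : ℕ} {f : ℂ[X]} (hf : f.natDegree ≤ n) (h0 : f ≠ 0) :
    ∃ (κ : ℂ) (p : Fin n → RiemannSphere), κ ≠ 0 ∧ f = C κ * rootPoly p := by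
  obtain ⟨u, hu⟩ := vieteProj_surjective n (CP.proj n ⟨_, coeffVec_ne_zero hf h0⟩)
  obtain ⟨p, rfl⟩ := (SymProd.isOpenQuotientMap_mk n).surjective u
  obtain ⟨a, ha⟩ := (CP.proj_eq_iff _ _).1 hu.symm
  refine ⟨a, p, a.ne_zero, poly_ext_of_natDegree_le hf
    ((natDegree_C_mul_le _ _).trans (rootPoly_natDegree_le p)) fun k => ?_⟩
  simpa [viete, coeffVec, Units.smul_def] using (congrFun ha k).symm

theorem denPoly_ne_zero {s : ℕ} (hs : 2 ≤ s) {v : Fin (2 * s - 1 + 1) → ℂ}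
    (h : coefCondition s v) : denPoly s v ≠ 0 := by
  intro h0
  have := ((coefCondition_iff hs v).1 h).2.1
  simp [h0] at this

theorem numPoly_ne_zero {s : ℕ} (hs : 2 ≤ s) {v : Fin (2 * s - 1 + 1) → ℂ}
    (h : coefCondition s v) : numPoly s v ≠ 0 := by
  intro h0
  obtain ⟨μ, p, hμ, hp⟩ := exists_eq_C_mul_rootPoly (denPoly_natDegree_le hs v)
    (denPoly_ne_zero hs h)
  obtain ⟨h1, h2⟩ := ((coefCondition_iff hs v).1 h).1
  simp only [h0, hp, coeff_C_mul, coeff_zero, and_true, mul_eq_zero, hμ, false_or, eval_mul,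
    eval_C, eval_zero, rootPoly_coeff_eq_zero_iff, rootPoly_eval_eq_zero_iff] at h1 h2
  cases hq : p ⟨0, by omega⟩ using OnePoint.rec with
  | infty => exact h1 ⟨_, hq⟩
  | coe z => exact h2 z ⟨_, hq⟩

/-! ### Partial fractions -/

/-- The restriction to finite poles is encoded in the derivative of the linear factor, which is `0`
at `∞` and `1` elsewhere. In this form the numerator scales along with the linear factors. -/
theorem residueNumerator_eq {s : ℕ} (r : Fin s → ℂ) (p : Fin s → RiemannSphere) :
    residueNumerator r p = ∑ j, C (r j) * derivative (linearFactor (p j)) *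
      ∏ i ∈ Finset.univ.erase j, linearFactor (p i) := by
  refine Finset.sum_congr rfl fun j _ => ?_
  generalize p j = q
  induction q using OnePoint.rec with
  | infty =>
    rw [linearFactor_infty, derivative_one, mul_zero, zero_mul]
    rfl
  | coe c =>
    rw [linearFactor_coe, derivative_X_sub_C, mul_one]
    rfl

theorem residueNumerator_eval {s : ℕ} (r : Fin s → ℂ) (p : Fin s → RiemannSphere) {j : Fin s}
    {z : ℂ} (hj : p j = (z : RiemannSphere)) :
    (residueNumerator r p).eval z = r j * (derivative (rootPoly p)).eval z := by
  rw [residueNumerator_eq, rootPoly, derivative_prod_finset, eval_finsetSum, eval_finsetSum,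
    Finset.sum_eq_single j, Finset.sum_eq_single j]
  · simp only [eval_mul, eval_C, hj, linearFactor_coe, derivative_X_sub_C, eval_one]
    ring
  · intro b _ hb
    rw [eval_mul, eval_prod, Finset.prod_eq_zero (Finset.mem_erase.2 ⟨hb.symm, Finset.mem_univ j⟩)]
    · simp
    · simp [hj]
  · simp
  · intro b _ hb
    rw [eval_mul, eval_prod, Finset.prod_eq_zero (Finset.mem_erase.2 ⟨hb.symm, Finset.mem_univ j⟩)]
    · simp
    · simp [hj]
  · simp

theorem derivative_rootPoly_eval_ne_zero {s : ℕ} {p : Fin s → RiemannSphere} (hs : 2 ≤ s)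
    (hp : Function.Injective p) {j : Fin s} {z : ℂ} (hj : p j = (z : RiemannSphere)) :
    (derivative (rootPoly p)).eval z ≠ 0 := fun h =>
  ((injective_iff_rootPoly hs p).1 hp).2 z ⟨(rootPoly_eval_eq_zero_iff p z).2 ⟨j, hj⟩, h⟩

theorem natDegree_prod_erase_of_infty {s : ℕ} {p : Fin s → RiemannSphere}
    (hp : Function.Injective p) {i₀ j : Fin s} (hi : p i₀ = OnePoint.infty) (hj : j ≠ i₀) :
    (∏ i ∈ Finset.univ.erase j, linearFactor (p i)).natDegree = s - 2 := by
  rw [natDegree_prod_of_monic _ _ fun i _ => linearFactor_monic (p i),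
    ← Finset.add_sum_erase _ _ (Finset.mem_erase.2 ⟨hj.symm, Finset.mem_univ i₀⟩), hi,
    Finset.sum_congr rfl (g := fun _ => 1)]
  · rw [Finset.sum_const,
      Finset.card_erase_of_mem (Finset.mem_erase.2 ⟨hj.symm, Finset.mem_univ i₀⟩),
      Finset.card_erase_of_mem (Finset.mem_univ _)]
    simp
    omega
  · intro i hi'
    have hne : p i ≠ OnePoint.infty := fun h => (Finset.mem_erase.1 hi').1 (hp (h.trans hi.symm))
    cases hq : p i using OnePoint.rec with
    | infty => exact absurd hq hne
    | coe z => simp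

theorem natDegree_prod_erase_of_finite {s : ℕ} {p : Fin s → RiemannSphere}
    (hfin : ∀ i, p i ≠ OnePoint.infty) (j : Fin s) :
    (∏ i ∈ Finset.univ.erase j, linearFactor (p i)).natDegree = s - 1 := by
  rw [natDegree_prod_of_monic _ _ fun i _ => linearFactor_monic (p i),
    Finset.sum_congr rfl (g := fun _ => 1)]
  · rw [Finset.sum_const, Finset.card_erase_of_mem (Finset.mem_univ _)]
    simp
  · intro i _
    cases hq : p i using OnePoint.rec with
    | infty => exact absurd hq (hfin i)
    | coe z => simp

theorem prod_erase_monic {s : ℕ} (p : Fin s → RiemannSphere) (j : Fin s) :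
    (∏ i ∈ Finset.univ.erase j, linearFactor (p i)).Monic :=
  monic_prod_of_monic _ _ fun i _ => linearFactor_monic (p i)

theorem derivative_linearFactor_of_ne {q : RiemannSphere} (h : q ≠ OnePoint.infty) :
    derivative (linearFactor q) = 1 := by
  induction q using OnePoint.rec with
  | infty => exact absurd rfl h
  | coe c => simp

theorem residueNumerator_coeff_of_infty {s : ℕ} (r : Fin s → ℂ) {p : Fin s → RiemannSphere}
    (hp : Function.Injective p) {i₀ : Fin s} (hi : p i₀ = OnePoint.infty) :
    (residueNumerator r p).coeff (s - 2) = ∑ j ∈ Finset.univ.erase i₀, r j := by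
  rw [residueNumerator_eq, finsetSum_coeff,
    ← Finset.add_sum_erase _ _ (Finset.mem_univ i₀), hi]
  simp only [linearFactor_infty, derivative_one, mul_zero, zero_mul, coeff_zero, zero_add]
  refine Finset.sum_congr rfl fun j hj => ?_
  have hj' := (Finset.mem_erase.1 hj).1
  rw [derivative_linearFactor_of_ne fun h => hj' (hp (h.trans hi.symm)), mul_one, coeff_C_mul,
    ← natDegree_prod_erase_of_infty hp hi hj', (prod_erase_monic p j).coeff_natDegree, mul_one]

theorem residueNumerator_coeff_of_finite {s : ℕ} (r : Fin s → ℂ) {p : Fin s → RiemannSphere}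
    (hfin : ∀ i, p i ≠ OnePoint.infty) :
    (residueNumerator r p).coeff (s - 1) = ∑ j, r j := by
  rw [residueNumerator_eq, finsetSum_coeff]
  refine Finset.sum_congr rfl fun j _ => ?_
  rw [derivative_linearFactor_of_ne (hfin j), mul_one, coeff_C_mul,
    ← natDegree_prod_erase_of_finite hfin j, (prod_erase_monic p j).coeff_natDegree, mul_one]

/-- The coefficient of `z^(s-1)` in the numerator is the sum of the residues if all poles are finite,
and the terms have degree `s - 2` anyway if one of the poles is `∞`. -/
theorem residueNumerator_natDegree_le {s : ℕ} {r : Fin s → ℂ} {p : Fin s → RiemannSphere}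
    (hr : ∑ j, r j = 0) (hp : Function.Injective p) :
    (residueNumerator r p).natDegree ≤ s - 2 := by
  by_cases hfin : ∀ i, p i ≠ OnePoint.infty
  · rw [natDegree_le_iff_coeff_eq_zero]
    intro k hk
    rcases eq_or_ne k (s - 1) with rfl | hk1
    · rw [residueNumerator_coeff_of_finite r hfin, hr]
    · rw [residueNumerator_eq, finsetSum_coeff]
      refine Finset.sum_eq_zero fun j _ => ?_
      rw [derivative_linearFactor_of_ne (hfin j), mul_one, coeff_C_mul,
        coeff_eq_zero_of_natDegree_lt, mul_zero]
      rw [natDegree_prod_erase_of_finite hfin]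
      omega
  · push Not at hfin
    obtain ⟨i₀, hi⟩ := hfin
    rw [residueNumerator_eq]
    refine natDegree_sum_le_of_forall_le _ _ fun j _ => ?_
    rcases eq_or_ne j i₀ with rfl | hj
    · simp [hi]
    · rw [derivative_linearFactor_of_ne fun h => hj (hp (h.trans hi.symm)), mul_one]
      exact (natDegree_C_mul_le _ _).trans (natDegree_prod_erase_of_infty hp hi hj).le

theorem numPoly_rpVec {s : ℕ} (hs : 2 ≤ s) (r : residueSpace s) (p : poleSpace s) :
    numPoly s (rpVec r p) = residueNumerator r.1.1 p.1 :=
  numPoly_pairVec hs (residueNumerator_natDegree_le r.1.2 p.2) _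

theorem denPoly_rpVec {s : ℕ} (hs : 2 ≤ s) (r : residueSpace s) (p : poleSpace s) :
    denPoly s (rpVec r p) = rootPoly p.1 := by
  rw [rpVec, viete_eq_coeffVec, C_1, one_mul, SymProd.poly_mk]
  exact denPoly_pairVec hs (rootPoly_natDegree_le p.1) _

theorem rpVec_ne_zero {s : ℕ} (hs : 2 ≤ s) (r : residueSpace s) (p : poleSpace s) :
    rpVec r p ≠ 0 := by
  intro h
  have h1 := denPoly_rpVec hs r p
  rw [h] at h1
  exact (rootPoly_monic p.1).ne_zero (by rw [← h1]; ext k; simp [denPoly_coeff hs])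

theorem coefCondition_rpVec {s : ℕ} (hs : 2 ≤ s) (r : residueSpace s) (p : poleSpace s) :
    coefCondition s (rpVec r p) := by
  rw [coefCondition_iff hs, numPoly_rpVec hs, denPoly_rpVec hs]
  refine ⟨⟨?_, ?_⟩, (injective_iff_rootPoly hs p.1).1 p.2⟩
  · rintro ⟨h1, h2⟩
    obtain ⟨i, hi⟩ := (rootPoly_coeff_eq_zero_iff p.1).1 h1
    rw [residueNumerator_coeff_of_infty _ p.2 hi] at h2
    have h3 : ∑ j, r.1.1 j = 0 := r.1.2
    rw [← Finset.add_sum_erase _ _ (Finset.mem_univ i), h2, add_zero] at h3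
    exact r.2 i h3
  · rintro z ⟨h1, h2⟩
    obtain ⟨i, hi⟩ := (rootPoly_eval_eq_zero_iff p.1 z).1 h1
    rw [residueNumerator_eval _ _ hi] at h2
    exact mul_ne_zero (r.2 i) (derivative_rootPoly_eval_ne_zero hs p.2 hi) h2

/-- A polynomial that vanishes at the finite members of an injective family of points is a multiple
of the product of the corresponding linear factors. -/
theorem rootPoly_dvd {n : ℕ} {p : Fin n → RiemannSphere} (hp : Function.Injective p) {f : ℂ[X]}
    (h : ∀ (j : Fin n) (z : ℂ), p j = (z : RiemannSphere) → f.eval z = 0) : rootPoly p ∣ f := by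
  refine Finset.prod_dvd_of_coprime (fun i _ j _ hij => ?_) fun i _ => ?_
  · cases hi : p i using OnePoint.rec with
    | infty => simpa [Function.onFun, hi] using isCoprime_one_left
    | coe a =>
      cases hj : p j using OnePoint.rec with
      | infty => simpa [Function.onFun, hj] using isCoprime_one_right
      | coe b =>
        simp only [Function.onFun, hi, hj, linearFactor_coe]
        refine isCoprime_X_sub_C_of_isUnit_sub (sub_ne_zero.2 ?_).isUnit
        rintro rfl
        exact hij (hp (hi.trans hj.symm))
  · cases hi : p i using OnePoint.rec with
    | infty => simp
    | coe a =>
      rw [linearFactor_coe, dvd_iff_isRoot, IsRoot.def, h i a hi]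

/-- Two polynomials of degree at most `s - 2` agree as soon as they agree at all finite points of
an injective family of `s` points. -/
theorem eq_of_eval_eq {s : ℕ} (hs : 2 ≤ s) {f g : ℂ[X]} (hf : f.natDegree ≤ s - 2)
    (hg : g.natDegree ≤ s - 2) {p : Fin s → RiemannSphere} (hp : Function.Injective p)
    (h : ∀ (j : Fin s) (z : ℂ), p j = (z : RiemannSphere) → f.eval z = g.eval z) : f = g := by
  classical
  have hdvd : rootPoly p ∣ f - g := rootPoly_dvd hp fun j z hj => by
    rw [eval_sub, h j z hj, sub_self]
  have hdeg : s - 1 ≤ (rootPoly p).natDegree := by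
    have h1 := rootPoly_natDegree_add p
    have h2 : Fintype.card {i // p i = OnePoint.infty} ≤ 1 :=
      Fintype.card_le_one_iff.2 fun ⟨i, hi⟩ ⟨j, hj⟩ => Subtype.ext (hp (hi.trans hj.symm))
    omega
  rw [← sub_eq_zero]
  refine eq_zero_of_dvd_of_natDegree_lt hdvd ?_
  have := natDegree_sub_le f g
  have := max_le hf hg
  omega

/-- The partial fraction decomposition of `f / ∏ (z - pⱼ)`: every `f` of degree at most `s - 2` is the
numerator of a sum of simple fractions whose residues, the one at `∞` included, add up to zero. -/
theorem exists_residues {s : ℕ} (hs : 2 ≤ s) {f : ℂ[X]} (hf : f.natDegree ≤ s - 2)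
    {p : Fin s → RiemannSphere} (hp : Function.Injective p) :
    ∃ r : Fin s → ℂ, ∑ j, r j = 0 ∧ residueNumerator r p = f := by
  classical
  set ρ : Fin s → ℂ := fun j =>
    (p j).elim 0 fun z => f.eval z / (derivative (rootPoly p)).eval z with hρ
  have hev : ∀ (r : Fin s → ℂ), (∀ j, p j ≠ OnePoint.infty → r j = ρ j) →
      ∀ (j : Fin s) (z : ℂ), p j = (z : RiemannSphere) →
        (residueNumerator r p).eval z = f.eval z := by
    intro r hr j z hj
    rw [residueNumerator_eval _ _ hj, hr j (by rw [hj]; exact OnePoint.coe_ne_infty z), hρ]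
    simp only [hj]
    exact div_mul_cancel₀ _ (derivative_rootPoly_eval_ne_zero hs hp hj)
  by_cases hfin : ∀ i, p i ≠ OnePoint.infty
  · -- `f` has degree below `s - 1`, which makes the sum of the residues vanish
    have hroot : rootPoly p ∣ residueNumerator ρ p - f := rootPoly_dvd hp fun j z hj => by
      rw [eval_sub, hev ρ (fun _ _ => rfl) j z hj, sub_self]
    have hdeg : (rootPoly p).natDegree = s := by
      have h1 := rootPoly_natDegree_add p
      have : IsEmpty {i // p i = OnePoint.infty} := ⟨fun i => hfin i.1 i.2⟩
      rwa [Fintype.card_eq_zero, add_zero] at h1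
    have heq : residueNumerator ρ p - f = 0 := by
      refine eq_zero_of_dvd_of_natDegree_lt hroot ?_
      have h1 : (residueNumerator ρ p).natDegree ≤ s - 1 := by
        rw [residueNumerator_eq]
        refine natDegree_sum_le_of_forall_le _ _ fun j _ => ?_
        rw [derivative_linearFactor_of_ne (hfin j), mul_one]
        exact (natDegree_C_mul_le _ _).trans (natDegree_prod_erase_of_finite hfin j).le
      have := natDegree_sub_le (residueNumerator ρ p) f
      have := max_le h1 (hf.trans (by omega : s - 2 ≤ s - 1))
      omega
    rw [sub_eq_zero] at heq
    refine ⟨ρ, ?_, heq⟩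
    rw [← residueNumerator_coeff_of_finite ρ hfin, heq]
    exact coeff_eq_zero_of_natDegree_lt (by omega)
  · push Not at hfin
    obtain ⟨i₀, hi⟩ := hfin
    set r := Function.update ρ i₀ (-∑ j ∈ Finset.univ.erase i₀, ρ j) with hr
    have hsum : ∑ j, r j = 0 := by
      have h1 : ∑ j ∈ Finset.univ.erase i₀, r j = ∑ j ∈ Finset.univ.erase i₀, ρ j :=
        Finset.sum_congr rfl fun j hj => by rw [hr, Function.update_of_ne (Finset.mem_erase.1 hj).1]
      rw [← Finset.add_sum_erase _ _ (Finset.mem_univ i₀), h1, hr, Function.update_self,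
        neg_add_cancel]
    refine ⟨r, hsum, eq_of_eval_eq hs (residueNumerator_natDegree_le hsum hp) hf hp
      (hev r fun j hj => ?_)⟩
    rw [hr, Function.update_of_ne]
    rintro rfl
    exact hj hi

/-- Every vector in the coefficient model is a multiple of one that comes from residues and
poles. -/
theorem exists_rpVec {s : ℕ} (hs : 2 ≤ s) {v : Fin (2 * s - 1 + 1) → ℂ} (hv : coefCondition s v) :
    ∃ (μ : ℂ) (r : residueSpace s) (p : poleSpace s), μ ≠ 0 ∧ v = μ • rpVec r p := by
  obtain ⟨μ, p, hμ, hp⟩ := exists_eq_C_mul_rootPoly (denPoly_natDegree_le hs v)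
    (denPoly_ne_zero hs hv)
  have hcond := (coefCondition_iff hs v).1 hv
  have hinj : Function.Injective p := by
    rw [injective_iff_rootPoly hs]
    have := hcond.2
    rw [hp] at this
    simpa only [coeff_C_mul, eval_mul, eval_C, derivative_C_mul, mul_eq_zero, hμ, false_or]
      using this
  obtain ⟨r, hr, hrp⟩ := exists_residues hs (f := C μ⁻¹ * numPoly s v)
    ((natDegree_C_mul_le _ _).trans (numPoly_natDegree_le hs v)) hinj
  have hnum : numPoly s v = C μ * residueNumerator r p := by
    rw [hrp, ← mul_assoc, ← C_mul, mul_inv_cancel₀ hμ, C_1, one_mul]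
  have hr0 : ∀ i, r i ≠ 0 := by
    intro i hi
    cases hq : p i using OnePoint.rec with
    | infty =>
      refine hcond.1.1 ⟨?_, ?_⟩
      · rw [hp, coeff_C_mul, (rootPoly_coeff_eq_zero_iff p).2 ⟨i, hq⟩, mul_zero]
      · rw [hnum, coeff_C_mul, residueNumerator_coeff_of_infty r hinj hq]
        rw [← Finset.add_sum_erase _ _ (Finset.mem_univ i), hi, zero_add] at hr
        rw [hr, mul_zero]
    | coe z =>
      refine hcond.1.2 z ⟨?_, ?_⟩
      · rw [hp, eval_mul, (rootPoly_eval_eq_zero_iff p z).2 ⟨i, hq⟩, mul_zero]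
      · rw [hnum, eval_mul, residueNumerator_eval r p hq, hi, zero_mul, mul_zero]
  refine ⟨μ, ⟨⟨r, hr⟩, hr0⟩, ⟨p, hinj⟩, hμ, ?_⟩
  rw [← pairVec_coeffVec hs v, hnum, hp, coeffVec_C_mul, coeffVec_C_mul, pairVec_smul, rpVec,
    viete_eq_coeffVec, C_1, one_mul, SymProd.poly_mk]
  rfl

theorem rpVec_smul {s : ℕ} (σ : SymGroup s) (x : residueSpace s × poleSpace s) :
    rpVec (σ • x).1 (σ • x).2 = rpVec x.1 x.2 := by
  have h1 : SymProd.mk (σ • x).2.1 = SymProd.mk x.2.1 :=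
    (SymProd.mk_eq_mk_iff _ _).2 ⟨DomMulAct.mk.symm σ, rfl⟩
  have h2 : residueNumerator (σ • x).1.1.1 (σ • x).2.1 = residueNumerator x.1.1.1 x.2.1 := by
    simp only [residueNumerator_eq]
    refine Fintype.sum_equiv (DomMulAct.mk.symm σ) _ _ fun j => ?_
    congr 1
    refine Finset.prod_bij (fun i _ => DomMulAct.mk.symm σ i) ?_ ?_ ?_ ?_
    · intro i hi
      simpa using hi
    · intro i _ j _ h
      exact (DomMulAct.mk.symm σ).injective h
    · intro i hi
      exact ⟨(DomMulAct.mk.symm σ).symm i, by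
        simp only [Finset.mem_erase, Finset.mem_univ, and_true] at hi ⊢
        rwa [ne_eq, Equiv.symm_apply_eq], by simp⟩
    · intro i _
      rfl
  rw [rpVec, rpVec, h1, h2]

/-- Residues and poles are determined up to simultaneous permutation: the multiple is trivial as the
denominators are monic, the poles are the roots of the denominator, the residues at the finite poles
are values of `Q / P'`, and the residue at `∞` is determined by the sum. -/
theorem exists_smul_eq_of_rpVec {s : ℕ} (hs : 2 ≤ s) {x y : residueSpace s × poleSpace s} {μ : ℂ}
    (h : rpVec x.1 x.2 = μ • rpVec y.1 y.2) : ∃ σ : SymGroup s, σ • y = x := by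
  have hnum : residueNumerator x.1.1.1 x.2.1 = C μ * residueNumerator y.1.1.1 y.2.1 := by
    rw [← numPoly_rpVec hs, h, numPoly_smul hs, numPoly_rpVec hs]
  have hden : rootPoly x.2.1 = C μ * rootPoly y.2.1 := by
    rw [← denPoly_rpVec hs x.1 x.2, h, denPoly_smul hs, denPoly_rpVec hs]
  have hμ : μ = 1 := by
    have := congrArg leadingCoeff hden
    rw [leadingCoeff_mul, leadingCoeff_C, (rootPoly_monic _).leadingCoeff,
      (rootPoly_monic _).leadingCoeff, mul_one] at this
    exact this.symm
  rw [hμ, C_1, one_mul] at hnum hden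
  have hmk : SymProd.mk x.2.1 = SymProd.mk y.2.1 := by
    refine vieteProj_injective s (congrArg (CP.proj s) (Subtype.ext ?_))
    simp only [viete_eq_coeffVec, SymProd.poly_mk, hden]
  obtain ⟨σ, hσ⟩ := (SymProd.mk_eq_mk_iff _ _).1 hmk
  refine ⟨DomMulAct.mk σ, ?_⟩
  have h2 : (DomMulAct.mk σ • y).2 = x.2 := Subtype.ext hσ
  have hnum' : residueNumerator (DomMulAct.mk σ • y).1.1.1 x.2.1 =
      residueNumerator x.1.1.1 x.2.1 := by
    rw [hnum, ← numPoly_rpVec hs y.1 y.2, ← rpVec_smul (DomMulAct.mk σ) y, numPoly_rpVec hs, h2]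
  set r := (DomMulAct.mk σ • y).1 with hr
  have hfin : ∀ j, x.2.1 j ≠ OnePoint.infty → r.1.1 j = x.1.1.1 j := by
    intro j hj
    cases hq : x.2.1 j using OnePoint.rec with
    | infty => exact absurd hq hj
    | coe z =>
      have := congrArg (eval z) hnum'
      rw [residueNumerator_eval _ _ hq, residueNumerator_eval _ _ hq] at this
      exact mul_right_cancel₀ (derivative_rootPoly_eval_ne_zero hs x.2.2 hq) this
  refine Prod.ext (Subtype.ext (Subtype.ext (funext fun j => ?_))) h2
  by_cases hj : x.2.1 j = OnePoint.infty
  · have h4 : ∑ i, r.1.1 i = 0 := r.1.2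
    have h5 : ∑ i, x.1.1.1 i = 0 := x.1.1.2
    rw [← Finset.add_sum_erase _ _ (Finset.mem_univ j)] at h4 h5
    rw [Finset.sum_congr rfl (g := x.1.1.1)] at h4
    · exact add_right_cancel (h4.trans h5.symm)
    · intro i hi
      exact hfin i fun h => (Finset.mem_erase.1 hi).1 (x.2.2 (h.trans hj.symm))
  · exact hfin j hj

/-! ### Bijections that are biholomorphic in charts -/

section Transfer

variable {E H E' H' : Type*} [NormedAddCommGroup E] [NormedSpace ℂ E] [TopologicalSpace H]
  [NormedAddCommGroup E'] [NormedSpace ℂ E'] [TopologicalSpace H']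
  {I : ModelWithCorners ℂ E H} {J : ModelWithCorners ℂ E' H'}
  {M N : Type*} [TopologicalSpace M] [ChartedSpace H M] [TopologicalSpace N] [ChartedSpace H' N]

/-- A bijection `f` from `M` to `N` that is biholomorphic when read in the charts of the given atlas
of `M`. Neither the compatibility of these charts nor the continuity of `f` is presupposed; both
follow. The condition `eventually_mem` says that `f` maps the domains of the charts to open
sets. -/
structure IsChartwiseBiholomorphic (I : ModelWithCorners ℂ E H) (J : ModelWithCorners ℂ E' H')
    (f : M ≃ N) : Prop where
  contMDiffAt : ∀ e ∈ atlas H M, ∀ x ∈ e.target, ContMDiffAt I J ω (f ∘ e.symm) x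
  eventually_mem : ∀ e ∈ atlas H M, ∀ y, f.symm y ∈ e.source → ∀ᶠ y' in 𝓝 y, f.symm y' ∈ e.source
  contMDiffAt_symm : ∀ e ∈ atlas H M, ∀ y, f.symm y ∈ e.source →
    ContMDiffAt J I ω (e ∘ f.symm) y

/-- A change of coordinates from `e` to `e'` is `(e' ∘ f⁻¹) ∘ (f ∘ e⁻¹)`. -/
theorem IsChartwiseBiholomorphic.isManifold {f : M ≃ N} (h : IsChartwiseBiholomorphic I J f) :
    IsManifold I ω M := by
  refine isManifold_of_contDiffOn I ω M fun e e' he he' => ?_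
  rw [← contMDiffOn_iff_contDiffOn]
  refine I.contMDiff.comp_contMDiffOn ?_
  refine ContMDiffOn.comp (t := (e.symm ≫ₕ e').source) ?_
    (I.contMDiffOn_symm.mono Set.inter_subset_right) Set.inter_subset_left
  intro x hx
  rw [OpenPartialHomeomorph.trans_source] at hx
  have h1 : f.symm ((f ∘ e.symm) x) ∈ e'.source := by simpa using hx.2
  have h2 := (h.contMDiffAt_symm e' he' _ h1).comp x (h.contMDiffAt e he x hx.1)
  refine (h2.congr_of_eventuallyEq (Eventually.of_forall fun y => ?_)).contMDiffWithinAt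
  simp

theorem IsChartwiseBiholomorphic.contMDiff {f : M ≃ N} (h : IsChartwiseBiholomorphic I J f) :
    ContMDiff I J ω f := by
  have := h.isManifold
  intro x
  have h1 := (h.contMDiffAt _ (chart_mem_atlas H x) _ (mem_chart_target H x)).comp x
    (contMDiffAt_of_mem_maximalAtlas (IsManifold.chart_mem_maximalAtlas (I := I) (n := ω) x)
      (mem_chart_source H x))
  refine h1.congr_of_eventuallyEq ?_
  filter_upwards [chart_source_mem_nhds H x] with y hy
  simp [(chartAt H x).left_inv hy]

theorem IsChartwiseBiholomorphic.contMDiff_symm {f : M ≃ N}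
    (h : IsChartwiseBiholomorphic I J f) : ContMDiff J I ω f.symm := by
  have := h.isManifold
  intro y
  set x := f.symm y with hx
  have h0 : f.symm y ∈ (chartAt H x).source := mem_chart_source H x
  have h1 := (contMDiffAt_symm_of_mem_maximalAtlas
    (IsManifold.chart_mem_maximalAtlas (I := I) (n := ω) x)
    ((chartAt H x).map_source h0)).comp y
      (h.contMDiffAt_symm _ (chart_mem_atlas H x) _ h0)
  refine h1.congr_of_eventuallyEq ?_
  filter_upwards [h.eventually_mem _ (chart_mem_atlas H x) y h0] with z hz
  simp [(chartAt H x).left_inv hz]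

/-- A chartwise biholomorphic bijection as an analytic diffeomorphism. -/
def IsChartwiseBiholomorphic.diffeomorph {f : M ≃ N} (h : IsChartwiseBiholomorphic I J f) :
    M ≃ₘ^ω⟮I, J⟯ N where
  toEquiv := f
  contMDiff_toFun := h.contMDiff
  contMDiff_invFun := h.contMDiff_symm

theorem IsChartwiseBiholomorphic.isComplexManifold {f : M ≃ N}
    (h : IsChartwiseBiholomorphic I J f) [T2Space N] [SecondCountableTopology N] :
    IsComplexManifold I M where
  t2 := h.diffeomorph.toHomeomorph.isEmbedding.t2Space
  secondCountable := h.diffeomorph.toHomeomorph.isEmbedding.secondCountableTopology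
  isManifold := h.isManifold

theorem contMDiffAt_of_val_comp {U : TopologicalSpace.Opens N} {f : M → U} {x : M}
    (h : ContMDiffAt I J ω (fun y => (f y : N)) x) : ContMDiffAt I J ω f x :=
  (ChartedSpace.liftPropWithinAt_subtypeVal_comp_iff f Set.univ x).1 h

theorem contMDiffAt_units {f : M → ℂˣ} {x : M}
    (h : ContMDiffAt I 𝓘(ℂ, ℂ) ω (fun y => (f y : ℂ)) x) : ContMDiffAt I 𝓘(ℂ, ℂ) ω f x := by
  have h1 := contMDiffOn_isOpenEmbedding_symm (I := 𝓘(ℂ, ℂ)) (n := ω)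
    (Units.isOpenEmbedding_val (R := ℂ))
  have h2 := (h1.contMDiffAt ((Units.isOpenEmbedding_val (R := ℂ)).isOpen_range.mem_nhds
    ⟨f x, rfl⟩)).comp x h
  refine h2.congr_of_eventuallyEq (Eventually.of_forall fun y => ?_)
  exact ((Units.isOpenEmbedding_val (R := ℂ)).toOpenPartialHomeomorph_left_inv).symm

end Transfer

/-! ### Projective space -/

theorem CP.mem_affineChart_source {n : ℕ} (i : Fin (n + 1)) (v : {v : Fin (n + 1) → ℂ // v ≠ 0}) :
    CP.proj n v ∈ (CP.affineChart n i).source ↔ v.1 i ≠ 0 := by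
  constructor
  · rintro ⟨w, hw, h⟩ h0
    obtain ⟨a, ha⟩ := (CP.proj_eq_iff _ _).1 h
    apply hw
    rw [← ha]
    simp [h0]
  · exact fun h => ⟨v, h, rfl⟩

theorem contDiff_insertNth_one {n : ℕ} (i : Fin (n + 1)) :
    ContDiff ℂ ω fun w : Fin n → ℂ => (i.insertNth (1 : ℂ) w : Fin (n + 1) → ℂ) := by
  refine contDiff_pi.2 fun k => ?_
  refine Fin.succAboveCases i ?_ (fun j => ?_) k
  · simpa using contDiff_const
  · simpa using contDiff_apply ℂ ℂ j

instance (n : ℕ) : IsManifold 𝓘(ℂ, Fin n → ℂ) ω (CP n) := by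
  refine isManifold_of_contDiffOn _ ω _ ?_
  rintro _ _ ⟨i, rfl⟩ ⟨j, rfl⟩
  intro w hw
  have hw1 : (i.insertNth (1 : ℂ) w : Fin (n + 1) → ℂ) j ≠ 0 :=
    (CP.mem_affineChart_source j _).1 hw.1.2
  have h : ContDiffAt ℂ ω (fun w : Fin n → ℂ => fun k : Fin n =>
      (i.insertNth (1 : ℂ) w : Fin (n + 1) → ℂ) (j.succAbove k) /
        (i.insertNth (1 : ℂ) w : Fin (n + 1) → ℂ) j) w := by
    have h0 := contDiff_pi.1 (contDiff_insertNth_one i)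
    exact contDiffAt_pi.2 fun k => (h0 _).contDiffAt.div (h0 _).contDiffAt hw1
  exact h.contDiffWithinAt

instance (n : ℕ) : SecondCountableTopology (CP n) :=
  (CP.isOpenQuotientMap_proj n).isQuotientMap.secondCountableTopology
    (CP.isOpenQuotientMap_proj n).isOpenMap

section

variable {E H : Type*} [NormedAddCommGroup E] [NormedSpace ℂ E] [TopologicalSpace H]
  {I : ModelWithCorners ℂ E H} {M : Type*} [TopologicalSpace M] [ChartedSpace H M]

theorem contMDiffAt_div {f g : M → ℂ} {x : M} (hf : ContMDiffAt I 𝓘(ℂ, ℂ) ω f x)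
    (hg : ContMDiffAt I 𝓘(ℂ, ℂ) ω g x) (h0 : g x ≠ 0) :
    ContMDiffAt I 𝓘(ℂ, ℂ) ω (fun y => f y / g y) x := by
  have h : ContDiffAt ℂ ω (fun q : ℂ × ℂ => q.1 / q.2) (f x, g x) :=
    contDiffAt_fst.div contDiffAt_snd h0
  exact h.contMDiffAt.comp x (hf.prodMk_space hg)

/-- A map to projective space is holomorphic as soon as it has holomorphic homogeneous
coordinates. -/
theorem contMDiffAt_of_homogeneous {n : ℕ} {f : M → CP n} {g : M → Fin (n + 1) → ℂ} {x : M}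
    (hg : ContMDiffAt I 𝓘(ℂ, Fin (n + 1) → ℂ) ω g x) (h0 : g x ≠ 0)
    (hfg : ∀ᶠ y in 𝓝 x, ∀ h : g y ≠ 0, f y = CP.proj n ⟨g y, h⟩) :
    ContMDiffAt I 𝓘(ℂ, Fin n → ℂ) ω f x := by
  obtain ⟨i, hi⟩ := Function.ne_iff.1 h0
  have hgi : ∀ k, ContMDiffAt I 𝓘(ℂ, ℂ) ω (fun y => g y k) x := contMDiffAt_pi_space.1 hg
  have h1 : ContMDiffAt I 𝓘(ℂ, Fin n → ℂ) ω (fun y => fun j => g y (i.succAbove j) / g y i) x :=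
    contMDiffAt_pi_space.2 fun j => contMDiffAt_div (hgi _) (hgi _) hi
  have h2 : ContMDiffAt 𝓘(ℂ, Fin n → ℂ) 𝓘(ℂ, Fin n → ℂ) ω (CP.affineChart n i).symm
      (fun j => g x (i.succAbove j) / g x i) :=
    contMDiffAt_symm_of_mem_maximalAtlas
      (IsManifold.subset_maximalAtlas (Set.mem_range_self i)) (Set.mem_univ _)
  refine (h2.comp x h1).congr_of_eventuallyEq ?_
  filter_upwards [hfg, (hgi i).continuousAt.eventually_ne hi] with y hy hyi
  have hne : g y ≠ 0 := fun h => hyi (by rw [h])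
  rw [hy hne, Function.comp_apply]
  exact ((CP.affineChart n i).left_inv ((CP.mem_affineChart_source i ⟨g y, hne⟩).2 hyi)).symm

end

/-- Near every point of projective space the homogeneous coordinates can be chosen
holomorphically. -/
theorem CP.exists_section {n : ℕ} (x : CP n) :
    ∃ σ : CP n → {v : Fin (n + 1) → ℂ // v ≠ 0},
      ContMDiffAt 𝓘(ℂ, Fin n → ℂ) 𝓘(ℂ, Fin (n + 1) → ℂ) ω (fun y => (σ y).1) x ∧
      ∀ᶠ y in 𝓝 x, CP.proj n (σ y) = y := by
  obtain ⟨i, hi⟩ := CP.exists_mem_affineChart x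
  refine ⟨fun y => ⟨i.insertNth 1 (CP.affineChart n i y), fun h => by simpa using congrFun h i⟩,
    ?_, ?_⟩
  · exact (contDiff_insertNth_one i).contMDiff.contMDiffAt.comp x
      (contMDiffAt_of_mem_maximalAtlas (IsManifold.subset_maximalAtlas (Set.mem_range_self i)) hi)
  · filter_upwards [(CP.affineChart n i).open_source.mem_nhds hi] with y hy
    exact (CP.affineChart n i).left_inv hy

/-! ### Symmetric products -/

theorem isChartwiseBiholomorphic_vieteHomeo (n : ℕ) :
    IsChartwiseBiholomorphic 𝓘(ℂ, Fin n → ℂ) 𝓘(ℂ, Fin n → ℂ) (vieteHomeo n).toEquiv where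
  contMDiffAt := by
    rintro _ ⟨c, hc, rfl⟩ x hx
    have hx' : x ∈ c.target := by simpa using hx
    have := contMDiffAt_symm_of_mem_maximalAtlas (I := 𝓘(ℂ, Fin n → ℂ)) (n := ω)
      (IsManifold.subset_maximalAtlas hc) hx'
    refine this.congr_of_eventuallyEq (Eventually.of_forall fun y => ?_)
    simp
  eventually_mem := by
    rintro _ ⟨c, hc, rfl⟩ y hy
    exact (vieteHomeo n).symm.continuous.continuousAt.eventually
      ((OpenPartialHomeomorph.open_source _).mem_nhds hy)
  contMDiffAt_symm := by
    rintro _ ⟨c, hc, rfl⟩ y hy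
    have hy' : y ∈ c.source := by simpa using hy
    have := contMDiffAt_of_mem_maximalAtlas (I := 𝓘(ℂ, Fin n → ℂ)) (n := ω)
      (IsManifold.subset_maximalAtlas hc) hy'
    refine this.congr_of_eventuallyEq (Eventually.of_forall fun z => ?_)
    simp

instance (n : ℕ) : IsManifold 𝓘(ℂ, Fin n → ℂ) ω (SymProd n) :=
  (isChartwiseBiholomorphic_vieteHomeo n).isManifold

theorem contMDiff_vieteHomeo (n : ℕ) :
    ContMDiff 𝓘(ℂ, Fin n → ℂ) 𝓘(ℂ, Fin n → ℂ) ω (vieteHomeo n) :=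
  (isChartwiseBiholomorphic_vieteHomeo n).contMDiff

theorem contMDiff_vieteHomeo_symm (n : ℕ) :
    ContMDiff 𝓘(ℂ, Fin n → ℂ) 𝓘(ℂ, Fin n → ℂ) ω (vieteHomeo n).symm :=
  (isChartwiseBiholomorphic_vieteHomeo n).contMDiff_symm

/-! ### The Riemann sphere -/

theorem sphereChartFinite_coe (z : ℂ) : sphereChartFinite (z : RiemannSphere) = z :=
  (OnePoint.isOpenEmbedding_coe (X := ℂ)).toOpenPartialHomeomorph_left_inv

theorem sphereChartFinite_symm (z : ℂ) : sphereChartFinite.symm z = (z : RiemannSphere) := rfl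

theorem mem_sphereChartFinite_source {p : RiemannSphere} :
    p ∈ sphereChartFinite.source ↔ p ≠ OnePoint.infty := by
  simp [sphereChartFinite, OnePoint.ne_infty_iff_exists]

theorem sphereChartInfinity_apply (p : RiemannSphere) :
    sphereChartInfinity p = sphereChartFinite (sphereInv p) := rfl

theorem sphereChartInfinity_symm (z : ℂ) :
    sphereChartInfinity.symm z = sphereInv (z : RiemannSphere) := rfl

theorem mem_sphereChartInfinity_source {p : RiemannSphere} :
    p ∈ sphereChartInfinity.source ↔ sphereInv p ≠ OnePoint.infty := by
  rw [← mem_sphereChartFinite_source]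
  simp [sphereChartInfinity, sphereInvHomeo]

theorem sphereInv_coe_ne_infty_iff {z : ℂ} :
    sphereInv (z : RiemannSphere) ≠ OnePoint.infty ↔ z ≠ 0 := by
  rcases eq_or_ne z 0 with rfl | hz
  · simp
  · simp [sphereInv_coe hz, hz]

instance : IsManifold 𝓘(ℂ, ℂ) ω RiemannSphere := by
  refine isManifold_of_contDiffOn _ ω _ ?_
  have hinv : ∀ {f : ℂ → ℂ} {z : ℂ}, z ≠ 0 → (∀ z, z ≠ 0 → f z = z⁻¹) → ContDiffAt ℂ ω f z := by
    intro f z hz hf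
    refine (contDiffAt_inv ℂ hz).congr_of_eventuallyEq ?_
    filter_upwards [isOpen_ne.mem_nhds hz] with w hw using hf w hw
  rintro e e' he he' z hz
  simp only [mfld_simps, Set.mem_inter_iff, Set.mem_preimage] at hz ⊢
  rcases he with rfl | rfl <;> rcases he' with rfl | rfl
  · refine contDiff_id.contDiffAt.contDiffWithinAt.congr (fun w hw => ?_) ?_ <;>
    simp [sphereChartFinite_symm, sphereChartFinite_coe]
  · refine (hinv (sphereInv_coe_ne_infty_iff.1 (mem_sphereChartInfinity_source.1 hz.2))
      fun w hw => ?_).contDiffWithinAt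
    simp [sphereChartFinite_symm, sphereChartInfinity_apply, sphereInv_coe hw,
      sphereChartFinite_coe]
  · refine (hinv (sphereInv_coe_ne_infty_iff.1 (mem_sphereChartFinite_source.1 hz.2))
      fun w hw => ?_).contDiffWithinAt
    simp [sphereChartInfinity_symm, sphereInv_coe hw, sphereChartFinite_coe]
  · refine contDiff_id.contDiffAt.contDiffWithinAt.congr (fun w hw => ?_) ?_ <;>
    simp [sphereChartInfinity_symm, sphereChartInfinity_apply, sphereInv_sphereInv,
      sphereChartFinite_coe]

theorem contMDiff_sphere_coe :
    ContMDiff 𝓘(ℂ, ℂ) 𝓘(ℂ, ℂ) ω fun z : ℂ => (z : RiemannSphere) := fun z =>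
  contMDiffAt_symm_of_mem_maximalAtlas (e := sphereChartFinite)
    (IsManifold.subset_maximalAtlas (Or.inl rfl)) (by simp [sphereChartFinite])

theorem contMDiff_sphereInv_coe :
    ContMDiff 𝓘(ℂ, ℂ) 𝓘(ℂ, ℂ) ω fun z : ℂ => sphereInv (z : RiemannSphere) := fun z =>
  contMDiffAt_symm_of_mem_maximalAtlas (e := sphereChartInfinity)
    (IsManifold.subset_maximalAtlas (Or.inr rfl))
    (by simp [sphereChartInfinity, sphereChartFinite, sphereInvHomeo])

/-- Near every point of the sphere the linear factor has a multiple whose coefficients are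
holomorphic. -/
theorem exists_holomorphic_factor (p₀ : RiemannSphere) :
    ∃ L : RiemannSphere → ℂ[X],
      (∀ k, ContMDiffAt 𝓘(ℂ, ℂ) 𝓘(ℂ, ℂ) ω (fun p => (L p).coeff k) p₀) ∧
      ∀ᶠ p in 𝓝 p₀, ∃ a : ℂˣ, L p = C (a : ℂ) * linearFactor p := by
  by_cases hp : p₀ = OnePoint.infty
  · have hp' : p₀ ∈ sphereChartInfinity.source := by
      rw [mem_sphereChartInfinity_source, hp]
      simp
    have hc := contMDiffAt_of_mem_maximalAtlas (I := 𝓘(ℂ, ℂ)) (n := ω) (e := sphereChartInfinity)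
      (IsManifold.subset_maximalAtlas (Or.inr rfl)) hp'
    refine ⟨fun p => coverFactor (Sum.inr (sphereChartInfinity p)), fun k => ?_, ?_⟩
    · have h : ContDiff ℂ ω fun w : ℂ => (coverFactor (Sum.inr w)).coeff k := by
        simp only [coverFactor, Sum.elim_inr, coeff_sub, coeff_C_mul]
        fun_prop
      exact h.contMDiff.contMDiffAt.comp p₀ hc
    · filter_upwards [sphereChartInfinity.open_source.mem_nhds hp'] with p hps
      obtain ⟨a, ha⟩ := coverFactor_eq (Sum.inr (sphereChartInfinity p))
      refine ⟨a, ?_⟩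
      rw [← ha]
      congr 2
      exact sphereChartInfinity.left_inv hps
  · have hp' : p₀ ∈ sphereChartFinite.source := mem_sphereChartFinite_source.2 hp
    have hc := contMDiffAt_of_mem_maximalAtlas (I := 𝓘(ℂ, ℂ)) (n := ω) (e := sphereChartFinite)
      (IsManifold.subset_maximalAtlas (Or.inl rfl)) hp'
    refine ⟨fun p => coverFactor (Sum.inl (sphereChartFinite p)), fun k => ?_, ?_⟩
    · have h : ContDiff ℂ ω fun w : ℂ => (coverFactor (Sum.inl w)).coeff k := by
        simp only [coverFactor, Sum.elim_inl, coeff_sub, coeff_C]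
        split_ifs <;> fun_prop
      exact h.contMDiff.contMDiffAt.comp p₀ hc
    · filter_upwards [sphereChartFinite.open_source.mem_nhds hp'] with p hps
      obtain ⟨a, ha⟩ := coverFactor_eq (Sum.inl (sphereChartFinite p))
      refine ⟨a, ?_⟩
      rw [← ha]
      congr 2
      exact sphereChartFinite.left_inv hps

/-! ### Tuples of points of the sphere -/

instance (n : ℕ) : IsManifold 𝓘(ℂ, Fin n → ℂ) ω (Fin n → RiemannSphere) := by
  refine isManifold_of_contDiffOn _ ω _ ?_
  rintro _ _ ⟨e, he, rfl⟩ ⟨e', he', rfl⟩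
  intro z hz
  refine contDiffWithinAt_pi.2 fun i => ?_
  have h1 : z i ∈ ((e i).symm ≫ₕ e' i).source := by
    have := hz.1
    simp only [mfld_simps, Set.mem_preimage] at this ⊢
    exact ⟨this.1 i trivial, this.2 i trivial⟩
  have h2 : ContDiffAt ℂ ω ((e i).symm ≫ₕ e' i) (z i) :=
    (contMDiffAt_iff_contDiffAt.1 <| (contMDiffOn_of_mem_contDiffGroupoid (I := 𝓘(ℂ, ℂ)) (n := ω)
      (HasGroupoid.compatible (he i trivial) (he' i trivial))).contMDiffAt
        (((e i).symm ≫ₕ e' i).open_source.mem_nhds h1))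
  exact (h2.comp z (contDiff_apply ℂ ℂ i).contDiffAt).contDiffWithinAt

section

variable {E H : Type*} [NormedAddCommGroup E] [NormedSpace ℂ E] [TopologicalSpace H]
  {I : ModelWithCorners ℂ E H} {M : Type*} [TopologicalSpace M] [ChartedSpace H M]

theorem contMDiff_sphere_apply {n : ℕ} (i : Fin n) :
    ContMDiff 𝓘(ℂ, Fin n → ℂ) 𝓘(ℂ, ℂ) ω fun p : Fin n → RiemannSphere => p i := by
  intro p
  have h1 := contMDiffAt_symm_of_mem_maximalAtlas (I := 𝓘(ℂ, ℂ)) (n := ω)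
    (IsManifold.chart_mem_maximalAtlas (p i)) (mem_chart_target ℂ (p i))
  have h2 := contMDiffAt_of_mem_maximalAtlas (I := 𝓘(ℂ, Fin n → ℂ)) (n := ω)
    (IsManifold.chart_mem_maximalAtlas p) (mem_chart_source (Fin n → ℂ) p)
  have h3 : ContMDiffAt 𝓘(ℂ, Fin n → ℂ) 𝓘(ℂ, ℂ) ω (fun z : Fin n → ℂ => z i)
    (chartAt (Fin n → ℂ) p p) := (contDiff_apply ℂ ℂ i).contMDiff.contMDiffAt
  refine (ContMDiffAt.comp p (h1.comp_of_eq h3 rfl) h2).congr_of_eventuallyEq ?_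
  filter_upwards [chart_source_mem_nhds (Fin n → ℂ) p] with q hq
  exact ((chartAt ℂ (p i)).left_inv (hq i trivial)).symm

theorem contMDiffAt_sphere_pi {n : ℕ} {f : M → Fin n → RiemannSphere} {x : M}
    (h : ∀ i, ContMDiffAt I 𝓘(ℂ, ℂ) ω (fun y => f y i) x) :
    ContMDiffAt I 𝓘(ℂ, Fin n → ℂ) ω f x := by
  have h1 := contMDiffAt_symm_of_mem_maximalAtlas (I := 𝓘(ℂ, Fin n → ℂ)) (n := ω)
    (IsManifold.chart_mem_maximalAtlas (f x)) (mem_chart_target (Fin n → ℂ) (f x))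
  have h2 : ContMDiffAt I 𝓘(ℂ, Fin n → ℂ) ω (fun y => fun i => chartAt ℂ (f x i) (f y i)) x :=
    contMDiffAt_pi_space.2 fun i => (contMDiffAt_of_mem_maximalAtlas (I := 𝓘(ℂ, ℂ)) (n := ω)
      (IsManifold.chart_mem_maximalAtlas (f x i)) (mem_chart_source ℂ (f x i))).comp x (h i)
  refine (h1.comp_of_eq h2 rfl).congr_of_eventuallyEq ?_
  have hc : ContinuousAt f x := continuousAt_pi.2 fun i => (h i).continuousAt
  filter_upwards [hc.eventually (chart_source_mem_nhds (Fin n → ℂ) (f x))] with y hy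
  exact ((chartAt (Fin n → ℂ) (f x)).left_inv hy).symm

end

/-! ### Polynomials with holomorphic coefficients -/

section

variable {E H : Type*} [NormedAddCommGroup E] [NormedSpace ℂ E] [TopologicalSpace H]
  {I : ModelWithCorners ℂ E H} {M : Type*} [TopologicalSpace M] [ChartedSpace H M]

/-- The coefficients of a family of polynomials are holomorphic at `x`. -/
def HolomorphicCoeffAt (I : ModelWithCorners ℂ E H) (f : M → ℂ[X]) (x : M) : Prop :=
  ∀ k, ContMDiffAt I 𝓘(ℂ, ℂ) ω (fun y => (f y).coeff k) x

theorem HolomorphicCoeffAt.sum {ι : Type*} {S : Finset ι} {f : ι → M → ℂ[X]} {x : M}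
    (hf : ∀ i ∈ S, HolomorphicCoeffAt I (f i) x) :
    HolomorphicCoeffAt I (fun y => ∑ i ∈ S, f i y) x := by
  intro k
  simp only [finsetSum_coeff]
  exact ContMDiffAt.sum fun i hi => hf i hi k

theorem HolomorphicCoeffAt.mul {f g : M → ℂ[X]} {x : M} (hf : HolomorphicCoeffAt I f x)
    (hg : HolomorphicCoeffAt I g x) : HolomorphicCoeffAt I (fun y => f y * g y) x := by
  intro k
  simp only [coeff_mul]
  exact ContMDiffAt.sum fun i _ => (hf _).mul (hg _)

theorem HolomorphicCoeffAt.C {f : M → ℂ} {x : M} (hf : ContMDiffAt I 𝓘(ℂ, ℂ) ω f x) :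
    HolomorphicCoeffAt I (fun y => C (f y)) x := by
  intro k
  simp only [coeff_C]
  split_ifs
  · exact hf
  · exact contMDiffAt_const

theorem HolomorphicCoeffAt.prod {ι : Type*} {S : Finset ι} {f : ι → M → ℂ[X]} {x : M}
    (hf : ∀ i, HolomorphicCoeffAt I (f i) x) :
    HolomorphicCoeffAt I (fun y => ∏ i ∈ S, f i y) x := by
  classical
  induction S using Finset.induction_on with
  | empty =>
    intro k
    simp only [Finset.prod_empty]
    exact contMDiffAt_const
  | insert a S ha ih =>
    simp only [Finset.prod_insert ha]
    exact (hf a).mul ih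

theorem HolomorphicCoeffAt.derivative {f : M → ℂ[X]} {x : M} (hf : HolomorphicCoeffAt I f x) :
    HolomorphicCoeffAt I (fun y => derivative (f y)) x := by
  intro k
  simp only [coeff_derivative]
  exact (hf _).mul contMDiffAt_const

theorem HolomorphicCoeffAt.eval {f : M → ℂ[X]} {x : M} {n : ℕ} (hf : HolomorphicCoeffAt I f x)
    (hn : ∀ y, (f y).natDegree ≤ n) {g : M → ℂ} (hg : ContMDiffAt I 𝓘(ℂ, ℂ) ω g x) :
    ContMDiffAt I 𝓘(ℂ, ℂ) ω (fun y => (f y).eval (g y)) x := by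
  have h : ∀ y, (f y).eval (g y) = ∑ k ∈ Finset.range (n + 1), (f y).coeff k * g y ^ k :=
    fun y => eval_eq_sum_range' (Nat.lt_succ_of_le (hn y)) _
  simp only [h]
  exact ContMDiffAt.sum fun k _ => (hf k).mul (hg.pow k)

theorem HolomorphicCoeffAt.coeffVec {f : M → ℂ[X]} {x : M} (hf : HolomorphicCoeffAt I f x)
    (n : ℕ) : ContMDiffAt I 𝓘(ℂ, Fin (n + 1) → ℂ) ω (fun y => coeffVec n (f y)) x :=
  contMDiffAt_pi_space.2 fun _ => hf _

theorem contMDiffAt_pairVec {s : ℕ} {a : M → Fin (s - 2 + 1) → ℂ} {b : M → Fin (s + 1) → ℂ} {x : M}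
    (ha : ContMDiffAt I 𝓘(ℂ, Fin (s - 2 + 1) → ℂ) ω a x)
    (hb : ContMDiffAt I 𝓘(ℂ, Fin (s + 1) → ℂ) ω b x) :
    ContMDiffAt I 𝓘(ℂ, Fin (2 * s - 1 + 1) → ℂ) ω (fun y => pairVec s (a y) (b y)) x := by
  refine contMDiffAt_pi_space.2 fun i => ?_
  simp only [pairVec]
  split_ifs
  · exact contMDiffAt_pi_space.1 ha _
  · exact contMDiffAt_pi_space.1 hb _

theorem HolomorphicCoeffAt.numPoly {s : ℕ} (hs : 2 ≤ s) {v : M → Fin (2 * s - 1 + 1) → ℂ} {x : M}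
    (hv : ContMDiffAt I 𝓘(ℂ, Fin (2 * s - 1 + 1) → ℂ) ω v x) :
    HolomorphicCoeffAt I (fun y => numPoly s (v y)) x := by
  intro k
  simp only [numPoly_coeff hs]
  split_ifs
  · exact contMDiffAt_pi_space.1 hv _
  · exact contMDiffAt_const

theorem HolomorphicCoeffAt.denPoly {s : ℕ} (hs : 2 ≤ s) {v : M → Fin (2 * s - 1 + 1) → ℂ} {x : M}
    (hv : ContMDiffAt I 𝓘(ℂ, Fin (2 * s - 1 + 1) → ℂ) ω v x) :
    HolomorphicCoeffAt I (fun y => denPoly s (v y)) x := by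
  intro k
  simp only [denPoly_coeff hs]
  split_ifs
  · exact contMDiffAt_pi_space.1 hv _
  · exact contMDiffAt_const

end

/-- The polynomial `v₀ zⁿ + … + vₙ`. -/
def vecPoly (n : ℕ) (v : Fin (n + 1) → ℂ) : ℂ[X] := ∑ i : Fin (n + 1), C (v i) * X ^ (n - (i : ℕ))

theorem vecPoly_natDegree_le (n : ℕ) (v : Fin (n + 1) → ℂ) : (vecPoly n v).natDegree ≤ n :=
  natDegree_sum_le_of_forall_le _ _ fun _ _ => (natDegree_C_mul_X_pow_le _ _).trans (Nat.sub_le _ _)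

theorem coeffVec_vecPoly (n : ℕ) (v : Fin (n + 1) → ℂ) : coeffVec n (vecPoly n v) = v := by
  ext k
  rw [coeffVec, vecPoly, finsetSum_coeff, Finset.sum_eq_single k]
  · simp
  · intro j _ hj
    rw [coeff_C_mul_X_pow, if_neg]
    intro h
    exact hj (Fin.ext (by omega))
  · simp

/-- Near every unordered tuple the polynomial of the tuple has a multiple whose coefficients are
holomorphic. -/
theorem SymProd.exists_holomorphic_poly {n : ℕ} (u₀ : SymProd n) :
    ∃ A : SymProd n → ℂ[X], HolomorphicCoeffAt 𝓘(ℂ, Fin n → ℂ) A u₀ ∧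
      (∀ u, (A u).natDegree ≤ n) ∧ ∀ᶠ u in 𝓝 u₀, ∃ κ : ℂ, κ ≠ 0 ∧ A u = C κ * u.poly := by
  obtain ⟨σ, h1, h2⟩ := CP.exists_section (vieteHomeo n u₀)
  refine ⟨fun u => vecPoly n (σ (vieteHomeo n u)).1, ?_, fun u => vecPoly_natDegree_le _ _, ?_⟩
  · have h3 : ContMDiffAt 𝓘(ℂ, Fin n → ℂ) 𝓘(ℂ, Fin (n + 1) → ℂ) ω
        (fun u => (σ (vieteHomeo n u)).1) u₀ := h1.comp u₀ (contMDiff_vieteHomeo n).contMDiffAt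
    refine HolomorphicCoeffAt.sum fun i _ => HolomorphicCoeffAt.mul
      (HolomorphicCoeffAt.C (contMDiffAt_pi_space.1 h3 i)) fun k => contMDiffAt_const
  · filter_upwards [(vieteHomeo n).continuous.continuousAt.eventually h2] with u hu
    obtain ⟨a, ha⟩ := (CP.proj_eq_iff _ _).1 hu
    obtain ⟨p, rfl⟩ := (SymProd.isOpenQuotientMap_mk n).surjective u
    refine ⟨a, a.ne_zero, poly_ext_of_natDegree_le (vecPoly_natDegree_le _ _)
      ((natDegree_C_mul_le _ _).trans (rootPoly_natDegree_le p)) fun k => ?_⟩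
    change coeffVec n (vecPoly n _) k = _
    rw [coeffVec_vecPoly, ← ha]
    simp [viete, Units.smul_def]

/-! ### Points of the coefficient model -/

/-- The point `[v]` of the coefficient model. -/
def coefPoint {s : ℕ} (v : Fin (2 * s - 1 + 1) → ℂ) (h0 : v ≠ 0) (hv : coefCondition s v) :
    OmegaCoef s :=
  ⟨CP.proj _ ⟨v, h0⟩, ⟨v, h0⟩, hv, rfl⟩

theorem ne_zero_of_coefCondition {s : ℕ} (hs : 2 ≤ s) {v : Fin (2 * s - 1 + 1) → ℂ}
    (hv : coefCondition s v) : v ≠ 0 := by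
  rintro rfl
  refine denPoly_ne_zero hs hv ?_
  ext k
  simp [denPoly_coeff hs]

/-- Near every point of the coefficient model the homogeneous coordinates can be chosen
holomorphically. -/
theorem exists_coef_section {s : ℕ} (y₀ : OmegaCoef s) :
    ∃ σ : OmegaCoef s → {v : Fin (2 * s - 1 + 1) → ℂ // v ≠ 0},
      ContMDiffAt (modelCoef s) 𝓘(ℂ, Fin (2 * s - 1 + 1) → ℂ) ω (fun y => (σ y).1) y₀ ∧
      ∀ᶠ y in 𝓝 y₀, CP.proj _ (σ y) = y.1 := by
  obtain ⟨σ, h1, h2⟩ := CP.exists_section y₀.1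
  exact ⟨fun y => σ y.1, h1.comp y₀ contMDiff_subtype_val.contMDiffAt,
    continuous_subtype_val.continuousAt.eventually h2⟩

/-! ### The map from the zeros–poles model -/

/-- The factor `l P_u(α) / Q_u(α)` in the homogeneous coordinates of the image of `[u, l]_α`. -/
def zpScalar {s : ℕ} (α : BundleIndex s) (u : zerosPoles s) (l : ℂˣ) : ℂ :=
  l * ((polePoly u).eval α.pt / (zeroPoly u).eval α.pt)

theorem zpVec_eq {s : ℕ} (α : BundleIndex s) (u : zerosPoles s) (l : ℂˣ) :
    zpVec α u l = pairVec s (coeffVec (s - 2) (C (zpScalar α u l) * zeroPoly u))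
      (coeffVec s (polePoly u)) := by
  rw [zpVec, viete_eq_coeffVec, viete_eq_coeffVec, C_1, one_mul, one_mul, coeffVec_C_mul]
  rfl

theorem SymProd.poly_natDegree_le {n : ℕ} (u : SymProd n) : u.poly.natDegree ≤ n := by
  obtain ⟨p, rfl⟩ := (SymProd.isOpenQuotientMap_mk n).surjective u
  exact rootPoly_natDegree_le p

theorem SymProd.poly_monic {n : ℕ} (u : SymProd n) : u.poly.Monic := by
  obtain ⟨p, rfl⟩ := (SymProd.isOpenQuotientMap_mk n).surjective u
  exact rootPoly_monic p

theorem numPoly_zpVec {s : ℕ} (hs : 2 ≤ s) (α : BundleIndex s) (u : zerosPoles s) (l : ℂˣ) :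
    numPoly s (zpVec α u l) = C (zpScalar α u l) * zeroPoly u := by
  rw [zpVec_eq]
  exact numPoly_pairVec hs ((natDegree_C_mul_le _ _).trans u.1.1.poly_natDegree_le) _

theorem denPoly_zpVec {s : ℕ} (hs : 2 ≤ s) (α : BundleIndex s) (u : zerosPoles s) (l : ℂˣ) :
    denPoly s (zpVec α u l) = polePoly u := by
  rw [zpVec_eq]
  exact denPoly_pairVec hs u.1.2.poly_natDegree_le _

theorem zpScalar_ne_zero {s : ℕ} {α : BundleIndex s} {u : zerosPoles s} (hu : u ∈ trivSet α)
    (l : ℂˣ) : zpScalar α u l ≠ 0 :=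
  mul_ne_zero l.ne_zero (div_ne_zero hu.2 hu.1)

theorem coefCondition_zpVec {s : ℕ} (hs : 2 ≤ s) {α : BundleIndex s} {u : zerosPoles s}
    (hu : u ∈ trivSet α) (l : ℂˣ) : coefCondition s (zpVec α u l) := by
  obtain ⟨⟨c, p⟩, hcp, hx⟩ := u.2
  have hz : zeroPoly u = rootPoly c := by rw [zeroPoly, ← hx]; rfl
  have hp : polePoly u = rootPoly p := by rw [polePoly, ← hx]; rfl
  refine (coefCondition_iff_of_factorization hs (zpScalar_ne_zero hu l) one_ne_zero
    (c := c) (p := p) ?_ ?_).2 hcp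
  · rw [numPoly_zpVec hs, hz]
  · rw [denPoly_zpVec hs, hp, C_1, one_mul]

theorem zpVec_ne_zero {s : ℕ} (hs : 2 ≤ s) {α : BundleIndex s} {u : zerosPoles s}
    (hu : u ∈ trivSet α) (l : ℂˣ) :
    zpVec α u l ≠ 0 := ne_zero_of_coefCondition hs (coefCondition_zpVec hs hu l)

theorem vieteProj_eq_of_poly {n : ℕ} {u : SymProd n} {f : ℂ[X]} {c : ℂ} (hc : c ≠ 0)
    (hf : f = C c * u.poly) (h0 : coeffVec n f ≠ 0) : CP.proj n ⟨_, h0⟩ = vieteProj n u := by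
  refine (CP.proj_eq_iff _ _).2 ⟨Units.mk0 c hc, ?_⟩
  simp only [viete_eq_coeffVec, C_1, one_mul, hf, coeffVec_C_mul]
  rfl

section

variable {s : ℕ} {hs : 2 ≤ s}

/-- The base point `u` of a point of the zeros–poles model. -/
def OmegaZP.base (x : OmegaZP s hs) : zerosPoles s := (zpBundle s hs).proj x

/-- The coordinate over `𝒰_α` of a point of the zeros–poles model. -/
def OmegaZP.coord (α : BundleIndex s) (x : OmegaZP s hs) : ℂˣ := ((zpBundle s hs).localTriv α x).2

/-- An index `α` with `u ∈ 𝒰_α`. -/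
def OmegaZP.index (x : OmegaZP s hs) : BundleIndex s := (exists_mem_trivSet hs x.base).choose

theorem OmegaZP.base_mem (x : OmegaZP s hs) : x.base ∈ trivSet x.index :=
  (exists_mem_trivSet hs x.base).choose_spec

variable (hs)

theorem mem_localTriv_source {α : BundleIndex s} {x : OmegaZP s hs} :
    x ∈ ((zpBundle s hs).localTriv α).source ↔ x.base ∈ trivSet α := Iff.rfl

theorem mem_localTriv_target {α : BundleIndex s} {q : zerosPoles s × ℂˣ} :
    q ∈ ((zpBundle s hs).localTriv α).target ↔ q.1 ∈ trivSet α := by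
  rw [Bundle.Trivialization.target_eq]
  simp
  rfl

theorem coord_zpPoint {α : BundleIndex s} {u : zerosPoles s} (hu : u ∈ trivSet α) (l : ℂˣ) :
    (zpPoint hs α u l).coord α = l := by
  have := ((zpBundle s hs).localTriv α).toOpenPartialHomeomorph.right_inv
    ((mem_localTriv_target hs (q := (u, l))).2 hu)
  exact congrArg Prod.snd this

theorem zpPoint_coord {α : BundleIndex s} {x : OmegaZP s hs} (hx : x.base ∈ trivSet α) :
    zpPoint hs α x.base (x.coord α) = x :=
  ((zpBundle s hs).localTriv α).toOpenPartialHomeomorph.left_inv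
    ((mem_localTriv_source hs).2 hx)

/-- The factor `l P_u(α) / Q_u(α)` does not depend on the trivialization, by the form of the
transition functions. -/
theorem zpScalar_coord {α β : BundleIndex s} {x : OmegaZP s hs} (hα : x.base ∈ trivSet α)
    (hβ : x.base ∈ trivSet β) :
    zpScalar α x.base (x.coord α) = zpScalar β x.base (x.coord β) := by
  have key : ∀ {γ : BundleIndex s}, x.base ∈ trivSet γ → zpScalar γ x.base (x.coord γ) =
      zpScalar ((zpBundle s hs).indexAt x.base) x.base (show ℂˣ from x.2) := by
    intro γ hγ
    have h1 : x.coord γ =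
        transition γ ((zpBundle s hs).indexAt x.base) x.base * (show ℂˣ from x.2) := rfl
    have hi : x.base ∈ trivSet ((zpBundle s hs).indexAt x.base) :=
      (zpBundle s hs).mem_baseSet_at x.base
    rw [zpScalar, zpScalar, h1, Units.val_mul, transition_val hγ hi]
    have := hγ.1
    have := hγ.2
    have := hi.1
    have := hi.2
    field_simp
  rw [key hα, key hβ]

/-- The map `ℱ_s`, that is `[u, l]_α ↦ [l (P_u(α) / Q_u(α)) ν(1, {c_j}) : ν(1, {p_i})]`. -/
def zpMap (x : OmegaZP s hs) : OmegaCoef s :=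
  coefPoint (zpVec (x.index) x.base (x.coord (x.index)))
    (ne_zero_of_coefCondition hs (coefCondition_zpVec hs (x.base_mem) _))
    (coefCondition_zpVec hs (x.base_mem) _)

theorem zpMap_eq {α : BundleIndex s} {x : OmegaZP s hs} (hx : x.base ∈ trivSet α) :
    (zpMap hs x).1 = CP.proj _ ⟨zpVec α x.base (x.coord α), zpVec_ne_zero hs hx _⟩ := by
  have : zpVec (x.index) x.base (x.coord (x.index)) = zpVec α x.base (x.coord α) := by
    rw [zpVec_eq, zpVec_eq, zpScalar_coord hs (x.base_mem) hx]
  exact congrArg (CP.proj _) (Subtype.ext this)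

theorem zpMap_zpPoint {α : BundleIndex s} {u : zerosPoles s} (hu : u ∈ trivSet α) (l : ℂˣ) :
    (zpMap hs (zpPoint hs α u l)).1 = CP.proj _ ⟨zpVec α u l, zpVec_ne_zero hs hu l⟩ := by
  rw [zpMap_eq hs (x := zpPoint hs α u l) hu]
  exact congrArg (CP.proj _) (Subtype.ext (congrArg (zpVec α u) (coord_zpPoint hs hu l)))

/-- Homogeneous coordinates of the image determine the zeros, the poles and the fibre
coordinate. -/
theorem exists_of_zpMap_eq {α : BundleIndex s} {x : OmegaZP s hs} (hx : x.base ∈ trivSet α)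
    {v : {v : Fin (2 * s - 1 + 1) → ℂ // v ≠ 0}} (h : (zpMap hs x).1 = CP.proj _ v) :
    ∃ a : ℂ, a ≠ 0 ∧ numPoly s v.1 = C (a * zpScalar α x.base (x.coord α)) * zeroPoly x.base ∧
      denPoly s v.1 = C a * polePoly x.base := by
  rw [zpMap_eq hs hx] at h
  obtain ⟨a, ha⟩ := (CP.proj_eq_iff _ _).1 h.symm
  refine ⟨a, a.ne_zero, ?_, ?_⟩
  · rw [← ha, Units.smul_def, numPoly_smul hs, numPoly_zpVec hs, C_mul, mul_assoc]
  · rw [← ha, Units.smul_def, denPoly_smul hs, denPoly_zpVec hs]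

/-- The fibre coordinate over `𝒰_α` is the value of `Q / P` at `α`. -/
theorem coord_eq_of_zpMap_eq {α : BundleIndex s} {x : OmegaZP s hs} (hx : x.base ∈ trivSet α)
    {v : {v : Fin (2 * s - 1 + 1) → ℂ // v ≠ 0}} (h : (zpMap hs x).1 = CP.proj _ v) :
    (denPoly s v.1).eval α.pt ≠ 0 ∧
      (x.coord α : ℂ) = (numPoly s v.1).eval α.pt / (denPoly s v.1).eval α.pt := by
  obtain ⟨a, ha, hn, hd⟩ := exists_of_zpMap_eq hs hx h
  have := hx.1
  have := hx.2
  rw [hn, hd, eval_mul, eval_C, eval_mul, eval_C, zpScalar]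
  refine ⟨mul_ne_zero ha hx.2, ?_⟩
  field_simp

theorem base_fst_eq_of_zpMap_eq {x : OmegaZP s hs} {v : {v : Fin (2 * s - 1 + 1) → ℂ // v ≠ 0}}
    (h : (zpMap hs x).1 = CP.proj _ v) :
    ∃ h0 : coeffVec (s - 2) (numPoly s v.1) ≠ 0,
      x.base.1.1 = (vieteHomeo (s - 2)).symm (CP.proj _ ⟨_, h0⟩) := by
  obtain ⟨a, ha, hn, -⟩ := exists_of_zpMap_eq hs (x.base_mem) h
  have hc := mul_ne_zero ha (zpScalar_ne_zero (x.base_mem) (x.coord (x.index)))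
  refine ⟨coeffVec_ne_zero (numPoly_natDegree_le hs _) ?_, ?_⟩
  · rw [hn]
    exact mul_ne_zero (C_ne_zero.2 hc) x.base.1.1.poly_monic.ne_zero
  · rw [vieteProj_eq_of_poly hc hn]
    exact ((vieteHomeo (s - 2)).symm_apply_apply _).symm

theorem base_snd_eq_of_zpMap_eq {x : OmegaZP s hs} {v : {v : Fin (2 * s - 1 + 1) → ℂ // v ≠ 0}}
    (h : (zpMap hs x).1 = CP.proj _ v) :
    ∃ h0 : coeffVec s (denPoly s v.1) ≠ 0,
      x.base.1.2 = (vieteHomeo s).symm (CP.proj _ ⟨_, h0⟩) := by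
  obtain ⟨a, ha, -, hd⟩ := exists_of_zpMap_eq hs (x.base_mem) h
  refine ⟨coeffVec_ne_zero (denPoly_natDegree_le hs _) ?_, ?_⟩
  · rw [hd]
    exact mul_ne_zero (C_ne_zero.2 ha) x.base.1.2.poly_monic.ne_zero
  · rw [vieteProj_eq_of_poly ha hd]
    exact ((vieteHomeo s).symm_apply_apply _).symm

theorem zpMap_injective : Function.Injective (zpMap hs) := by
  intro x y hxy
  have h : (zpMap hs x).1 = CP.proj _ _ := (congrArg Subtype.val hxy).trans
    (zpMap_eq hs (y.base_mem))
  have h' := zpMap_eq hs (y.base_mem)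
  have hb : x.base = y.base := by
    obtain ⟨_, h1⟩ := base_fst_eq_of_zpMap_eq hs h
    obtain ⟨_, h2⟩ := base_snd_eq_of_zpMap_eq hs h
    obtain ⟨_, h3⟩ := base_fst_eq_of_zpMap_eq hs h'
    obtain ⟨_, h4⟩ := base_snd_eq_of_zpMap_eq hs h'
    exact Subtype.ext (Prod.ext (h1.trans h3.symm) (h2.trans h4.symm))
  have hx : x.base ∈ trivSet (y.index) := hb ▸ y.base_mem
  have hc : x.coord (y.index) = y.coord (y.index) :=
    Units.ext ((coord_eq_of_zpMap_eq hs hx h).2.trans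
      (coord_eq_of_zpMap_eq hs (y.base_mem) h').2.symm)
  rw [← zpPoint_coord hs hx, hc, hb, zpPoint_coord hs (y.base_mem)]

theorem zpMap_surjective : Function.Surjective (zpMap hs) := by
  rintro ⟨_, v, hv, rfl⟩
  obtain ⟨κ, c, hκ, hc⟩ := exists_eq_C_mul_rootPoly (numPoly_natDegree_le hs v.1)
    (numPoly_ne_zero hs hv)
  obtain ⟨μ, p, hμ, hp⟩ := exists_eq_C_mul_rootPoly (denPoly_natDegree_le hs v.1)
    (denPoly_ne_zero hs hv)
  have hcp := (coefCondition_iff_of_factorization hs hκ hμ hc hp).1 hv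
  set u : zerosPoles s := ⟨(SymProd.mk c, SymProd.mk p), (c, p), hcp, rfl⟩ with hu
  obtain ⟨α, hα⟩ := exists_mem_trivSet hs u
  have hl : κ / μ * ((zeroPoly u).eval α.pt / (polePoly u).eval α.pt) ≠ 0 :=
    mul_ne_zero (div_ne_zero hκ hμ) (div_ne_zero hα.1 hα.2)
  refine ⟨zpPoint hs α u (Units.mk0 _ hl), Subtype.ext ?_⟩
  rw [zpMap_zpPoint hs hα]
  refine (CP.proj_eq_iff _ _).2 ⟨(Units.mk0 μ hμ)⁻¹, ?_⟩
  have hsc : zpScalar α u (Units.mk0 _ hl) = μ⁻¹ * κ := by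
    rw [zpScalar, Units.val_mk0]
    have := hα.1
    have := hα.2
    field_simp
  change _ • v.1 = zpVec α u _
  rw [zpVec_eq, hsc, Units.smul_def]
  rw [← pairVec_coeffVec hs v.1, hc, hp, ← pairVec_smul, ← coeffVec_C_mul, ← coeffVec_C_mul,
    ← mul_assoc, ← C_mul, ← mul_assoc, ← C_mul]
  have : ((Units.mk0 μ hμ)⁻¹ : ℂˣ).val * μ = 1 := by simp [hμ]
  rw [this, C_1, one_mul, Units.val_inv_eq_inv_val, Units.val_mk0]
  rfl

/-- The bijection of the zeros–poles model with the coefficient model. -/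
def zpEquiv : OmegaZP s hs ≃ OmegaCoef s :=
  Equiv.ofBijective (zpMap hs) ⟨zpMap_injective hs, zpMap_surjective hs⟩

theorem zpMap_zpEquiv_symm (y : OmegaCoef s) : zpMap hs ((zpEquiv hs).symm y) = y :=
  (zpEquiv hs).apply_symm_apply y

/-- In the trivialization over `𝒰_α` the map is holomorphic: with holomorphic multiples `A` and `B`
of `Q_u` and `P_u` it is `l ↦ [l (B(α) / A(α)) A : B]`, as the factors of proportionality combine to
a common one. -/
theorem contMDiffAt_zpMap_zpPoint {α : BundleIndex s} {q₀ : zerosPoles s × ℂˣ}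
    (hq : q₀.1 ∈ trivSet α) :
    ContMDiffAt (modelZP s) (modelCoef s) ω
      (fun q : zerosPoles s × ℂˣ => zpMap hs (zpPoint hs α q.1 q.2)) q₀ := by
  refine contMDiffAt_of_val_comp ?_
  obtain ⟨A, hA, hAdeg, hA'⟩ := SymProd.exists_holomorphic_poly q₀.1.1.1
  obtain ⟨B, hB, hBdeg, hB'⟩ := SymProd.exists_holomorphic_poly q₀.1.1.2
  have hfst : ContMDiffAt (modelZP s) 𝓘(ℂ, Fin (s - 2) → ℂ) ω
      (fun q : zerosPoles s × ℂˣ => q.1.1.1) q₀ :=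
    contMDiffAt_fst.comp q₀ (contMDiff_subtype_val.contMDiffAt.comp q₀ contMDiffAt_fst)
  have hsnd : ContMDiffAt (modelZP s) 𝓘(ℂ, Fin s → ℂ) ω
      (fun q : zerosPoles s × ℂˣ => q.1.1.2) q₀ :=
    contMDiffAt_snd.comp q₀ (contMDiff_subtype_val.contMDiffAt.comp q₀ contMDiffAt_fst)
  have hunit : ContMDiffAt (modelZP s) 𝓘(ℂ, ℂ) ω (fun q : zerosPoles s × ℂˣ => (q.2 : ℂ)) q₀ :=
    (Units.contMDiff_val (R := ℂ)).contMDiffAt.comp q₀ contMDiffAt_snd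
  have hAq : HolomorphicCoeffAt (modelZP s) (fun q : zerosPoles s × ℂˣ => A q.1.1.1) q₀ :=
    fun k => (hA k).comp q₀ hfst
  have hBq : HolomorphicCoeffAt (modelZP s) (fun q : zerosPoles s × ℂˣ => B q.1.1.2) q₀ :=
    fun k => (hB k).comp q₀ hsnd
  have hA0 : (A q₀.1.1.1).eval α.pt ≠ 0 := by
    obtain ⟨κ, hκ, h⟩ := hA'.self_of_nhds
    rw [h, eval_mul, eval_C]
    exact mul_ne_zero hκ hq.1
  have hev : ∀ᶠ q in 𝓝 q₀, ∃ μ : ℂ, μ ≠ 0 ∧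
      pairVec s (coeffVec (s - 2) (C (q.2 * ((B q.1.1.2).eval α.pt / (A q.1.1.1).eval α.pt)) *
        A q.1.1.1)) (coeffVec s (B q.1.1.2)) = μ • zpVec α q.1 q.2 := by
    filter_upwards [hfst.continuousAt.eventually hA', hsnd.continuousAt.eventually hB',
      continuousAt_fst.eventually ((isOpen_trivSet α).mem_nhds hq)] with q h1 h2 h3
    obtain ⟨κ, hκ, h1⟩ := h1
    obtain ⟨μ, hμ, h2⟩ := h2
    refine ⟨μ, hμ, ?_⟩
    rw [h1, h2, zpVec_eq, ← pairVec_smul, ← coeffVec_C_mul, ← coeffVec_C_mul, zpScalar, eval_mul,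
      eval_mul, eval_C, eval_C, ← mul_assoc, ← C_mul, ← mul_assoc, ← C_mul]
    have hQ : eval α.pt q.1.1.1.poly ≠ 0 := h3.1
    congr 4
    simp only [zeroPoly, polePoly]
    field_simp
  refine contMDiffAt_of_homogeneous (g := fun q : zerosPoles s × ℂˣ =>
    pairVec s (coeffVec (s - 2) (C (q.2 * ((B q.1.1.2).eval α.pt / (A q.1.1.1).eval α.pt)) *
        A q.1.1.1)) (coeffVec s (B q.1.1.2))) ?_ ?_ ?_
  · refine contMDiffAt_pairVec (((HolomorphicCoeffAt.C ?_).mul hAq).coeffVec _) (hBq.coeffVec s)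
    exact hunit.mul (contMDiffAt_div (hBq.eval (fun _ => hBdeg _) contMDiffAt_const)
      (hAq.eval (fun _ => hAdeg _) contMDiffAt_const) hA0)
  · obtain ⟨μ, hμ, h⟩ := hev.self_of_nhds
    rw [h]
    exact smul_ne_zero hμ (zpVec_ne_zero hs hq _)
  · filter_upwards [hev, continuousAt_fst.eventually ((isOpen_trivSet α).mem_nhds hq)]
      with q ⟨μ, hμ, h⟩ h3 hne
    rw [zpMap_zpPoint hs h3]
    refine (CP.proj_eq_iff _ _).2 ⟨(Units.mk0 μ hμ)⁻¹, ?_⟩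
    rw [inv_smul_eq_iff]
    exact h

/-- The zeros and poles depend holomorphically on the point of the coefficient model. -/
theorem contMDiff_base_zpEquiv_symm :
    ContMDiff (modelCoef s) (𝓘(ℂ, Fin (s - 2) → ℂ).prod 𝓘(ℂ, Fin s → ℂ)) ω
      fun y => ((zpEquiv hs).symm y).base := by
  intro y₀
  refine contMDiffAt_of_val_comp ?_
  obtain ⟨σ, hσ, hσ'⟩ := exists_coef_section y₀
  have hproj : ∀ᶠ y in 𝓝 y₀, (zpMap hs ((zpEquiv hs).symm y)).1 = CP.proj _ (σ y) := by
    filter_upwards [hσ'] with y hy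
    rw [zpMap_zpEquiv_symm, hy]
  have h1 : ContMDiffAt (modelCoef s) 𝓘(ℂ, Fin (s - 2) → ℂ) ω
      (fun y => vieteHomeo (s - 2) ((zpEquiv hs).symm y).base.1.1) y₀ := by
    refine contMDiffAt_of_homogeneous ((HolomorphicCoeffAt.numPoly hs hσ).coeffVec (s - 2)) ?_ ?_
    · exact (base_fst_eq_of_zpMap_eq hs hproj.self_of_nhds).1
    · filter_upwards [hproj] with y hy h0
      rw [(base_fst_eq_of_zpMap_eq hs hy).2, Homeomorph.apply_symm_apply]
  have h2 : ContMDiffAt (modelCoef s) 𝓘(ℂ, Fin s → ℂ) ω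
      (fun y => vieteHomeo s ((zpEquiv hs).symm y).base.1.2) y₀ := by
    refine contMDiffAt_of_homogeneous ((HolomorphicCoeffAt.denPoly hs hσ).coeffVec s) ?_ ?_
    · exact (base_snd_eq_of_zpMap_eq hs hproj.self_of_nhds).1
    · filter_upwards [hproj] with y hy h0
      rw [(base_snd_eq_of_zpMap_eq hs hy).2, Homeomorph.apply_symm_apply]
  have h3 := ((contMDiff_vieteHomeo_symm _).contMDiffAt.comp y₀ h1).prodMk
    ((contMDiff_vieteHomeo_symm _).contMDiffAt.comp y₀ h2)
  refine h3.congr_of_eventuallyEq (Eventually.of_forall fun y => ?_)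
  simp

theorem contMDiffAt_coord_zpEquiv_symm {α : BundleIndex s} {y₀ : OmegaCoef s}
    (h : ((zpEquiv hs).symm y₀).base ∈ trivSet α) :
    ContMDiffAt (modelCoef s) 𝓘(ℂ, ℂ) ω (fun y => ((zpEquiv hs).symm y).coord α) y₀ := by
  refine contMDiffAt_units ?_
  obtain ⟨σ, hσ, hσ'⟩ := exists_coef_section y₀
  have hproj : ∀ᶠ y in 𝓝 y₀, (zpMap hs ((zpEquiv hs).symm y)).1 = CP.proj _ (σ y) := by
    filter_upwards [hσ'] with y hy
    rw [zpMap_zpEquiv_symm, hy]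
  have hQ := (HolomorphicCoeffAt.numPoly hs hσ).eval (fun _ => numPoly_natDegree_le hs _)
    (contMDiffAt_const (c := α.pt))
  have hP := (HolomorphicCoeffAt.denPoly hs hσ).eval (fun _ => denPoly_natDegree_le hs _)
    (contMDiffAt_const (c := α.pt))
  refine (contMDiffAt_div hQ hP
    (coord_eq_of_zpMap_eq hs h hproj.self_of_nhds).1).congr_of_eventuallyEq ?_
  filter_upwards [hproj, (contMDiff_base_zpEquiv_symm hs).continuous.continuousAt.eventually
    ((isOpen_trivSet α).mem_nhds h)] with y hy hmem
  exact (coord_eq_of_zpMap_eq hs hmem hy).2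

/-- The charts of the total space are local trivializations followed by charts of `M_s × ℂ*`. -/
theorem exists_of_mem_atlas_zp {e : OpenPartialHomeomorph (OmegaZP s hs)
      (ModelProd (ModelProd (Fin (s - 2) → ℂ) (Fin s → ℂ)) ℂ)}
    (he : e ∈ atlas (ModelProd (ModelProd (Fin (s - 2) → ℂ) (Fin s → ℂ)) ℂ) (OmegaZP s hs)) :
    ∃ (α : BundleIndex s) (c : OpenPartialHomeomorph (zerosPoles s × ℂˣ) _),
      c ∈ atlas (ModelProd (ModelProd (Fin (s - 2) → ℂ) (Fin s → ℂ)) ℂ) (zerosPoles s × ℂˣ) ∧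
      e = ((zpBundle s hs).localTriv α).toOpenPartialHomeomorph.trans c := by
  obtain ⟨_, ⟨t, ⟨α, rfl⟩, rfl⟩, c, hc, rfl⟩ := he
  exact ⟨α, c, hc, rfl⟩

theorem isChartwiseBiholomorphic_zpEquiv :
    IsChartwiseBiholomorphic (modelZP s) (modelCoef s) (zpEquiv hs) where
  contMDiffAt := by
    intro e he x hx
    obtain ⟨α, c, hc, rfl⟩ := exists_of_mem_atlas_zp hs he
    rw [OpenPartialHomeomorph.trans_target] at hx
    have h1 := contMDiffAt_symm_of_mem_maximalAtlas (I := modelZP s) (n := ω)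
      (IsManifold.subset_maximalAtlas hc) hx.1
    exact (contMDiffAt_zpMap_zpPoint hs ((mem_localTriv_target hs).1 hx.2)).comp x h1
  eventually_mem := by
    intro e he y hy
    obtain ⟨α, c, hc, rfl⟩ := exists_of_mem_atlas_zp hs he
    rw [OpenPartialHomeomorph.trans_source] at hy ⊢
    filter_upwards [(contMDiff_base_zpEquiv_symm hs).continuous.continuousAt.eventually
        ((isOpen_trivSet α).mem_nhds hy.1),
      ((contMDiff_base_zpEquiv_symm hs).continuous.continuousAt.prodMk
        (contMDiffAt_coord_zpEquiv_symm hs hy.1).continuousAt).eventually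
          (c.open_source.mem_nhds hy.2)] with z h1 h2
    exact ⟨h1, h2⟩
  contMDiffAt_symm := by
    intro e he y hy
    obtain ⟨α, c, hc, rfl⟩ := exists_of_mem_atlas_zp hs he
    rw [OpenPartialHomeomorph.trans_source] at hy
    have h1 := contMDiffAt_of_mem_maximalAtlas (I := modelZP s) (n := ω)
      (IsManifold.subset_maximalAtlas hc) hy.2
    exact ContMDiffAt.comp (f := fun z => (((zpEquiv hs).symm z).base,
      ((zpEquiv hs).symm z).coord α)) y h1 ((contMDiff_base_zpEquiv_symm hs).contMDiffAt.prodMk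
        (contMDiffAt_coord_zpEquiv_symm hs hy.1))

end

/-! ### The map from the residues–poles model -/

section

variable {s : ℕ} (hs : 2 ≤ s)

/-- The map `(r, p) ↦ [a_{s-2} : … : a₀ : ν(1, {p₁, …, p_s})]` before passing to the quotient by the
symmetric group. -/
def rpLift (x : residueSpace s × poleSpace s) : OmegaCoef s :=
  coefPoint (rpVec x.1 x.2) (rpVec_ne_zero hs _ _) (coefCondition_rpVec hs _ _)

theorem rpLift_smul (σ : SymGroup s) (x : residueSpace s × poleSpace s) :
    rpLift hs (σ • x) = rpLift hs x :=
  Subtype.ext (congrArg (CP.proj _) (Subtype.ext (rpVec_smul σ x)))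

/-- The map `C_s`, that is `⟨r, p⟩ ↦ [a_{s-2} : … : a₀ : ν(1, {p₁, …, p_s})]`. -/
def rpMap : OmegaRP s → OmegaCoef s :=
  Quotient.lift (s := MulAction.orbitRel (SymGroup s) (residueSpace s × poleSpace s))
    (rpLift hs) (by
      rintro _ x ⟨σ, rfl⟩
      exact rpLift_smul hs σ x)

theorem exists_smul_of_rpLift_eq {x y : residueSpace s × poleSpace s}
    (h : rpLift hs x = rpLift hs y) : ∃ σ : SymGroup s, σ • y = x := by
  obtain ⟨a, ha⟩ := (CP.proj_eq_iff _ _).1 (congrArg Subtype.val h)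
  exact exists_smul_eq_of_rpVec hs (μ := (a : ℂ)) ha.symm

theorem rpLift_surjective : Function.Surjective (rpLift hs) := by
  rintro ⟨_, v, hv, rfl⟩
  obtain ⟨μ, r, p, hμ, h⟩ := exists_rpVec hs hv
  refine ⟨(r, p), Subtype.ext ((CP.proj_eq_iff _ _).2 ⟨(Units.mk0 μ hμ)⁻¹, ?_⟩)⟩
  rw [inv_smul_eq_iff]
  exact h

/-- The bijection of the residues–poles model with the coefficient model. -/
def rpEquiv : OmegaRP s ≃ OmegaCoef s :=
  Equiv.ofBijective (rpMap hs) (by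
    constructor
    · rintro ⟨x⟩ ⟨y⟩ h
      exact Quotient.sound (exists_smul_of_rpLift_eq hs h)
    · intro y
      obtain ⟨x, hx⟩ := rpLift_surjective hs y
      exact ⟨rpPoint x.1 x.2, hx⟩)

theorem contMDiff_residue (j : Fin s) : ContMDiff (modelRP s) 𝓘(ℂ, ℂ) ω
    fun x : residueSpace s × poleSpace s => x.1.1.1 j := by
  have h : ContDiff ℂ ω fun r : residueHyperplane s => r.1 j :=
    (contDiff_apply ℂ ℂ j).comp (residueHyperplane s).subtypeL.contDiff
  exact h.contMDiff.comp (contMDiff_subtype_val.comp contMDiff_fst)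

theorem contMDiff_pole (j : Fin s) : ContMDiff (modelRP s) 𝓘(ℂ, ℂ) ω
    fun x : residueSpace s × poleSpace s => x.2.1 j :=
  (contMDiff_sphere_apply j).comp (contMDiff_subtype_val.comp contMDiff_snd)

/-- Near a given tuple of poles the linear factors are replaced by multiples with holomorphic
coefficients; this multiplies numerator and denominator by a common factor. -/
theorem contMDiff_rpLift : ContMDiff (modelRP s) (modelCoef s) ω (rpLift hs) := by
  intro x₀
  refine contMDiffAt_of_val_comp ?_
  choose L hL hL' using fun j => exists_holomorphic_factor (x₀.2.1 j)
  have hLx : ∀ j, HolomorphicCoeffAt (modelRP s)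
      (fun x : residueSpace s × poleSpace s => L j (x.2.1 j)) x₀ := fun j k =>
    ContMDiffAt.comp (g := fun p => (L j p).coeff k) x₀ (hL j k) (contMDiff_pole j).contMDiffAt
  have hev : ∀ᶠ x : residueSpace s × poleSpace s in 𝓝 x₀, ∃ a : ℂˣ,
      pairVec s (coeffVec (s - 2) (∑ j, C (x.1.1.1 j) * derivative (L j (x.2.1 j)) *
        ∏ i ∈ Finset.univ.erase j, L i (x.2.1 i))) (coeffVec s (∏ j, L j (x.2.1 j))) =
      (a : ℂ) • rpVec x.1 x.2 := by
    have h1 : ∀ᶠ x : residueSpace s × poleSpace s in 𝓝 x₀, ∀ j, ∃ a : ℂˣ,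
        L j (x.2.1 j) = C (a : ℂ) * linearFactor (x.2.1 j) :=
      eventually_all.2 fun j => (contMDiff_pole j).continuous.continuousAt.eventually (hL' j)
    filter_upwards [h1] with x hx
    choose a ha using hx
    refine ⟨∏ j, a j, ?_⟩
    rw [rpVec, viete_eq_coeffVec, C_1, one_mul, SymProd.poly_mk, ← pairVec_smul]
    change _ = pairVec s (_ • coeffVec (s - 2) _) _
    rw [← coeffVec_C_mul, ← coeffVec_C_mul, residueNumerator_eq, rootPoly, Units.coe_prod, map_prod,
      ← Finset.prod_mul_distrib, Finset.mul_sum]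
    congr 2
    · refine Finset.sum_congr rfl fun j _ => ?_
      rw [← Finset.mul_prod_erase _ _ (Finset.mem_univ j), ha, derivative_C_mul,
        Finset.prod_congr rfl fun i _ => ha i, Finset.prod_mul_distrib]
      ring
    · exact Finset.prod_congr rfl fun i _ => ha i
  have hnum : HolomorphicCoeffAt (modelRP s) (fun x : residueSpace s × poleSpace s =>
      ∑ j, C (x.1.1.1 j) * derivative (L j (x.2.1 j)) *
        ∏ i ∈ Finset.univ.erase j, L i (x.2.1 i)) x₀ :=
    HolomorphicCoeffAt.sum fun j _ =>
      ((HolomorphicCoeffAt.C (contMDiff_residue j).contMDiffAt).mul (hLx j).derivative).mul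
        (HolomorphicCoeffAt.prod hLx)
  have hden : HolomorphicCoeffAt (modelRP s) (fun x : residueSpace s × poleSpace s =>
      ∏ j, L j (x.2.1 j)) x₀ := HolomorphicCoeffAt.prod hLx
  refine contMDiffAt_of_homogeneous
    (contMDiffAt_pairVec (hnum.coeffVec _) (hden.coeffVec _)) ?_ ?_
  · obtain ⟨a, ha⟩ := hev.self_of_nhds
    rw [ha]
    exact smul_ne_zero a.ne_zero (rpVec_ne_zero hs _ _)
  · filter_upwards [hev] with x ⟨a, ha⟩ hne
    refine (CP.proj_eq_iff _ _).2 ⟨a⁻¹, ?_⟩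
    rw [inv_smul_eq_iff]
    exact ha

end

/-! ### Roots as holomorphic functions of the coefficients -/

/-- A simple root of a polynomial is a holomorphic function of the coefficients. -/
theorem exists_holomorphic_root {E : Type*} [NormedAddCommGroup E] [NormedSpace ℂ E]
    [CompleteSpace E] {G : E → ℂ[X]} {v₀ : E} {z₀ : ℂ} {n : ℕ}
    (hG : HolomorphicCoeffAt 𝓘(ℂ, E) G v₀) (hn : ∀ v, (G v).natDegree ≤ n)
    (h0 : (G v₀).eval z₀ = 0) (h1 : (derivative (G v₀)).eval z₀ ≠ 0) :
    ∃ φ : E → ℂ, ContMDiffAt 𝓘(ℂ, E) 𝓘(ℂ, ℂ) ω φ v₀ ∧ φ v₀ = z₀ ∧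
      ∀ᶠ v in 𝓝 v₀, (G v).eval (φ v) = 0 := by
  set F : E × ℂ → ℂ := fun q => (G q.1).eval q.2 with hF
  have hFd : ContDiffAt ℂ ω F (v₀, z₀) := by
    have hfst : ContMDiffAt 𝓘(ℂ, E × ℂ) 𝓘(ℂ, E) ω (fun q : E × ℂ => q.1) (v₀, z₀) :=
      contDiff_fst.contMDiff.contMDiffAt
    have hsnd : ContMDiffAt 𝓘(ℂ, E × ℂ) 𝓘(ℂ, ℂ) ω (fun q : E × ℂ => q.2) (v₀, z₀) :=
      contDiff_snd.contMDiff.contMDiffAt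
    have h2 : HolomorphicCoeffAt 𝓘(ℂ, E × ℂ) (fun q : E × ℂ => G q.1) (v₀, z₀) :=
      fun k => ContMDiffAt.comp (g := fun v => (G v).coeff k) (v₀, z₀) (hG k) hfst
    exact contMDiffAt_iff_contDiffAt.1 (h2.eval (fun _ => hn _) hsnd)
  have hinv : (fderiv ℂ F (v₀, z₀) ∘L .inr ℂ E ℂ).IsInvertible := by
    have hd : HasDerivAt (fun z => F (v₀, z)) ((derivative (G v₀)).eval z₀) z₀ :=
      (G v₀).hasDerivAt z₀
    have hc : HasFDerivAt (fun z => F (v₀, z)) (fderiv ℂ F (v₀, z₀) ∘L .inr ℂ E ℂ) z₀ :=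
      (hFd.differentiableAt (by simp)).hasFDerivAt.comp z₀ (hasFDerivAt_prodMk_right v₀ z₀)
    refine ⟨ContinuousLinearEquiv.unitsEquivAut ℂ (Units.mk0 _ h1), ?_⟩
    ext
    have := hc.hasDerivAt.unique hd
    simpa using this.symm
  refine ⟨hFd.implicitFunction (by simp) hinv,
    (hFd.contDiffAt_implicitFunction (by simp) hinv).contMDiffAt,
    hFd.implicitFunction_apply_self (by simp) hinv, ?_⟩
  filter_upwards [hFd.eventually_apply_implicitFunction (by simp) hinv] with v hv
  exact hv.trans h0

/-- The point `p` of the sphere is a root of `f` as a form of degree `s`: for `p = ∞` this means that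
the coefficient of `z^s` vanishes. -/
def IsFormRoot (s : ℕ) (f : ℂ[X]) (p : RiemannSphere) : Prop :=
  p.elim (f.coeff s = 0) fun z => f.eval z = 0

theorem isFormRoot_C_mul_rootPoly {s : ℕ} {a : ℂ} (ha : a ≠ 0) {p : Fin s → RiemannSphere}
    {q : RiemannSphere} : IsFormRoot s (C a * rootPoly p) q ↔ ∃ i, p i = q := by
  induction q using OnePoint.rec with
  | infty =>
    rw [← rootPoly_coeff_eq_zero_iff]
    change (C a * rootPoly p).coeff s = 0 ↔ _
    simp [ha]
  | coe z =>
    rw [← rootPoly_eval_eq_zero_iff]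
    change (C a * rootPoly p).eval z = 0 ↔ _
    simp [ha]

theorem isFormRoot_sphereInv {s : ℕ} {f : ℂ[X]} (hf : f.natDegree ≤ s) {w : ℂ}
    (h : (reflect s f).eval w = 0) : IsFormRoot s f (sphereInv (w : RiemannSphere)) := by
  rcases eq_or_ne w 0 with rfl | hw
  · rw [sphereInv_zero]
    rw [← coeff_zero_eq_eval_zero, coeff_reflect, revAt_le (Nat.zero_le s)] at h
    exact h
  · rw [sphereInv_coe hw]
    have : Invertible w⁻¹ := invertibleOfNonzero (inv_ne_zero hw)
    have h2 := eval₂_reflect_mul_pow (RingHom.id ℂ) w⁻¹ s f hf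
    simp only [invOf_eq_inv, inv_inv] at h2
    change eval w⁻¹ f = 0
    rw [eval, ← h2, ← eval, h, zero_mul]

/-- The poles are holomorphic functions of the coefficients. Near a pole at `∞` its inverse is a
simple root of the reflected polynomial `z^s P(1/z)`. -/
theorem exists_holomorphic_pole {s : ℕ} (hs : 2 ≤ s) {v₀ : Fin (2 * s - 1 + 1) → ℂ} {a : ℂ}
    (ha : a ≠ 0) {p : Fin s → RiemannSphere} (hp : Function.Injective p)
    (hv : denPoly s v₀ = C a * rootPoly p) (j : Fin s) :
    ∃ φ : (Fin (2 * s - 1 + 1) → ℂ) → RiemannSphere,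
      ContMDiffAt 𝓘(ℂ, Fin (2 * s - 1 + 1) → ℂ) 𝓘(ℂ, ℂ) ω φ v₀ ∧ φ v₀ = p j ∧
      ∀ᶠ v in 𝓝 v₀, IsFormRoot s (denPoly s v) (φ v) := by
  have hden : HolomorphicCoeffAt 𝓘(ℂ, Fin (2 * s - 1 + 1) → ℂ) (fun v => denPoly s v) v₀ :=
    HolomorphicCoeffAt.denPoly hs contMDiffAt_id
  cases hq : p j using OnePoint.rec with
  | coe z₀ =>
    obtain ⟨φ, h1, h2, h3⟩ := exists_holomorphic_root hden (denPoly_natDegree_le hs) (z₀ := z₀)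
      (by rw [hv, eval_mul, (rootPoly_eval_eq_zero_iff p z₀).2 ⟨j, hq⟩, mul_zero])
      (by
        rw [hv, derivative_C_mul, eval_mul, eval_C]
        exact mul_ne_zero ha (derivative_rootPoly_eval_ne_zero hs hp hq))
    exact ⟨fun v => (φ v : RiemannSphere), contMDiff_sphere_coe.contMDiffAt.comp v₀ h1,
      congrArg _ h2, h3⟩
  | infty =>
    have h0 := (rootPoly_coeff_eq_zero_iff p).2 ⟨j, hq⟩
    have hrev : HolomorphicCoeffAt 𝓘(ℂ, Fin (2 * s - 1 + 1) → ℂ)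
        (fun v => reflect s (denPoly s v)) v₀ := by
      intro k
      simp only [coeff_reflect]
      exact hden _
    obtain ⟨φ, h1, h2, h3⟩ := exists_holomorphic_root hrev (n := s) (z₀ := 0)
      (fun v => by
        rw [natDegree_le_iff_coeff_eq_zero]
        intro k hk
        rw [coeff_reflect, revAt_eq_self_of_lt hk]
        exact coeff_eq_zero_of_natDegree_lt ((denPoly_natDegree_le hs v).trans_lt hk))
      (by
        rw [← coeff_zero_eq_eval_zero, coeff_reflect, revAt_le (Nat.zero_le s), hv, coeff_C_mul]
        simp [h0])
      (by
        rw [← coeff_zero_eq_eval_zero, coeff_derivative, coeff_reflect, zero_add,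
          revAt_le (by omega), hv, coeff_C_mul]
        simpa [ha] using fun h => ((injective_iff_rootPoly hs p).1 hp).1 ⟨h0, h⟩)
    refine ⟨fun v => sphereInv (φ v : RiemannSphere),
      contMDiff_sphereInv_coe.contMDiffAt.comp v₀ h1, ?_, ?_⟩
    · simp only [h2, sphereInv_zero]
    · filter_upwards [h3] with v hv'
      exact isFormRoot_sphereInv (denPoly_natDegree_le hs v) hv'

section

variable {s : ℕ} (hs : 2 ≤ s)

theorem exists_of_rpLift_eq {x : residueSpace s × poleSpace s}
    {v : {v : Fin (2 * s - 1 + 1) → ℂ // v ≠ 0}} (h : (rpLift hs x).1 = CP.proj _ v) :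
    ∃ a : ℂ, a ≠ 0 ∧ numPoly s v.1 = C a * residueNumerator x.1.1.1 x.2.1 ∧
      denPoly s v.1 = C a * rootPoly x.2.1 := by
  obtain ⟨a, ha⟩ := (CP.proj_eq_iff _ _).1 h.symm
  refine ⟨a, a.ne_zero, ?_, ?_⟩
  · rw [← ha, Units.smul_def, numPoly_smul hs, numPoly_rpVec hs]
  · rw [← ha, Units.smul_def, denPoly_smul hs, denPoly_rpVec hs]

/-- The residue at a finite pole is `Q(z) / P'(z)`. -/
theorem residue_eq {x : residueSpace s × poleSpace s}
    {v : {v : Fin (2 * s - 1 + 1) → ℂ // v ≠ 0}} (h : (rpLift hs x).1 = CP.proj _ v) {j : Fin s}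
    {z : ℂ} (hj : x.2.1 j = (z : RiemannSphere)) :
    (derivative (denPoly s v.1)).eval z ≠ 0 ∧
      x.1.1.1 j = (numPoly s v.1).eval z / (derivative (denPoly s v.1)).eval z := by
  obtain ⟨a, ha, hn, hd⟩ := exists_of_rpLift_eq hs h
  have := derivative_rootPoly_eval_ne_zero hs x.2.2 hj
  rw [hn, hd, derivative_C_mul, eval_mul, eval_mul, eval_C, residueNumerator_eval _ _ hj]
  refine ⟨mul_ne_zero ha this, ?_⟩
  field_simp

/-- A point of the coefficient model has a preimage with prescribed order of its poles. -/
theorem exists_rpLift_eq_of_poles {y : OmegaCoef s} {v : {v : Fin (2 * s - 1 + 1) → ℂ // v ≠ 0}}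
    (hv : CP.proj _ v = y.1) {p : Fin s → RiemannSphere} (hp : Function.Injective p)
    (hroot : ∀ j, IsFormRoot s (denPoly s v.1) (p j)) :
    ∃ x : residueSpace s × poleSpace s, rpLift hs x = y ∧ x.2.1 = p := by
  obtain ⟨x, hx⟩ := rpLift_surjective hs y
  obtain ⟨a, ha, -, hd⟩ := exists_of_rpLift_eq hs ((congrArg Subtype.val hx).trans hv.symm)
  have h1 : ∀ j, ∃ i, x.2.1 i = p j := fun j => by
    have := hroot j
    rwa [hd, isFormRoot_C_mul_rootPoly ha] at this
  choose τ hτ using h1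
  have hτi : Function.Injective τ := fun i j hij => hp (by rw [← hτ, ← hτ, hij])
  set τ' := Equiv.ofBijective τ (Finite.injective_iff_bijective.1 hτi)
  refine ⟨DomMulAct.mk τ' • x, (rpLift_smul hs _ x).trans hx, funext fun j => hτ j⟩

theorem eq_of_rpLift_eq_of_poles {x y : residueSpace s × poleSpace s}
    (h : rpLift hs x = rpLift hs y) (hp : x.2 = y.2) : x = y := by
  obtain ⟨σ, hσ⟩ := exists_smul_of_rpLift_eq hs h
  have h1 : σ = 1 := by
    apply DomMulAct.mk.symm.injective
    ext i
    have h2 : y.2.1 (DomMulAct.mk.symm σ i) = y.2.1 i := by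
      have h3 : (σ • y).2.1 i = y.2.1 i := by rw [hσ, hp]
      exact h3
    exact congrArg Fin.val (y.2.2 h2)
  rw [← hσ, h1, one_smul]

/-- Holomorphy of a map to the hyperplane can be checked in the ambient space, which has a linear
retraction to the hyperplane. -/
theorem contMDiffAt_residueHyperplane {E H : Type*} [NormedAddCommGroup E] [NormedSpace ℂ E]
    [TopologicalSpace H] {I : ModelWithCorners ℂ E H} {M : Type*} [TopologicalSpace M]
    [ChartedSpace H M] {f : M → residueHyperplane s} {x : M}
    (h : ContMDiffAt I 𝓘(ℂ, Fin s → ℂ) ω (fun y => (f y).1) x) :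
    ContMDiffAt I 𝓘(ℂ, residueHyperplane s) ω f x := by
  obtain ⟨g, hg⟩ := (residueHyperplane s).subtype.exists_leftInverse_of_injective
    (LinearMap.ker_eq_bot.2 Subtype.val_injective)
  have h2 := (g.toContinuousLinearMap.contDiff (n := ω)).contMDiff.contMDiffAt.comp x h
  refine h2.congr_of_eventuallyEq (Eventually.of_forall fun y => ?_)
  exact (LinearMap.congr_fun hg (f y)).symm

/-- The map `(r, p) ↦ [a : b]` has a holomorphic local section through every point `(r₀, p₀)`: the
poles are followed as simple roots of the denominator, and the residues are determined by them. -/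
theorem exists_rpLift_section (x₀ : residueSpace s × poleSpace s) :
    ∃ σ : OmegaCoef s → residueSpace s × poleSpace s,
      ContMDiffAt (modelCoef s) (modelRP s) ω σ (rpLift hs x₀) ∧ σ (rpLift hs x₀) = x₀ ∧
      ∀ᶠ y in 𝓝 (rpLift hs x₀), rpLift hs (σ y) = y := by
  classical
  set y₀ := rpLift hs x₀ with hy₀
  obtain ⟨v, hv, hv'⟩ := exists_coef_section y₀
  obtain ⟨a, ha, -, hd⟩ := exists_of_rpLift_eq hs hv'.self_of_nhds.symm
  choose φ hφ hφ0 hφr using exists_holomorphic_pole hs ha x₀.2.2 hd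
  set p : OmegaCoef s → Fin s → RiemannSphere := fun y j => φ j (v y).1 with hp
  have hpj : ∀ j, ContMDiffAt (modelCoef s) 𝓘(ℂ, ℂ) ω (fun y => p y j) y₀ := fun j =>
    (hφ j).comp y₀ hv
  have hpc : ContMDiffAt (modelCoef s) 𝓘(ℂ, Fin s → ℂ) ω p y₀ := contMDiffAt_sphere_pi hpj
  have hp0 : p y₀ = x₀.2.1 := funext fun j => hφ0 j
  have hpinj : ∀ᶠ y in 𝓝 y₀, Function.Injective (p y) :=
    hpc.continuousAt.eventually ((poleSpace s).isOpen.mem_nhds (by rw [hp0]; exact x₀.2.2))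
  have hroot : ∀ᶠ y in 𝓝 y₀, ∀ j, IsFormRoot s (denPoly s (v y).1) (p y j) :=
    eventually_all.2 fun j => hv.continuousAt.eventually (hφr j)
  set σ : OmegaCoef s → residueSpace s × poleSpace s := fun y =>
    if h : ∃ x : residueSpace s × poleSpace s, rpLift hs x = y ∧ x.2.1 = p y then h.choose else x₀
    with hσ
  have hσ' : ∀ᶠ y in 𝓝 y₀, rpLift hs (σ y) = y ∧ (σ y).2.1 = p y := by
    filter_upwards [hpinj, hroot, hv'] with y h1 h2 h3
    have h := exists_rpLift_eq_of_poles hs h3 h1 h2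
    simp only [hσ, dif_pos h]
    exact h.choose_spec
  -- at most one of the poles is `∞`, and its residue is determined by the others
  obtain ⟨j₀, hj₀⟩ : ∃ j₀, ∀ j, j ≠ j₀ → x₀.2.1 j ≠ OnePoint.infty := by
    by_cases h : ∃ j₀, x₀.2.1 j₀ = OnePoint.infty
    · obtain ⟨j₀, h⟩ := h
      exact ⟨j₀, fun j hj hj' => hj (x₀.2.2 (hj'.trans h.symm))⟩
    · push Not at h
      exact ⟨⟨0, by omega⟩, fun j _ => h j⟩
  have hchart : ∀ {q : RiemannSphere}, q ≠ OnePoint.infty →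
      ((sphereChartFinite q : ℂ) : RiemannSphere) = q := fun hq =>
    sphereChartFinite.left_inv (mem_sphereChartFinite_source.2 hq)
  set z : Fin s → OmegaCoef s → ℂ := fun j y => sphereChartFinite (p y j) with hz
  have hzc : ∀ j, j ≠ j₀ → ContMDiffAt (modelCoef s) 𝓘(ℂ, ℂ) ω (z j) y₀ := fun j hj =>
    ContMDiffAt.comp y₀ (contMDiffAt_of_mem_maximalAtlas
      (IsManifold.subset_maximalAtlas (Or.inl rfl))
      (mem_sphereChartFinite_source.2 (by rw [hp0]; exact hj₀ j hj))) (hpj j)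
  set ρ : Fin s → OmegaCoef s → ℂ := fun j y =>
    (numPoly s (v y).1).eval (z j y) / (derivative (denPoly s (v y).1)).eval (z j y) with hρ
  have hρev : ∀ᶠ y in 𝓝 y₀, ∀ j, j ≠ j₀ →
      (derivative (denPoly s (v y).1)).eval (z j y) ≠ 0 ∧ (σ y).1.1.1 j = ρ j y := by
    refine eventually_all.2 fun j => ?_
    by_cases hj : j = j₀
    · exact Eventually.of_forall fun y h => absurd hj h
    filter_upwards [hσ', hv', (hpj j).continuousAt.eventually_ne
      (by rw [hp0]; exact hj₀ j hj : p y₀ j ≠ OnePoint.infty)] with y h1 h2 h3 _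
    exact residue_eq hs ((congrArg Subtype.val h1.1).trans h2.symm)
      ((congrFun h1.2 j).trans (hchart h3).symm)
  have hρc : ∀ j, j ≠ j₀ → ContMDiffAt (modelCoef s) 𝓘(ℂ, ℂ) ω (ρ j) y₀ := fun j hj =>
    contMDiffAt_div
      ((HolomorphicCoeffAt.numPoly hs hv).eval (fun _ => numPoly_natDegree_le hs _) (hzc j hj))
      ((HolomorphicCoeffAt.denPoly hs hv).derivative.eval
        (fun _ => (natDegree_derivative_le _).trans
          ((Nat.sub_le _ _).trans (denPoly_natDegree_le hs _))) (hzc j hj))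
      (hρev.self_of_nhds j hj).1
  have hres : ∀ j, ContMDiffAt (modelCoef s) 𝓘(ℂ, ℂ) ω (fun y => (σ y).1.1.1 j) y₀ := by
    have hne : ∀ j, j ≠ j₀ → ContMDiffAt (modelCoef s) 𝓘(ℂ, ℂ) ω (fun y => (σ y).1.1.1 j) y₀ :=
      fun j hj => (hρc j hj).congr_of_eventuallyEq (hρev.mono fun y hy => (hy j hj).2)
    intro j
    by_cases hj : j = j₀
    · subst hj
      have h1 : ContMDiffAt (modelCoef s) 𝓘(ℂ, ℂ) ω
          (fun y => -∑ i ∈ Finset.univ.erase j, (σ y).1.1.1 i) y₀ :=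
        (ContMDiffAt.sum fun i hi => hne i (Finset.mem_erase.1 hi).1).neg
      refine h1.congr_of_eventuallyEq (Eventually.of_forall fun y => ?_)
      have h2 : ∑ i, (σ y).1.1.1 i = 0 := (σ y).1.1.2
      rw [← Finset.add_sum_erase _ _ (Finset.mem_univ j)] at h2
      exact eq_neg_of_add_eq_zero_left h2
    · exact hne j hj
  refine ⟨σ, ?_, ?_, hσ'.mono fun y hy => hy.1⟩
  · refine ContMDiffAt.prodMk (f := fun y => (σ y).1) (g := fun y => (σ y).2) ?_ ?_
    · exact contMDiffAt_of_val_comp (contMDiffAt_residueHyperplane (contMDiffAt_pi_space.2 hres))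
    · exact contMDiffAt_of_val_comp (hpc.congr_of_eventuallyEq (hσ'.mono fun y hy => hy.2))
  · obtain ⟨h1, h2⟩ := hσ'.self_of_nhds
    exact eq_of_rpLift_eq_of_poles hs h1 (Subtype.ext (h2.trans hp0))

/-- The charts of the quotient are local inverses of the projection followed by charts of
`H_s × (Ĉˢ ∖ Δ)`. -/
theorem exists_of_mem_atlas_rp
    {e : OpenPartialHomeomorph (OmegaRP s) (ModelProd (residueHyperplane s) (Fin s → ℂ))}
    (he : e ∈ atlas (ModelProd (residueHyperplane s) (Fin s → ℂ)) (OmegaRP s)) :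
    ∃ (β : OpenPartialHomeomorph (OmegaRP s) (residueSpace s × poleSpace s))
      (c : OpenPartialHomeomorph (residueSpace s × poleSpace s) _),
      c ∈ atlas (ModelProd (residueHyperplane s) (Fin s → ℂ)) (residueSpace s × poleSpace s) ∧
      (∀ x, β.symm x = rpPoint x.1 x.2) ∧ e = β.trans c := by
  obtain ⟨q, rfl⟩ := he
  exact ⟨_, _, chart_mem_atlas _ _,
    fun x => congrFun (IsLocalHomeomorph.localInverseAt_symm _ _) x, rfl⟩

theorem isChartwiseBiholomorphic_rpEquiv :
    IsChartwiseBiholomorphic (modelRP s) (modelCoef s) (rpEquiv hs) := by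
  -- a local inverse `β` of the projection turns the inverse map into a local section
  have key : ∀ (β : OpenPartialHomeomorph (OmegaRP s) (residueSpace s × poleSpace s))
      (hβ : ∀ x, β.symm x = rpPoint x.1 x.2) (y : OmegaCoef s), (rpEquiv hs).symm y ∈ β.source →
      (∀ᶠ z in 𝓝 y, (rpEquiv hs).symm z ∈ β.source) ∧
        ContMDiffAt (modelCoef s) (modelRP s) ω (fun z => β ((rpEquiv hs).symm z)) y := by
    intro β hβ y hy
    set x₀ := β ((rpEquiv hs).symm y) with hx₀
    have hx₀t : x₀ ∈ β.target := β.map_source hy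
    have hxy : rpLift hs x₀ = y := by
      have h1 : rpEquiv hs (β.symm x₀) = y := by
        rw [hx₀, β.left_inv hy, Equiv.apply_symm_apply]
      rwa [hβ] at h1
    obtain ⟨σ, h1, h2, h3⟩ := exists_rpLift_section hs x₀
    rw [hxy] at h1 h2 h3
    have h4 : ∀ᶠ z in 𝓝 y, σ z ∈ β.target :=
      h1.continuousAt.eventually (β.open_target.mem_nhds (by rwa [h2]))
    have h5 : ∀ᶠ z in 𝓝 y, (rpEquiv hs).symm z = β.symm (σ z) := by
      filter_upwards [h3] with z hz
      rw [Equiv.symm_apply_eq, hβ]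
      exact hz.symm
    constructor
    · filter_upwards [h4, h5] with z h6 h7
      rw [h7]
      exact β.map_target h6
    · refine h1.congr_of_eventuallyEq ?_
      filter_upwards [h4, h5] with z h6 h7
      rw [h7, β.right_inv h6]
  constructor
  · intro e he x hx
    obtain ⟨β, c, hc, hβ, rfl⟩ := exists_of_mem_atlas_rp he
    rw [OpenPartialHomeomorph.trans_target] at hx
    have h1 := contMDiffAt_symm_of_mem_maximalAtlas (I := modelRP s) (n := ω)
      (IsManifold.subset_maximalAtlas hc) hx.1
    refine ((contMDiff_rpLift hs).contMDiffAt.comp x h1).congr_of_eventuallyEq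
      (Eventually.of_forall fun z => ?_)
    simp only [Function.comp_apply, OpenPartialHomeomorph.coe_trans_symm, hβ]
    rfl
  · intro e he y hy
    obtain ⟨β, c, hc, hβ, rfl⟩ := exists_of_mem_atlas_rp he
    rw [OpenPartialHomeomorph.trans_source] at hy ⊢
    obtain ⟨h1, h2⟩ := key β hβ y hy.1
    filter_upwards [h1, h2.continuousAt.eventually (c.open_source.mem_nhds hy.2)] with z h3 h4
    exact ⟨h3, h4⟩
  · intro e he y hy
    obtain ⟨β, c, hc, hβ, rfl⟩ := exists_of_mem_atlas_rp he
    rw [OpenPartialHomeomorph.trans_source] at hy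
    have h1 := contMDiffAt_of_mem_maximalAtlas (I := modelRP s) (n := ω)
      (IsManifold.subset_maximalAtlas hc) hy.2
    exact ContMDiffAt.comp (f := fun z => β ((rpEquiv hs).symm z)) y h1 (key β hβ y hy.1).2

end

/-! ### Dimensions -/

theorem finrank_residueHyperplane_add_one {s : ℕ} (hs : 2 ≤ s) :
    Module.finrank ℂ (residueHyperplane s) + 1 = s := by
  set f : Module.Dual ℂ (Fin s → ℂ) := ∑ i, LinearMap.proj i with hf
  have hker : residueHyperplane s = LinearMap.ker f := by
    ext r
    rw [LinearMap.mem_ker, hf, LinearMap.sum_apply]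
    rfl
  have hf0 : f ≠ 0 := by
    intro h
    have := LinearMap.congr_fun h (Pi.single ⟨0, by omega⟩ 1)
    simp [hf, LinearMap.sum_apply] at this
  rw [hker, Module.Dual.finrank_ker_add_one_of_ne_zero hf0, Module.finrank_fin_fun]

theorem isComplexManifold_omegaCoef (s : ℕ) : IsComplexManifold (modelCoef s) (OmegaCoef s) where
  t2 := inferInstance
  secondCountable := inferInstance
  isManifold := inferInstance

end

end SimplePoles

theorem theorem2p1 (s : ℕ) (hs : 2 ≤ s) :
    -- the three models are complex manifolds of dimension `2 s - 1`
    (SimplePoles.IsComplexManifold (SimplePoles.modelCoef s) (SimplePoles.OmegaCoef s) ∧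
      SimplePoles.IsComplexManifold (SimplePoles.modelZP s) (SimplePoles.OmegaZP s hs) ∧
      SimplePoles.IsComplexManifold (SimplePoles.modelRP s) (SimplePoles.OmegaRP s)) ∧
    (Module.finrank ℂ (Fin (2 * s - 1) → ℂ) = 2 * s - 1 ∧
      Module.finrank ℂ (((Fin (s - 2) → ℂ) × (Fin s → ℂ)) × ℂ) = 2 * s - 1 ∧
      Module.finrank ℂ (SimplePoles.residueHyperplane s × (Fin s → ℂ)) = 2 * s - 1) ∧
    -- the explicit maps to the coefficient model are biholomorphisms
    ∃ (Cs : SimplePoles.OmegaRP s ≃ₘ^ω⟮SimplePoles.modelRP s, SimplePoles.modelCoef s⟯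
        SimplePoles.OmegaCoef s)
      (Fs : SimplePoles.OmegaZP s hs ≃ₘ^ω⟮SimplePoles.modelZP s, SimplePoles.modelCoef s⟯
        SimplePoles.OmegaCoef s)
      (Gs : SimplePoles.OmegaZP s hs ≃ₘ^ω⟮SimplePoles.modelZP s, SimplePoles.modelRP s⟯
        SimplePoles.OmegaRP s),
      (∀ (r : SimplePoles.residueSpace s) (p : SimplePoles.poleSpace s),
        ∃ h : SimplePoles.rpVec r p ≠ 0,
          (Cs (SimplePoles.rpPoint r p) : SimplePoles.CP (2 * s - 1)) =
            Projectivization.mk ℂ (SimplePoles.rpVec r p) h) ∧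
      (∀ (α : SimplePoles.BundleIndex s), ∀ u ∈ SimplePoles.trivSet α, ∀ l : ℂˣ,
        ∃ h : SimplePoles.zpVec α u l ≠ 0,
          (Fs (SimplePoles.zpPoint hs α u l) : SimplePoles.CP (2 * s - 1)) =
            Projectivization.mk ℂ (SimplePoles.zpVec α u l) h) ∧
      (∀ x, Cs (Gs x) = Fs x) := by
  have hzp := SimplePoles.isChartwiseBiholomorphic_zpEquiv hs
  have hrp := SimplePoles.isChartwiseBiholomorphic_rpEquiv hs
  refine ⟨⟨SimplePoles.isComplexManifold_omegaCoef s, hzp.isComplexManifold,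
    hrp.isComplexManifold⟩, ⟨?_, ?_, ?_⟩, hrp.diffeomorph, hzp.diffeomorph,
    hzp.diffeomorph.trans hrp.diffeomorph.symm, ?_, ?_, ?_⟩
  · exact Module.finrank_fin_fun ℂ
  · rw [Module.finrank_prod, Module.finrank_prod, Module.finrank_fin_fun, Module.finrank_fin_fun,
      Module.finrank_self]
    omega
  · have := SimplePoles.finrank_residueHyperplane_add_one hs
    rw [Module.finrank_prod, Module.finrank_fin_fun]
    omega
  · exact fun r p => ⟨SimplePoles.rpVec_ne_zero hs r p, rfl⟩
  · exact fun α u hu l => ⟨SimplePoles.zpVec_ne_zero hs hu l, SimplePoles.zpMap_zpPoint hs hu l⟩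
  · exact fun x => hrp.diffeomorph.apply_symm_apply _
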